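/- Conventions. Let $L\subset S^2$ be a diagram of an oriented link (possibly split, possibly with components without crossings), with a marked point $p\in L$ which is not a crossing. Let $X$ be its set of crossings, $n_+$ the number of right-handed crossings, $\mathcal F$ the set of faces (components of the complement in $S^2$ of the projection), $R_L=\mathbb Z/2[x_f: f\in\mathcal F]$ and $\mathbb F_L=\operatorname{Frac}(R_L)$. For $S\subset X$ let $L_S$ be the resolution in which the crossings in $S$ receive the $1$-resolution and all others the $0$-resolution (Khovanov's convention). For a circle $C$ of $L_S$ not containing $p$ let $[C]\in R_L$ be the sum of the variables $x_f$ over the faces in the component of $S^2\setminus C$ that does not contain $p$. Let $\mathcal V(L_S)$ be the $\mathbb F_L$-vector space whose basis consists of all decorations of the unmarked circles of $L_S$ by $v_+$ or $v_-$ (the marked circle carries $v_0$, treated as $v_-$ below). The totally twisted complex over $\mathbb F_L$ is $KT_*(L)=\bigoplus_{S\subset X}\mathcal V(L_S)$ with differential $\partial=\partial_{\mathcal V}+\partial_{KH}$. Here $\partial_{\mathcal V}$ is the sum over the unmarked circles $C$ of the maps $v_+\mapsto [C]\,v_-$, $v_-\mapsto 0$ on the factor of $C$, and $\partial_{KH}$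 is the sum over $S$ and $c\notin S$ of the maps $\mathcal V(L_S)\to\mathcal V(L_{S\cup\{c\}})$ given, when two circles merge, by $v_+v_+\mapsto v_+$, $v_+v_-\mapsto v_-$, $v_-v_+\mapsto v_-$, $v_-v_-\mapsto 0$, when a circle divides, by $v_+\mapsto v_+ v_-+v_- v_+$, $v_-\mapsto v_- v_-$, and by the identity on all other circles. A basis element of $\mathcal V(L_S)$ with $a$ signs $+$ and $b$ signs $-$ on the unmarked circles has degree $|S|-(a-b)-n_+$. Let $O(L)$ be the set of all $S\subset X$ such that $L_S$ is a single circle. The spanning tree complex $CT(L)$ is the $\mathbb F_L$-vector space with basis $O(L)$, with $T$ in degree $|T|-n_+$, and $$\partial_L T=\sum_{T'\in O(L),\ T\subset T',\ |T'|=|T|+2}\left(\frac1{[B_{T,T'}]}+\frac1{[W_{T,T'}]}\right)T',$$ where, for $T'\setminus T=\{c_1,c_2\}$, $[B_{T,T'}]$ and $[W_{T,T'}]$ are the areas $[C]$ of the unmarked circles $C$ of the two-circle resolutions $L_{T\cup\{c_1\}}$ and $L_{T\cup\{c_2\}}$. Theorem. Over $\mathbb F_L$, $KT_*(L)$ and $CT(L)$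 are graded complexes with differentials of degree $2$, and: 1. $CT(L)$ is isomorphic, as a graded complex, to a subcomplex of $KT_*(L)$ which is a deformation retract of $KT_*(L)$. 2. The subspaces $\bigoplus_{|S|\ge i}\mathcal V(L_S)$, $i\in\mathbb Z$, form a filtration of $KT_*(L)$ by subcomplexes. In the associated spectral sequence $(E^r,d_r)_{r\ge 0}$, with $d_r$ raising the filtration index by $r$, the page $(E^2,d_2)$ is isomorphic to $(CT(L),\partial_L)$, as a complex, compatibly with the filtration index (which is $|T|$ for $T\in O(L)$) and the degree; and the sequence collapses at $E^3$, i.e. $d_r=0$ for all $r\ge 3$. 3. The faces of $L$ admit a checkerboard coloring. For each checkerboard coloring and either color $b$, let the Tait graph of color $b$ be the multigraph whose vertices are the faces of color $b$ and whose edges are the crossings, each joining the two opposite faces of color $b$ at the crossing. Assign to $S\in O(L)$ the set $T_b(S)\subset X$ of all crossings at which $L_S$ merges the two corners of color $b$. Then $S\mapsto T_b(S)$ is a bijection from $O(L)$ onto the set of all $T\subset X$ such that $T$ is a spanning tree of the Tait graph of color $b$ and $X\setminus T$ is a spanning tree of the Tait graph of the other color. If the projection of $L$ is connected, it is a bijection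 from $O(L)$ onto the set of all spanning trees of the Tait graph of color $b$. -/

import Mathlib

/-! ### Link diagrams on the two-sphere -/

/-- A finite graph in which every vertex has valence four, possibly with additional closed edges
without vertices.  `X` is the set of vertices (crossings) and `D` the set of oriented edges
(darts); `rev` reverses an oriented edge.  `dart c 0, dart c 1, dart c 2, dart c 3` are the four
oriented edges which leave the crossing `c`.  An edge neither of whose two orientations leaves a
crossing is a closed curve without crossings. -/
structure FourValentGraph (X D : Type*) where
  rev : D → D
  rev_rev : ∀ d, rev (rev d) = d
  rev_ne : ∀ d, rev d ≠ d
  dart : X → ZMod 4 → D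
  dart_injective : Function.Injective2 dart
  rev_dart : ∀ c i, ∃ c' i', rev (dart c i) = dart c' i'

namespace FourValentGraph

variable {X D : Type*}

/-- Elementary steps inside a connected component of the graph. -/
inductive Step (G : FourValentGraph X D) : D → D → Prop
  | edge (d : D) : Step G d (G.rev d)
  | crossing (c : X) (i j : ZMod 4) : Step G (G.dart c i) (G.dart c j)

/-- The connected components of the graph. -/
def Component (G : FourValentGraph X D) : Type _ := Quot G.Step

/-- The graph is connected (and nonempty). -/
def IsConnected (G : FourValentGraph X D) : Prop := Nat.card G.Component = 1

end FourValentGraph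

/-- An oriented link diagram on the oriented sphere `S²`, up to isotopy.  The diagram may be split
and may have components without crossings.

* `dart c 0, dart c 1, dart c 2, dart c 3` leave the crossing `c` in counterclockwise order;
  `dart c 0`, `dart c 2` belong to the lower strand and `dart c 1`, `dart c 3` to the upper one.
* `F` is the set of faces, i.e. of components of the complement of the projection, and `left d` is
  the face to the left of the oriented edge `d`.  Hence `left (dart c i)` is the face which
  contains the corner at `c` between `dart c i` and `dart c (i + 1)`, and the face to the right of
  `dart c i` is the one at the corner between `dart c (i - 1)` and `dart c i`.
* `connected` and `euler` express that the faces and the projection fit together to a connected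
  closed surface whose faces are planar, and that it is a sphere:  a graph on the sphere with `V`
  vertices, `E` edges and `k` components has `1 + k - V + E` faces, here `E - V = |X|` (a closed
  edge without crossings is given one auxiliary vertex); for any other such gluing, i.e. for
  positive genus, the number of faces is smaller.
* `forward d` says that `d` points in the direction of the orientation of the link. -/
structure LinkDiagram (X D F : Type*) extends FourValentGraph X D where
  left : D → F
  left_surjective : Function.Surjective left
  left_rev_dart : ∀ c i, left (rev (dart c i)) = left (dart c (i - 1))
  connected : ∀ d d', Relation.EqvGen
    (fun a b => toFourValentGraph.Step a b ∨ left a = left b) d d'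
  euler : Nat.card F = Nat.card X + Nat.card toFourValentGraph.Component + 1
  forward : D → Prop
  forward_rev : ∀ d, forward (rev d) ↔ ¬ forward d
  forward_dart : ∀ c i, forward (dart c (i + 2)) ↔ ¬ forward (dart c i)

/-- The polynomial ring over `ℤ/2ℤ` with one formal variable for each face. -/
abbrev FaceRing (F : Type*) : Type _ := MvPolynomial F (ZMod 2)

/-- The field of fractions of `FaceRing F`. -/
abbrev FaceField (F : Type*) : Type _ := FractionRing (FaceRing F)

/-! ### Filtered complexes and their spectral sequences -/

section Homological

variable {K M : Type*} [CommRing K] [AddCommGroup M] [Module K M]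

/-- `d` is a differential of degree `2` on the module `M = ⨁ gr n`. -/
structure IsGradedComplex (gr : ℤ → Submodule K M) (d : M →ₗ[K] M) : Prop where
  internal : DirectSum.IsInternal gr
  d_d : ∀ x, d (d x) = 0
  d_mem : ∀ n, ∀ x ∈ gr n, d x ∈ gr (n + 2)

/-- A graded complex with a bounded decreasing filtration by graded subcomplexes. -/
structure IsFilteredComplex (gr : ℤ → Submodule K M) (fil : ℤ → Submodule K M)
    (d : M →ₗ[K] M) : Prop extends IsGradedComplex gr d where
  antitone : Antitone fil
  exists_eq_top : ∃ p, fil p = ⊤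
  exists_eq_bot : ∃ p, fil p = ⊥
  homogeneous : ∀ p, fil p = ⨆ n, fil p ⊓ gr n
  d_mem_fil : ∀ p, ∀ x ∈ fil p, d x ∈ fil p

/-- The submodule `N` is a subcomplex of the graded complex `(M, d)` onto which `(M, d)` deformation
retracts: there are a graded chain map `r : M → N` which is the identity on `N` and a homotopy `h`
from the identity of `M` to `r`. -/
structure IsDeformationRetract (gr : ℤ → Submodule K M) (d : M →ₗ[K] M) (N : Submodule K M) :
    Prop where
  d_mem : ∀ x ∈ N, d x ∈ N
  exists_retraction : ∃ (r : M →ₗ[K] N) (h : M →ₗ[K] M),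
    (∀ x, (r (d x) : M) = d (r x)) ∧
    (∀ x : N, r x = x) ∧
    (∀ n, ∀ x ∈ gr n, (r x : M) ∈ gr n) ∧
    (∀ n, ∀ x ∈ gr n, h x ∈ gr (n - 2)) ∧
    (∀ x, (r x : M) - x = d (h x) + h (d x))

/-- `Z^r_p` in degree `n`: the elements of degree `n` in the `p`-th step of the filtration whose
differential lies in the step `p + r`. -/
def specZ (gr fil : ℤ → Submodule K M) (d : M →ₗ[K] M) (r p n : ℤ) : Submodule K M :=
  fil p ⊓ gr n ⊓ (fil (p + r)).comap d

/-- The denominator `Z^{r-1}_{p+1} + d Z^{r-1}_{p-r+1}` of `E^r_p`, in degree `n`. -/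
def specB (gr fil : ℤ → Submodule K M) (d : M →ₗ[K] M) (r p n : ℤ) : Submodule K M :=
  specZ gr fil d (r - 1) (p + 1) n ⊔ (specZ gr fil d (r - 1) (p - r + 1) (n - 2)).map d

/-- The term `E^r_p` in degree `n` of the spectral sequence of a filtered complex. -/
abbrev SpecPage (gr fil : ℤ → Submodule K M) (d : M →ₗ[K] M) (r p n : ℤ) : Type _ :=
  specZ gr fil d r p n ⧸ (specB gr fil d r p n).comap (specZ gr fil d r p n).subtype

theorem IsFilteredComplex.d_mem_specZ {gr fil : ℤ → Submodule K M} {d : M →ₗ[K] M}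
    (h : IsFilteredComplex gr fil d) (r p n : ℤ) (x : M) (hx : x ∈ specZ gr fil d r p n) :
    d x ∈ specZ gr fil d r (p + r) (n + 2) := by
  obtain ⟨⟨_, hx2⟩, hx3⟩ := hx
  refine ⟨⟨hx3, h.d_mem n x hx2⟩, ?_⟩
  simp [h.d_d]

/-- The restriction of `d` to a map `Z^r_p → Z^r_{p+r}`. -/
def IsFilteredComplex.cycleMap {gr fil : ℤ → Submodule K M} {d : M →ₗ[K] M}
    (h : IsFilteredComplex gr fil d) (r p n : ℤ) :
    specZ gr fil d r p n →ₗ[K] specZ gr fil d r (p + r) (n + 2) :=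
  d.restrict (h.d_mem_specZ r p n)

/-- The differential `d_r : E^r_p → E^r_{p+r}` induced by `d`. -/
def IsFilteredComplex.pageD {gr fil : ℤ → Submodule K M} {d : M →ₗ[K] M}
    (h : IsFilteredComplex gr fil d) (r p n : ℤ) :
    SpecPage gr fil d r p n →ₗ[K] SpecPage gr fil d r (p + r) (n + 2) :=
  Submodule.mapQ _ _ (h.cycleMap r p n) (by
    rintro ⟨x, hx⟩ hB
    obtain ⟨a, ha, b, ⟨y, _, rfl⟩, hab⟩ := Submodule.mem_sup.1 (show x ∈ specB gr fil d r p n from hB)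
    change d x ∈ specB gr fil d r (p + r) (n + 2)
    have hdx : d x = d a := by
      have hxe : x = a + d y := hab.symm
      rw [hxe, map_add, h.d_d, add_zero]
    rw [hdx]
    refine Submodule.mem_sup_right ⟨a, ?_, rfl⟩
    have e1 : p + r - r + 1 = p + 1 := by ring
    have e2 : n + 2 - 2 = n := by ring
    rw [e1, e2]
    exact ha)

end Homological

/-! ### Spanning trees of multigraphs -/

/-- The edges in `T` form a spanning tree of the multigraph `G`: they connect all vertices, and the
ends of an edge in `T` are not connected by the other edges in `T`, so that there is no cycle. -/
structure Graph.IsSpanningTree {V E : Type*} (G : Graph V E) (T : Set E) : Prop where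
  subset : T ⊆ G.edgeSet
  nonempty : G.vertexSet.Nonempty
  connected : ∀ x ∈ G.vertexSet, ∀ y ∈ G.vertexSet,
    Relation.ReflTransGen (fun a b => ∃ e ∈ T, G.IsLink e a b) x y
  acyclic : ∀ e ∈ T, ∀ x y, G.IsLink e x y →
    ¬ Relation.ReflTransGen (fun a b => ∃ e' ∈ T \ {e}, G.IsLink e' a b) x y

namespace LinkDiagram

variable {X D F : Type*} [Fintype X] [DecidableEq X] [Fintype D] [Fintype F]

/-! ### Resolutions, circles and formal areas -/

/-- The number of right-handed crossings: the upper strand runs from `dart c 3` to `dart c 1` and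
the lower one from `dart c 0` to `dart c 2`, or both are reversed. -/
noncomputable def nPlus (L : LinkDiagram X D F) : ℕ :=
  Nat.card {c : X // L.forward (L.dart c 1) ↔ L.forward (L.dart c 2)}

/-- Elementary steps along the resolution `L_S`.  A crossing `c ∉ S` receives the `0`-resolution,
which joins the ends `0, 1` and the ends `2, 3`, so that the corner between `1` and `2` is merged
with the corner between `3` and `0` (the two corners swept out when the upper strand is turned
counterclockwise).  A crossing `c ∈ S` receives the `1`-resolution, which joins `1, 2` and
`3, 0`. -/
inductive Join (L : LinkDiagram X D F) (S : Finset X) : D → D → Prop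
  | edge (d : D) : Join L S d (L.rev d)
  | zero_left (c : X) (hc : c ∉ S) : Join L S (L.dart c 0) (L.dart c 1)
  | zero_right (c : X) (hc : c ∉ S) : Join L S (L.dart c 2) (L.dart c 3)
  | one_left (c : X) (hc : c ∈ S) : Join L S (L.dart c 1) (L.dart c 2)
  | one_right (c : X) (hc : c ∈ S) : Join L S (L.dart c 3) (L.dart c 0)

/-- The set of circles of the resolution `L_S`. -/
def Circle (L : LinkDiagram X D F) (S : Finset X) : Type _ := Quot (L.Join S)

/-- The circle of `L_S` which contains the edge `d`. -/
def circ (L : LinkDiagram X D F) (S : Finset X) (d : D) : L.Circle S := Quot.mk _ d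

instance (L : LinkDiagram X D F) (S : Finset X) : Finite (L.Circle S) :=
  inferInstanceAs (Finite (Quot (L.Join S)))

noncomputable instance (L : LinkDiagram X D F) (S : Finset X) : Fintype (L.Circle S) :=
  Fintype.ofFinite _

noncomputable instance (L : LinkDiagram X D F) (S : Finset X) : DecidableEq (L.Circle S) :=
  Classical.decEq _

/-- Elementary steps between faces inside `S² ∖ C`, for a circle `C` of `L_S`: across an edge which
does not lie on `C`, or through the two corners merged by the resolution of a crossing. -/
inductive SideStep (L : LinkDiagram X D F) (S : Finset X) (C : L.Circle S) : F → F → Prop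
  | edge (d : D) (hd : L.circ S d ≠ C) : SideStep L S C (L.left d) (L.left (L.rev d))
  | zero (c : X) (hc : c ∉ S) : SideStep L S C (L.left (L.dart c 1)) (L.left (L.dart c 3))
  | one (c : X) (hc : c ∈ S) : SideStep L S C (L.left (L.dart c 0)) (L.left (L.dart c 2))

/-- The interior of an unmarked circle `C` of `L_S`, as a set of faces: the component of `S² ∖ C`
which does not contain the marked point, i.e. the faces which are not in the same component
of `S² ∖ C` as the faces at the marked edge `p`. -/
def disc (L : LinkDiagram X D F) (p : D) (S : Finset X) (C : L.Circle S) : Set F :=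
  {f | ¬ Relation.EqvGen (L.SideStep S C) (L.left p) f}

open scoped Classical in
/-- The formal area of the interior of an unmarked circle. -/
noncomputable def area (L : LinkDiagram X D F) (p : D) (S : Finset X) (C : L.Circle S) :
    FaceRing F :=
  ∑ f : F with f ∈ L.disc p S C, MvPolynomial.X f

/-! ### The totally twisted Khovanov complex -/

/-- Pure states on `L_S`: decorations of the circles by `v₊` (`true`) and `v₋` (`false`).  The
generator `v₀` of the marked circle is treated as `v₋`. -/
abbrev State (L : LinkDiagram X D F) (p : D) (S : Finset X) : Type _ :=
  {ε : L.Circle S → Bool // ε (L.circ S p) = false}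

noncomputable instance (L : LinkDiagram X D F) (p : D) (S : Finset X) : Fintype (L.State p S) :=
  Fintype.ofFinite _

/-- Change the decoration of the circle `C` to `v₋`. -/
noncomputable def State.lower {L : LinkDiagram X D F} {p : D} {S : Finset X} (ε : L.State p S)
    (C : L.Circle S) : L.State p S :=
  ⟨Function.update ε.1 C false, by
    have h := ε.2
    rw [Function.update_apply]
    split_ifs
    · rfl
    · exact h⟩

/-- The basis of pure states of the totally twisted Khovanov complex. -/
def KTGen (L : LinkDiagram X D F) (p : D) : Type _ := Σ S : Finset X, L.State p S

/-- The module underlying the totally twisted Khovanov complex, with coefficients in `A`. -/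
abbrev KT (L : LinkDiagram X D F) (p : D) (A : Type*) [CommRing A] : Type _ := L.KTGen p →₀ A

/-- `u` occurs in `μ (s ⊗ t)`. -/
def MulTerm (s t u : Bool) : Prop :=
  (s = true ∧ t = true ∧ u = true) ∨ (s ≠ t ∧ u = false)

/-- `u ⊗ v` occurs in `Δ s`. -/
def ComulTerm (s u v : Bool) : Prop :=
  (s = true ∧ u ≠ v) ∨ (s = false ∧ u = false ∧ v = false)

open scoped Classical in
/-- The pure state `ε'` on `L_{S ∪ {c}}` occurs in the image of the pure state `ε` on `L_S` under
the Khovanov map: the decorations agree on the circles which do not run through `c`, and at `c`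
either one circle is divided or two circles are merged. -/
def KhTerm (L : LinkDiagram X D F) (p : D) (S : Finset X) (c : X) (ε : L.State p S)
    (ε' : L.State p (insert c S)) : Prop :=
  (∀ d : D, L.circ S d ≠ L.circ S (L.dart c 0) → L.circ S d ≠ L.circ S (L.dart c 2) →
    ε'.1 (L.circ (insert c S) d) = ε.1 (L.circ S d)) ∧
  if L.circ S (L.dart c 0) = L.circ S (L.dart c 2) then
    ComulTerm (ε.1 (L.circ S (L.dart c 0)))
      (ε'.1 (L.circ (insert c S) (L.dart c 1))) (ε'.1 (L.circ (insert c S) (L.dart c 3)))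
  else
    MulTerm (ε.1 (L.circ S (L.dart c 0))) (ε.1 (L.circ S (L.dart c 2)))
      (ε'.1 (L.circ (insert c S) (L.dart c 1)))

section Differentials

variable (L : LinkDiagram X D F) (p : D) (A : Type*) [CommRing A] [Algebra (FaceRing F) A]

/-- The Koszul differential `∂_𝒱`: on each `𝒱(L_S)` it is the sum over the unmarked circles `C` of
the maps `v₊ ↦ [C] v₋` on the factor of `C`. -/
noncomputable def koszulD : L.KT p A →ₗ[A] L.KT p A :=
  Finsupp.linearCombination A fun g : L.KTGen p =>
    ∑ C : L.Circle g.1, if g.2.1 C = true then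
      (Finsupp.single ⟨g.1, g.2.lower C⟩ (algebraMap (FaceRing F) A (L.area p g.1 C)) : L.KT p A)
    else 0

open scoped Classical in
/-- The Khovanov differential `∂_KH`. -/
noncomputable def khD : L.KT p A →ₗ[A] L.KT p A :=
  Finsupp.linearCombination A fun g : L.KTGen p =>
    ∑ c : X, if c ∈ g.1 then (0 : L.KT p A) else
      ∑ ε' : L.State p (insert c g.1), if L.KhTerm p g.1 c g.2 ε' then
        Finsupp.single ⟨insert c g.1, ε'⟩ 1 else 0

/-- The differential of the totally twisted Khovanov complex. -/
noncomputable def ktD : L.KT p A →ₗ[A] L.KT p A := L.khD p A + L.koszulD p A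

/-- The `q`-grading of a pure state of the unshifted complex: the sum of the decorations `±1` of the
unmarked circles, shifted by `|S|`. -/
noncomputable def qDeg (g : L.KTGen p) : ℤ :=
  (∑ C : L.Circle g.1, if C = L.circ g.1 p then 0 else if g.2.1 C = true then 1 else -1) + g.1.card

/-- The `δ`-grading `2 h - q` with `h = |S|`, shifted by `-n₊`. -/
noncomputable def ktDeg (g : L.KTGen p) : ℤ := 2 * g.1.card - L.qDeg p g - L.nPlus

/-- The part of the totally twisted Khovanov complex in (shifted) `δ`-grading `n`. -/
noncomputable def ktGr (n : ℤ) : Submodule A (L.KT p A) :=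
  Finsupp.supported A A {g | L.ktDeg p g = n}

/-- The decreasing filtration of the totally twisted Khovanov complex by `|S|`. -/
noncomputable def ktFil (i : ℤ) : Submodule A (L.KT p A) :=
  Finsupp.supported A A {g | i ≤ g.1.card}

end Differentials

/-! ### The spanning tree complex -/

/-- The set of all `S` whose resolution `L_S` consists of a single circle. -/
def singleCircle (L : LinkDiagram X D F) : Set (Finset X) := {S | Nat.card (L.Circle S) = 1}

/-- The vector space spanned by the single circle resolutions. -/
abbrev CT (L : LinkDiagram X D F) : Type _ := L.singleCircle →₀ FaceField F

/-- The sum of `1 / [A(C)]` over the unmarked circles `C` of `L_S`. -/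
noncomputable def invArea (L : LinkDiagram X D F) (p : D) (S : Finset X) : FaceField F :=
  ∑ C : L.Circle S, if C = L.circ S p then 0 else
    (algebraMap (FaceRing F) (FaceField F) (L.area p S C))⁻¹

/-- The coefficient `⟨T, T'⟩ = 1 / [B] + 1 / [W]`, where for `T' ∖ T = {c₁, c₂}` the regions `B` and
`W` are the interiors of the unmarked circles in the two-circle resolutions `T ∪ {c₁}` and
`T ∪ {c₂}`. -/
noncomputable def pairing (L : LinkDiagram X D F) (p : D) (T T' : Finset X) : FaceField F :=
  ∑ c ∈ T' \ T, L.invArea p (insert c T)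

open scoped Classical in
/-- The differential of the spanning tree complex. -/
noncomputable def ctD (L : LinkDiagram X D F) (p : D) : L.CT →ₗ[FaceField F] L.CT :=
  Finsupp.linearCombination (FaceField F) fun T : L.singleCircle =>
    ∑ T' : L.singleCircle, if T.1 ⊆ T'.1 ∧ T'.1.card = T.1.card + 2 then
      (Finsupp.single T' (L.pairing p T.1 T'.1) : L.CT) else 0

/-- The part of the spanning tree complex, shifted by `-n₊`, in grading `n`: a single circle
resolution `T` has grading `|T| - n₊`. -/
noncomputable def ctGr (L : LinkDiagram X D F) (n : ℤ) : Submodule (FaceField F) L.CT :=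
  Finsupp.supported (FaceField F) (FaceField F) {T | (T.1.card : ℤ) - L.nPlus = n}

/-- The span of the single circle resolutions `T` with `|T| = i`. -/
noncomputable def ctLevel (L : LinkDiagram X D F) (i : ℤ) : Submodule (FaceField F) L.CT :=
  Finsupp.supported (FaceField F) (FaceField F) {T | (T.1.card : ℤ) = i}

/-! ### Checkerboard colorings and Tait graphs -/

/-- A checkerboard coloring: the faces on the two sides of each edge have different colors. -/
def IsCheckerboard (L : LinkDiagram X D F) (χ : F → Bool) : Prop :=
  ∀ d : D, χ (L.left (L.rev d)) ≠ χ (L.left d)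


set_option linter.unusedSectionVars false in
theorem IsCheckerboard.corner_ne {L : LinkDiagram X D F} {χ : F → Bool} (h : L.IsCheckerboard χ)
    (c : X) (i : ZMod 4) : χ (L.left (L.dart c (i - 1))) ≠ χ (L.left (L.dart c i)) := by
  have := h (L.dart c i)
  rwa [L.left_rev_dart] at this

/-- The Tait graph for the color `b`: its vertices are the faces of color `b`, and each crossing is
an edge which joins the two opposite corners of color `b` at the crossing. -/
def taitGraph (L : LinkDiagram X D F) (χ : F → Bool) (h : L.IsCheckerboard χ) (b : Bool) :
    Graph F X where
  vertexSet := {f | χ f = b}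
  IsLink c f g := χ f = b ∧ χ g = b ∧
    ∃ i : ZMod 4, f = L.left (L.dart c i) ∧ g = L.left (L.dart c (i + 2))
  isLink_symm := by
    rintro c -
    refine ⟨?_⟩
    rintro f g ⟨hf, hg, i, rfl, rfl⟩
    refine ⟨hg, hf, i + 2, rfl, ?_⟩
    have e : i + 2 + 2 = i := by
      have : (2 + 2 : ZMod 4) = 0 := by decide
      rw [add_assoc, this, add_zero]
    rw [e]
  eq_or_eq_of_isLink_of_isLink := by
    rintro c x y v w ⟨hx, -, i, rfl, rfl⟩ ⟨hv, -, j, rfl, rfl⟩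
    have h1 := h.corner_ne c
    have key : ∀ i j : ZMod 4, i = j ∨ i = j + 2 ∨ j = i - 1 ∨ i = j - 1 := by decide
    rcases key i j with rfl | rfl | rfl | rfl
    · exact Or.inl rfl
    · exact Or.inr rfl
    · exact absurd (hv.trans hx.symm) (h1 i)
    · exact absurd (hx.trans hv.symm) (h1 j)
  left_mem_of_isLink := by
    rintro c x y ⟨hx, -⟩
    exact hx

/-- The crossings at which the resolution `L_S` merges the two corners of color `b`. -/
def bridged (L : LinkDiagram X D F) (χ : F → Bool) (b : Bool) (S : Finset X) : Set X :=
  {c | if c ∈ S then χ (L.left (L.dart c 0)) = b else χ (L.left (L.dart c 1)) = b}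

end LinkDiagram

set_option linter.unusedSectionVars false

namespace LinkDiagram

variable {X D F : Type*}

/-! The Koszul differential makes 𝒱(L_S) a tensor product of two-term complexes v₊ ↦ [C] v₋, one for
each unmarked circle. Areas are nonzero (`area_ne_zero`), hence invertible in the field of
fractions, so a single unmarked circle suffices to contract 𝒱(L_S) (`koszulD_raiseH`). What survives
is one line for each resolution with only the marked circle.

The Khovanov part k commutes with the Koszul part and raises |S| by one. It is therefore a nilpotent
perturbation, and the homological perturbation lemma (`PerturbedContraction`) applies. With the
contracting homotopy H and G = (1 + Hk)⁻¹, the inclusion ι of the surviving part deforms to Gι,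
which embeds it as a deformation retract with differential πkGι. For degree reasons only πkHkι
contributes. It leads from T through the two-circle resolutions T ∪ {c}, where H produces 1/[C], to
T', and this is the tree differential (`ctD_eq`).

That the total differential squares to zero rests on two things. Algebraically, each edge map of the
cube commutes with the operators v₊ ↦ v₋ attached to the edges of the diagram (`khC_lowerD`), so
identities need checking only on the all-v₊ states (`eq_of_top`), where a merge is 1 ↦ 1 and a
division is 1 ↦ x + y. Topologically, exactly one of the two resolutions of a crossing divides the
circles there (`circ_insert_eq_iff_ne`), and areas add up modulo 2 when circles merge
(`area_eq_sum`).

The sphere enters through `exists_potential`: by a dimension count based on the Euler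
characteristic, every mod 2 cycle of the projection is the boundary of a set of faces. This yields a
checkerboard coloring, and for every circle a function on the faces which jumps exactly across it,
whose support is the interior. The coloring also directs the circles consistently, so that they
become orbits of a permutation; changing one resolution composes it with a transposition.

For the spectral sequence, embedding, retraction and homotopy all respect the filtration, and the
tree differential raises |T| by exactly two, so E² consists of leading terms (`ker_pageMap`). A
degree of CT lives at one level only, which leaves no room for later differentials
(`pageD_eq_zero`).

For the trees, a potential of circles is constant along the crossings at which corners are merged.
Connectedness and acyclicity of the merged crossings translate into statements about such
potentials, after changing the resolution of one crossing where needed. -/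

theorem sum_zmod_four {M : Type*} [AddCommMonoid M] (u : ZMod 4 → M) :
    ∑ i, u i = u 0 + u 1 + u 2 + u 3 :=
  Fin.sum_univ_four u

theorem forall_zmod_four {P : ZMod 4 → Prop} (h0 : P 0) (h1 : P 1) (h2 : P 2) (h3 : P 3) (i) :
    P i := by
  have : ∀ i : ZMod 4, i = 0 ∨ i = 1 ∨ i = 2 ∨ i = 3 := by decide
  rcases this i with rfl | rfl | rfl | rfl <;> assumption

/-! ### Corners at a crossing and connectedness of the set of faces. -/

section Corners

variable (L : LinkDiagram X D F) (c : X)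

theorem left_rev_dart_zero : L.left (L.rev (L.dart c 0)) = L.left (L.dart c 3) :=
  L.left_rev_dart c 0

theorem left_rev_dart_one : L.left (L.rev (L.dart c 1)) = L.left (L.dart c 0) :=
  L.left_rev_dart c 1

theorem left_rev_dart_two : L.left (L.rev (L.dart c 2)) = L.left (L.dart c 1) :=
  L.left_rev_dart c 2

theorem left_rev_dart_three : L.left (L.rev (L.dart c 3)) = L.left (L.dart c 2) :=
  L.left_rev_dart c 3

end Corners

/-- A relation on the faces which holds across every edge connects all faces. -/
theorem face_induction (L : LinkDiagram X D F) {r : F → F → Prop} (hr : Equivalence r)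
    (h : ∀ d, r (L.left (L.rev d)) (L.left d)) (f f' : F) : r f f' := by
  obtain ⟨d, rfl⟩ := L.left_surjective f
  obtain ⟨d', rfl⟩ := L.left_surjective f'
  -- Going around a crossing passes over its edges one at a time, so all four corners are related.
  have key : ∀ c i, r (L.left (L.dart c i)) (L.left (L.dart c 0)) := by
    intro c
    have h1 := h (L.dart c 1)
    have h2 := h (L.dart c 2)
    have h3 := h (L.dart c 3)
    rw [left_rev_dart_one] at h1
    rw [left_rev_dart_two] at h2
    rw [left_rev_dart_three] at h3
    exact forall_zmod_four (hr.refl _) (hr.symm h1) (hr.symm (hr.trans h1 h2))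
      (hr.symm (hr.trans h1 (hr.trans h2 h3)))
  induction L.connected d d' with
  | rel a b hab =>
    rcases hab with hab | hab
    · cases hab with
      | edge => exact hr.symm (h _)
      | crossing c i j => exact hr.trans (key c i) (hr.symm (key c j))
    · rw [hab]; exact hr.refl _
  | refl a => exact hr.refl _
  | symm a b _ ih => exact hr.symm ih
  | trans a b c _ _ ih1 ih2 => exact hr.trans ih1 ih2

/-! ### Cycles of the projection are boundaries -/

section Potential

variable (L : LinkDiagram X D F)

open scoped Classical in
/-- The representative of an unoriented edge which is oriented as the link. -/
noncomputable def fold (d : D) : {d : D // L.forward d} :=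
  if h : L.forward d then ⟨d, h⟩ else ⟨L.rev d, (L.forward_rev d).2 h⟩

theorem fold_coe (e : {d : D // L.forward d}) : L.fold e.1 = e := by
  simp [fold, e.2]

theorem fold_rev (d : D) : L.fold (L.rev d) = L.fold d := by
  by_cases h : L.forward d
  · simp [fold, h, L.forward_rev, L.rev_rev]
  · simp [fold, h, L.forward_rev]

theorem fold_eq_or (d : D) : (L.fold d).1 = d ∨ (L.fold d).1 = L.rev d := by
  by_cases h : L.forward d
  · simp [fold, h]
  · simp [fold, h]

theorem fold_eq_iff (d : D) (e : {d : D // L.forward d}) :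
    L.fold d = e ↔ d = e.1 ∨ d = L.rev e.1 := by
  constructor
  · rintro rfl
    rcases L.fold_eq_or d with h | h
    · exact Or.inl h.symm
    · right; rw [h, L.rev_rev]
  · rintro (rfl | rfl)
    · exact L.fold_coe e
    · rw [L.fold_rev, L.fold_coe]

/-- The edges without crossings. -/
abbrev ClosedEdge : Type _ := {e : {d : D // L.forward d} // ∀ c i, e.1 ≠ L.dart c i}

theorem fold_closed {d : D} (h : ¬ ∃ c i, d = L.dart c i) (c : X) (i : ZMod 4) :
    (L.fold d).1 ≠ L.dart c i := by
  rcases L.fold_eq_or d with e | e <;> rw [e]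
  · exact fun h' => h ⟨c, i, h'⟩
  · intro h'
    obtain ⟨c', i', h''⟩ := L.rev_dart c i
    rw [← h', L.rev_rev] at h''
    exact h ⟨c', i', h''⟩

open scoped Classical in
/-- The vertex from which an oriented edge leaves; closed edges have an auxiliary vertex. -/
noncomputable def source (d : D) : X ⊕ L.ClosedEdge :=
  if h : ∃ c i, d = L.dart c i then Sum.inl h.choose else Sum.inr ⟨L.fold d, L.fold_closed h⟩

theorem source_dart (c : X) (i : ZMod 4) : L.source (L.dart c i) = Sum.inl c := by
  have h : ∃ c' i', L.dart c i = L.dart c' i' := ⟨c, i, rfl⟩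
  obtain ⟨i', h'⟩ := h.choose_spec
  rw [source, dif_pos h, (L.dart_injective h').1.symm]

theorem source_of_closed {d : D} (h : ¬ ∃ c i, d = L.dart c i) :
    L.source d = Sum.inr ⟨L.fold d, L.fold_closed h⟩ := dif_neg h

theorem source_surjective : Function.Surjective L.source := by
  rintro (c | ⟨e, he⟩)
  · exact ⟨_, L.source_dart c 0⟩
  · refine ⟨e.1, ?_⟩
    rw [L.source_of_closed (by rintro ⟨c, i, h⟩; exact he c i h)]
    simp [fold_coe]

theorem source_eq_inl {d : D} {c : X} : L.source d = Sum.inl c ↔ ∃ i, d = L.dart c i := by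
  constructor
  · intro h
    by_cases h' : ∃ c i, d = L.dart c i
    · obtain ⟨c', i, rfl⟩ := h'
      rw [source_dart] at h
      exact ⟨i, by rw [Sum.inl.inj h]⟩
    · rw [L.source_of_closed h'] at h
      cases h
  · rintro ⟨i, rfl⟩
    exact L.source_dart c i

theorem source_eq_inr {d : D} {e : L.ClosedEdge} : L.source d = Sum.inr e ↔ L.fold d = e.1 := by
  constructor
  · intro h
    by_cases h' : ∃ c i, d = L.dart c i
    · obtain ⟨c', i, rfl⟩ := h'
      rw [source_dart] at h
      cases h
    · rw [L.source_of_closed h'] at h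
      rw [← Sum.inr.inj h]
  · intro h
    have h' : ¬ ∃ c i, d = L.dart c i := by
      rintro ⟨c, i, rfl⟩
      rcases L.fold_eq_or (L.dart c i) with h1 | h1
      · exact e.2 c i (by rw [← h, h1])
      · obtain ⟨c', i', h2⟩ := L.rev_dart c i
        exact e.2 c' i' (by rw [← h, h1, h2])
    rw [L.source_of_closed h']
    congr 1
    exact Subtype.ext h

open scoped Classical in
/-- A surjective parametrization of the edges: two at each crossing, and the closed ones. -/
noncomputable def edgeParam : (X × Bool) ⊕ L.ClosedEdge → {d : D // L.forward d}
  | Sum.inl (c, b) => L.fold (if L.forward (L.dart c (if b then 1 else 0)) then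
      L.dart c (if b then 1 else 0) else L.dart c (if b then 3 else 2))
  | Sum.inr e => e.1

/-- Opposite ends of a crossing lie on one strand, so exactly one of them is directed away from the
crossing. Hence two edges start at each crossing, which bounds the number of edges by 2|X| plus the
closed ones. -/
theorem edgeParam_surjective : Function.Surjective L.edgeParam := by
  classical
  intro e
  by_cases h : ∃ c i, e.1 = L.dart c i
  · obtain ⟨c, i, h⟩ := h
    have hf : L.forward (L.dart c i) := h ▸ e.2
    have h0 := L.forward_dart c 0
    have h1 := L.forward_dart c 1
    rw [zero_add] at h0
    rw [show (1 + 2 : ZMod 4) = 3 by decide] at h1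
    have key : ∃ b : Bool, (if L.forward (L.dart c (if b then 1 else 0)) then
      L.dart c (if b then 1 else 0) else L.dart c (if b then 3 else 2)) = L.dart c i := by
      clear h
      revert hf
      refine forall_zmod_four (P := fun i => L.forward (L.dart c i) → ∃ b : Bool, (if L.forward
        (L.dart c (if b then 1 else 0)) then L.dart c (if b then 1 else 0) else
        L.dart c (if b then 3 else 2)) = L.dart c i) ?_ ?_ ?_ ?_ i <;> intro hf
      · exact ⟨false, by simp [hf]⟩
      · exact ⟨true, by simp [hf]⟩
      · exact ⟨false, by simp [h0.1 hf]⟩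
      · exact ⟨true, by simp [h1.1 hf]⟩
    obtain ⟨b, hb⟩ := key
    refine ⟨Sum.inl (c, b), ?_⟩
    simp only [edgeParam]
    rw [hb, ← h, L.fold_coe]
  · exact ⟨Sum.inr ⟨e, fun c i h' => h ⟨c, i, h'⟩⟩, rfl⟩

variable [Fintype X] [Fintype D]

open scoped Classical in
/-- The incidence matrix of the projection modulo `2`. -/
noncomputable def incidence : Matrix (X ⊕ L.ClosedEdge) {d : D // L.forward d} (ZMod 2) :=
  fun v e => ∑ d : D, if L.source d = v ∧ L.fold d = e then 1 else 0

open scoped Classical in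
theorem incidence_mulVec (w : {d : D // L.forward d} → ZMod 2) (v) :
    L.incidence.mulVec w v = ∑ d : D with L.source d = v, w (L.fold d) := by
  simp only [Matrix.mulVec, dotProduct, incidence, Finset.sum_mul]
  rw [Finset.sum_comm, Finset.sum_filter]
  refine Finset.sum_congr rfl fun d _ => ?_
  by_cases h : L.source d = v <;> simp [h]

open scoped Classical in
theorem incidence_transpose_mulVec (h : X ⊕ L.ClosedEdge → ZMod 2) (e) :
    L.incidence.transpose.mulVec h e = h (L.source e.1) + h (L.source (L.rev e.1)) := by
  classical
  simp only [Matrix.mulVec, dotProduct, incidence, Finset.sum_mul, Matrix.transpose_apply]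
  rw [Finset.sum_comm]
  have : ∀ d : D, (∑ v, (if L.source d = v ∧ L.fold d = e then (1 : ZMod 2) else 0) * h v) =
      if L.fold d = e then h (L.source d) else 0 := by
    intro d
    by_cases h : L.fold d = e <;> simp [h]
  simp only [this]
  rw [← Finset.sum_filter]
  have h2 : (Finset.univ.filter fun d => L.fold d = e) = {e.1, L.rev e.1} := by
    ext d
    simp [L.fold_eq_iff]
  rw [h2, Finset.sum_pair (L.rev_ne _).symm]

open scoped Classical in
theorem sum_source_inr {w : {d : D // L.forward d} → ZMod 2} (e : L.ClosedEdge) :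
    L.incidence.mulVec w (Sum.inr e) = 0 := by
  classical
  rw [incidence_mulVec]
  have h2 : (Finset.univ.filter fun d => L.source d = Sum.inr e) = {e.1.1, L.rev e.1.1} := by
    ext d
    simp [L.fold_eq_iff, L.source_eq_inr]
  rw [h2, Finset.sum_pair (L.rev_ne _).symm, L.fold_rev, CharTwo.add_self_eq_zero]

open scoped Classical in
theorem sum_source_inl {w : {d : D // L.forward d} → ZMod 2} (c : X) :
    L.incidence.mulVec w (Sum.inl c) = ∑ i, w (L.fold (L.dart c i)) := by
  classical
  rw [incidence_mulVec]
  have h2 : (Finset.univ.filter fun d => L.source d = Sum.inl c) =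
      Finset.univ.image (L.dart c) := by
    ext d
    simp [L.source_eq_inl, eq_comm]
  rw [h2, Finset.sum_image]
  intro i _ j _ h
  exact (L.dart_injective h).2

instance finiteComponent : Finite L.toFourValentGraph.Component :=
  inferInstanceAs (Finite (Quot _))

open scoped Classical in
-- A kernel vector takes equal values at the two ends of every edge. Pulled back to the oriented
-- edges, which loses nothing since every vertex is a source, it factors through the components.
theorem finrank_ker_incidence_transpose :
    Module.finrank (ZMod 2) (LinearMap.ker L.incidence.transpose.mulVecLin) ≤
      Nat.card L.toFourValentGraph.Component := by
  classical
  have := Fintype.ofFinite L.toFourValentGraph.Component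
  set W := LinearMap.ker L.incidence.transpose.mulVecLin
  set s := LinearMap.funLeft (ZMod 2) (ZMod 2) L.source
  have hs : Function.Injective s :=
    LinearMap.funLeft_injective_of_surjective _ _ _ L.source_surjective
  set q : (L.toFourValentGraph.Component → ZMod 2) →ₗ[ZMod 2] D → ZMod 2 :=
    LinearMap.funLeft (ZMod 2) (ZMod 2) (Quot.mk _)
  have hle : W.map s ≤ LinearMap.range q := by
    rintro _ ⟨h, hh, rfl⟩
    have h1 : ∀ d, h (L.source d) = h (L.source (L.rev d)) := by
      have h2 : ∀ e : {d : D // L.forward d}, h (L.source e.1) = h (L.source (L.rev e.1)) := by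
        intro e
        have := congrFun (show L.incidence.transpose.mulVec h = 0 from hh) e
        rw [incidence_transpose_mulVec] at this
        exact CharTwo.add_eq_zero.1 this
      intro d
      by_cases hd : L.forward d
      · exact h2 ⟨d, hd⟩
      · have := h2 ⟨_, (L.forward_rev d).2 hd⟩
        rw [L.rev_rev] at this
        exact this.symm
    refine ⟨Quot.lift (fun d => h (L.source d)) ?_, ?_⟩
    · intro a b hab
      cases hab with
      | edge => exact h1 _
      | crossing c i j => simp only [source_dart]
    · rfl
  calc Module.finrank (ZMod 2) W = Module.finrank (ZMod 2) (W.map s) :=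
        (LinearEquiv.finrank_eq (Submodule.equivMapOfInjective s hs W))
    _ ≤ Module.finrank (ZMod 2) (LinearMap.range q) := Submodule.finrank_mono hle
    _ ≤ Module.finrank (ZMod 2) (L.toFourValentGraph.Component → ZMod 2) :=
        LinearMap.finrank_range_le q
    _ = _ := by rw [Module.finrank_fintype_fun_eq_card, Nat.card_eq_fintype_card]

open scoped Classical in
-- The first Betti number is E - V + k: a matrix and its transpose have equal rank, V = |X| +
-- #closed and E ≤ 2|X| + #closed.
theorem finrank_ker_incidence :
    Module.finrank (ZMod 2) (LinearMap.ker L.incidence.mulVecLin) ≤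
      Nat.card X + Nat.card L.toFourValentGraph.Component := by
  classical
  have h1 := LinearMap.finrank_range_add_finrank_ker L.incidence.mulVecLin
  have h2 := LinearMap.finrank_range_add_finrank_ker L.incidence.transpose.mulVecLin
  have h3 := L.incidence.rank_transpose
  have h4 := L.finrank_ker_incidence_transpose
  have h5 := Fintype.card_le_of_surjective _ L.edgeParam_surjective
  simp only [Matrix.rank, Module.finrank_fintype_fun_eq_card, Fintype.card_sum, Fintype.card_prod,
    Fintype.card_bool, Nat.card_eq_fintype_card] at *
  omega

variable [Fintype F]

/-- On the sphere a cycle modulo `2` is the boundary of a set of faces. -/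
theorem exists_potential (p : D) (w : D → ZMod 2) (hrev : ∀ d, w (L.rev d) = w d)
    (hc : ∀ c, ∑ i, w (L.dart c i) = 0) :
    ∃ g : F → ZMod 2, g (L.left p) = 0 ∧ ∀ d, g (L.left d) + g (L.left (L.rev d)) = w d := by
  classical
  let δ : (F → ZMod 2) →ₗ[ZMod 2] ({d : D // L.forward d} → ZMod 2) :=
    { toFun := fun g e => g (L.left e.1) + g (L.left (L.rev e.1))
      map_add' := by intro a b; ext e; simp; ring
      map_smul' := by intro a b; ext e; simp; ring }
  have hδ : ∀ g d, δ g (L.fold d) = g (L.left d) + g (L.left (L.rev d)) := by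
    intro g d
    change g (L.left (L.fold d).1) + g (L.left (L.rev (L.fold d).1)) = _
    rcases L.fold_eq_or d with h | h <;> rw [h]
    rw [L.rev_rev, add_comm]
  -- The boundary of a boundary vanishes: around a crossing each corner is counted twice.
  have hle : LinearMap.range δ ≤ LinearMap.ker L.incidence.mulVecLin := by
    rintro _ ⟨g, rfl⟩
    rw [LinearMap.mem_ker, Matrix.mulVecLin_apply]
    ext v
    rcases v with c | e
    · rw [sum_source_inl, sum_zmod_four, hδ, hδ, hδ, hδ, left_rev_dart_zero, left_rev_dart_one,
        left_rev_dart_two, left_rev_dart_three, Pi.zero_apply]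
      have key : ∀ a b c d : ZMod 2, a + b + (c + a) + (d + c) + (b + d) = 0 := by decide
      exact key _ _ _ _
    · exact L.sum_source_inr e
  -- Only constant functions have zero boundary, since any two faces are linked by passing across
  -- edges.
  have hker : Module.finrank (ZMod 2) (LinearMap.ker δ) ≤ 1 := by
    refine finrank_le_one (⟨fun _ => 1, ?_⟩ : LinearMap.ker δ) ?_
    · rw [LinearMap.mem_ker]
      ext e
      exact CharTwo.add_self_eq_zero _
    · rintro ⟨g, hg⟩
      refine ⟨g (L.left p), ?_⟩
      ext f
      have : g f = g (L.left p) := by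
        refine L.face_induction (r := fun f f' => g f = g f') ⟨fun _ => rfl, Eq.symm, Eq.trans⟩
          (fun d => ?_) f _
        have := congrFun (show δ g = 0 from hg) (L.fold d)
        rw [hδ] at this
        exact (CharTwo.add_eq_zero.1 this).symm
      simp [this]
  -- By the Euler relation the boundaries have dimension at least |F| - 1 = |X| + k, which already
  -- bounds the dimension of the cycles.
  have heq : LinearMap.range δ = LinearMap.ker L.incidence.mulVecLin := by
    refine Submodule.eq_of_le_of_finrank_le hle ?_
    have h1 := LinearMap.finrank_range_add_finrank_ker δ
    have h2 := L.finrank_ker_incidence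
    have h3 := L.euler
    simp only [Module.finrank_fintype_fun_eq_card, Nat.card_eq_fintype_card (α := F)] at *
    omega
  have hfold : ∀ d, w (L.fold d).1 = w d := by
    intro d
    rcases L.fold_eq_or d with h | h <;> rw [h]
    exact hrev d
  have hw : (fun e : {d : D // L.forward d} => w e.1) ∈ LinearMap.range δ := by
    rw [heq, LinearMap.mem_ker, Matrix.mulVecLin_apply]
    ext v
    rcases v with c | e
    · rw [sum_source_inl]
      simp only [hfold]
      exact hc c
    · exact L.sum_source_inr e
  obtain ⟨g, hg⟩ := hw
  have hg' : ∀ d, g (L.left d) + g (L.left (L.rev d)) = w d := by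
    intro d
    rw [← hδ, hg]
    exact hfold d
  -- Adding a constant normalizes the value at the marked point and changes no jump.
  refine ⟨fun f => g f + g (L.left p), CharTwo.add_self_eq_zero _, fun d => ?_⟩
  rw [← hg', add_add_add_comm, CharTwo.add_self_eq_zero, add_zero]

/-- The sum of all edges is a mod 2 cycle because crossings have valence four; a potential for it
changes across every edge. -/
theorem exists_isCheckerboard (p : D) : ∃ χ : F → Bool, L.IsCheckerboard χ := by
  obtain ⟨g, -, hg⟩ := L.exists_potential p (fun _ => 1) (fun _ => rfl) (fun _ => by
    rw [sum_zmod_four]; decide)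
  refine ⟨fun f => decide (g f = 1), fun d h => ?_⟩
  have hd := hg d
  simp only [decide_eq_decide] at h
  revert hd h
  generalize g _ = a, g _ = b
  revert a b
  decide

end Potential

end LinkDiagram

namespace LinkDiagram

variable {X D F : Type*}

/-! ### Circles of a resolution and their basic identifications. -/

section Circles

variable [Fintype X] [DecidableEq X] [Fintype D] [Fintype F] (L : LinkDiagram X D F)

theorem circ_surjective (S : Finset X) : Function.Surjective (L.circ S) := Quot.mk_surjective

theorem circ_rev (S : Finset X) (d : D) : L.circ S (L.rev d) = L.circ S d :=
  (Quot.sound (Join.edge d)).symm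

theorem circ_zero_one {S : Finset X} {c : X} (hc : c ∉ S) :
    L.circ S (L.dart c 0) = L.circ S (L.dart c 1) := Quot.sound (Join.zero_left c hc)

theorem circ_two_three {S : Finset X} {c : X} (hc : c ∉ S) :
    L.circ S (L.dart c 2) = L.circ S (L.dart c 3) := Quot.sound (Join.zero_right c hc)

theorem circ_one_two {S : Finset X} {c : X} (hc : c ∈ S) :
    L.circ S (L.dart c 1) = L.circ S (L.dart c 2) := Quot.sound (Join.one_left c hc)

theorem circ_three_zero {S : Finset X} {c : X} (hc : c ∈ S) :
    L.circ S (L.dart c 3) = L.circ S (L.dart c 0) := Quot.sound (Join.one_right c hc)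

/-- An equivalence relation on the edges which contains the elementary steps of `L_S` holds along
the circles of `L_S`. -/
theorem circ_induction {S : Finset X} {r : D → D → Prop} (hr : Equivalence r)
    (h : ∀ d d', L.Join S d d' → r d d') {d d' : D} (hd : L.circ S d = L.circ S d') : r d d' := by
  induction Quot.eqvGen_exact hd with
  | rel a b hab => exact h a b hab
  | refl a => exact hr.refl a
  | symm a b hab ih => exact hr.symm (ih (Quot.eqvGen_sound hab).symm.symm)
  | trans a b c hab hbc ih1 ih2 =>
    exact hr.trans (ih1 (Quot.eqvGen_sound hab)) (ih2 (Quot.eqvGen_sound hbc))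

/-! ### Potentials and areas -/

/-- `g` is the function on the faces which vanishes at the marked point and jumps by `u C` across
each circle `C` of `L_S`. -/
def IsPotential (p : D) (S : Finset X) (u : L.Circle S → ZMod 2) (g : F → ZMod 2) : Prop :=
  g (L.left p) = 0 ∧ ∀ d, g (L.left d) + g (L.left (L.rev d)) = u (L.circ S d)

/-- At each crossing the resolution pairs the four ends into strands, so the values of `u` cancel in
pairs and form a cycle. -/
theorem exists_isPotential (p : D) (S : Finset X) (u : L.Circle S → ZMod 2) :
    ∃ g, L.IsPotential p S u g := by
  refine L.exists_potential p (fun d => u (L.circ S d)) (fun d => by rw [circ_rev]) fun c => ?_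
  rw [sum_zmod_four]
  by_cases hc : c ∈ S
  · rw [L.circ_one_two hc, L.circ_three_zero hc]
    have key : ∀ a b : ZMod 2, a + b + b + a = 0 := by decide
    exact key _ _
  · rw [L.circ_zero_one hc, L.circ_two_three hc]
    have key : ∀ a b : ZMod 2, a + a + b + b = 0 := by decide
    exact key _ _

/-- The indicator function of a circle. -/
noncomputable def indicator {S : Finset X} (C : L.Circle S) (C' : L.Circle S) : ZMod 2 :=
  if C' = C then 1 else 0

variable {L} {p : D} {S : Finset X} {u : L.Circle S → ZMod 2} {g : F → ZMod 2}

/-- Both merged corners are reached from a common third corner by passing over the same strand, so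
the jumps agree. -/
theorem IsPotential.corner_zero (hg : L.IsPotential p S u g) {c : X} (hc : c ∉ S) :
    g (L.left (L.dart c 1)) = g (L.left (L.dart c 3)) := by
  have h2 := hg.2 (L.dart c 2)
  have h3 := hg.2 (L.dart c 3)
  rw [left_rev_dart_two, L.circ_two_three hc] at h2
  rw [left_rev_dart_three] at h3
  have key : ∀ x y z w : ZMod 2, x + y = w → z + x = w → y = z := by decide
  exact key _ _ _ _ h2 h3

theorem IsPotential.corner_one (hg : L.IsPotential p S u g) {c : X} (hc : c ∈ S) :
    g (L.left (L.dart c 0)) = g (L.left (L.dart c 2)) := by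
  have h1 := hg.2 (L.dart c 1)
  have h2 := hg.2 (L.dart c 2)
  rw [left_rev_dart_one, L.circ_one_two hc] at h1
  rw [left_rev_dart_two] at h2
  have key : ∀ x y z w : ZMod 2, x + y = w → z + x = w → y = z := by decide
  exact key _ _ _ _ h1 h2

/-- A potential that jumps only across C is constant on each component of the complement of C. -/
theorem IsPotential.sideStep {C : L.Circle S} (hg : L.IsPotential p S (L.indicator C) g)
    {f f' : F} (h : Relation.EqvGen (L.SideStep S C) f f') : g f = g f' := by
  induction h with
  | rel a b hab =>
    cases hab with
    | edge d hd =>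
      have := hg.2 d
      rw [indicator, if_neg hd] at this
      exact CharTwo.add_eq_zero.1 this
    | zero c hc => exact hg.corner_zero hc
    | one c hc => exact hg.corner_one hc
  | refl a => rfl
  | symm a b _ ih => exact ih.symm
  | trans a b c _ _ ih1 ih2 => exact ih1.trans ih2

variable (L)

/-- The two sides of a circle are carried along it. Every elementary step reverses the direction of
travel and so exchanges left and right, which is why both alternatives occur. -/
theorem sides_along_circle {S : Finset X} (C : L.Circle S) {d d' : D}
    (h : L.circ S d = L.circ S d') :
    (Relation.EqvGen (L.SideStep S C) (L.left d) (L.left d') ∧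
      Relation.EqvGen (L.SideStep S C) (L.left (L.rev d)) (L.left (L.rev d'))) ∨
    (Relation.EqvGen (L.SideStep S C) (L.left d) (L.left (L.rev d')) ∧
      Relation.EqvGen (L.SideStep S C) (L.left (L.rev d)) (L.left d')) := by
  have he := Relation.EqvGen.is_equivalence (L.SideStep S C)
  refine L.circ_induction (r := fun d d' =>
    (Relation.EqvGen (L.SideStep S C) (L.left d) (L.left d') ∧
      Relation.EqvGen (L.SideStep S C) (L.left (L.rev d)) (L.left (L.rev d'))) ∨
    (Relation.EqvGen (L.SideStep S C) (L.left d) (L.left (L.rev d')) ∧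
      Relation.EqvGen (L.SideStep S C) (L.left (L.rev d)) (L.left d')))
    ⟨fun d => Or.inl ⟨he.refl _, he.refl _⟩, ?_, ?_⟩ ?_ h
  · rintro a b (⟨h1, h2⟩ | ⟨h1, h2⟩)
    · exact Or.inl ⟨he.symm h1, he.symm h2⟩
    · exact Or.inr ⟨he.symm h2, he.symm h1⟩
  · rintro a b c (⟨h1, h2⟩ | ⟨h1, h2⟩) (⟨h3, h4⟩ | ⟨h3, h4⟩)
    · exact Or.inl ⟨he.trans h1 h3, he.trans h2 h4⟩
    · exact Or.inr ⟨he.trans h1 h3, he.trans h2 h4⟩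
    · exact Or.inr ⟨he.trans h1 h4, he.trans h2 h3⟩
    · exact Or.inl ⟨he.trans h1 h4, he.trans h2 h3⟩
  · intro a b hab
    right
    cases hab with
    | edge => rw [L.rev_rev]; exact ⟨he.refl _, he.refl _⟩
    | zero_left c hc =>
      rw [left_rev_dart_zero, left_rev_dart_one]
      exact ⟨he.refl _, he.symm (.rel _ _ (SideStep.zero c hc))⟩
    | zero_right c hc =>
      rw [left_rev_dart_two, left_rev_dart_three]
      exact ⟨he.refl _, .rel _ _ (SideStep.zero c hc)⟩
    | one_left c hc =>
      rw [left_rev_dart_one, left_rev_dart_two]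
      exact ⟨he.refl _, .rel _ _ (SideStep.one c hc)⟩
    | one_right c hc =>
      rw [left_rev_dart_three, left_rev_dart_zero]
      exact ⟨he.refl _, he.symm (.rel _ _ (SideStep.one c hc))⟩

/-- A circle has at most two sides. -/
theorem sideStep_or (S : Finset X) (d : D) (f : F) :
    Relation.EqvGen (L.SideStep S (L.circ S d)) (L.left d) f ∨
      Relation.EqvGen (L.SideStep S (L.circ S d)) (L.left (L.rev d)) f := by
  have he := Relation.EqvGen.is_equivalence (L.SideStep S (L.circ S d))
  set U := fun f => Relation.EqvGen (L.SideStep S (L.circ S d)) (L.left d) f ∨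
      Relation.EqvGen (L.SideStep S (L.circ S d)) (L.left (L.rev d)) f
  refine (L.face_induction (r := fun f f' => U f ↔ U f')
    ⟨fun _ => Iff.rfl, Iff.symm, Iff.trans⟩ (fun d' => ?_) (L.left d) f).1 (Or.inl (he.refl _))
  by_cases hd : L.circ S d' = L.circ S d
  · rcases L.sides_along_circle (L.circ S d) hd with ⟨h1, h2⟩ | ⟨h1, h2⟩
    · exact iff_of_true (Or.inr (he.symm h2)) (Or.inl (he.symm h1))
    · exact iff_of_true (Or.inl (he.symm h2)) (Or.inr (he.symm h1))
  · have h := Relation.EqvGen.rel _ _ (SideStep.edge (C := L.circ S d) d' hd)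
    exact ⟨Or.imp (fun h' => he.trans h' (he.symm h)) (fun h' => he.trans h' (he.symm h)),
      Or.imp (fun h' => he.trans h' h) (fun h' => he.trans h' h)⟩

variable {L}

/-- C has at most two sides, and the potential differs by 1 between them, so its value tells which
side a face lies on. This turns interiors into solutions of linear equations, for which additivity
is automatic. -/
theorem IsPotential.mem_disc_iff {C : L.Circle S} (hg : L.IsPotential p S (L.indicator C) g)
    (f : F) : f ∈ L.disc p S C ↔ g f = 1 := by
  have he := Relation.EqvGen.is_equivalence (L.SideStep S C)
  have h01 : ∀ a : ZMod 2, a = 0 ∨ a = 1 := by decide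
  change ¬ _ ↔ _
  rw [not_iff_comm]
  constructor
  · intro h
    have h0 : g f = 0 := (h01 _).resolve_right h
    obtain ⟨d, rfl⟩ := L.circ_surjective S C
    have hne := hg.2 d
    rw [indicator, if_pos rfl] at hne
    have hp := hg.1
    rcases L.sideStep_or S d (L.left p) with h1 | h1 <;> rcases L.sideStep_or S d f with h2 | h2
    · exact he.trans (he.symm h1) h2
    · rw [hg.sideStep h1, hg.sideStep h2, hp, h0] at hne
      exact absurd hne (by decide)
    · rw [hg.sideStep h1, hg.sideStep h2, hp, h0] at hne
      exact absurd hne (by decide)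
    · exact he.trans (he.symm h1) h2
  · intro h
    rw [← hg.sideStep h, hg.1]
    decide

theorem IsPotential.area_eq {C : L.Circle S} (hg : L.IsPotential p S (L.indicator C) g) :
    L.area p S C = ∑ f, MvPolynomial.C (g f) * MvPolynomial.X f := by
  classical
  have h01 : ∀ a : ZMod 2, a = 0 ∨ a = 1 := by decide
  rw [area, Finset.sum_filter]
  refine Finset.sum_congr rfl fun f _ => ?_
  simp only [hg.mem_disc_iff]
  rcases h01 (g f) with h | h <;> simp [h]

variable (L p)

/-- The coefficients of the area are the values of the potential, and these cannot all vanish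
because the potential jumps across the edges of C. This is what makes areas invertible. -/
theorem area_ne_zero (S : Finset X) (C : L.Circle S) : L.area p S C ≠ 0 := by
  classical
  obtain ⟨g, hg⟩ := L.exists_isPotential p S (L.indicator C)
  obtain ⟨d, rfl⟩ := L.circ_surjective S C
  intro h
  rw [hg.area_eq] at h
  have hz : ∀ f, g f = 0 := by
    intro f
    have := congrArg (MvPolynomial.coeff (Finsupp.single f 1)) h
    simpa [MvPolynomial.coeff_sum, MvPolynomial.coeff_C_mul, MvPolynomial.coeff_X,
      Finsupp.single_left_inj] using this
  have := hg.2 d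
  rw [hz, hz, indicator, if_pos rfl] at this
  exact absurd this (by decide)

variable {L p}

/-- The area is additive modulo `2` when circles are merged. -/
theorem area_eq_sum {S S' : Finset X} (φ : L.Circle S → L.Circle S')
    (hφ : ∀ d, φ (L.circ S d) = L.circ S' d) (C' : L.Circle S') :
    L.area p S' C' = ∑ C with φ C = C', L.area p S C := by
  choose g hg using fun C : L.Circle S => L.exists_isPotential p S (L.indicator C)
  rw [Finset.sum_congr rfl fun C _ => (hg C).area_eq, Finset.sum_comm]
  simp only [← Finset.sum_mul, ← map_sum]
  -- The potentials of the circles in the fibre of C' add up to a potential of C'.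
  refine IsPotential.area_eq (g := fun f => ∑ C with φ C = C', g C f) ⟨?_, fun d => ?_⟩
  · exact Finset.sum_eq_zero fun C _ => (hg C).1
  · rw [← Finset.sum_add_distrib, Finset.sum_congr rfl fun C _ => (hg C).2 d]
    simp only [indicator, Finset.sum_ite_eq, Finset.mem_filter, Finset.mem_univ, true_and, hφ]

end Circles

/-! ### Circles as orbits -/

/-- Composing with a transposition cuts a cycle that contains both points and joins two cycles that
contain one each. Only the invariant set `A` around the orbit of `a` matters, so the two
permutations may be unrelated elsewhere. -/
theorem sameCycle_iff_not_of_swap {α : Type*} [Finite α] [DecidableEq α] {f f' : Equiv.Perm α}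
    {a b : α} (hab : a ≠ b) {A : Set α} (ha : a ∈ A) (hA : ∀ x ∈ A, f x ∈ A)
    (h : ∀ x ∈ A, f' x = Equiv.swap a b (f x)) : f'.SameCycle a b ↔ ¬ f.SameCycle a b := by
  have hmem : ∀ n, (f^[n]) a ∈ A := by
    intro n
    induction n with
    | zero => exact ha
    | succ n ih => rw [Function.iterate_succ_apply']; exact hA _ ih
  have hstep : ∀ n, (f'^[n]) a = (f^[n]) a → (f'^[n + 1]) a = Equiv.swap a b ((f^[n + 1]) a) := by
    intro n hn
    rw [Function.iterate_succ_apply', hn, h _ (hmem n), Function.iterate_succ_apply']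
  have hsame : ∀ {e : Equiv.Perm α} {y}, e.SameCycle a y ↔ ∃ n : ℕ, (e^[n]) a = y := by
    intro e y
    constructor
    · intro hs
      obtain ⟨n, -, hn⟩ := hs.exists_pow_eq'
      exact ⟨n, by rw [← hn, Equiv.Perm.iterate_eq_pow]⟩
    · rintro ⟨n, hn⟩
      exact ⟨n, by rw [← hn, Equiv.Perm.iterate_eq_pow]; simp⟩
  constructor
  · intro hs' hs
    classical
    obtain ⟨n, hn⟩ := hsame.1 hs'
    have hex := hsame.1 hs
    -- At the first time `k` at which `f` reaches `b`, the map `f'` returns to `a` instead; its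
    -- orbit closes up without meeting `b`.
    set k := Nat.find hex
    have hk : (f^[k]) a = b := Nat.find_spec hex
    have hmin : ∀ j < k, (f^[j]) a ≠ b := fun j hj => Nat.find_min hex hj
    have hk0 : 0 < k := by
      rcases Nat.eq_zero_or_pos k with h0 | h0
      · rw [h0] at hk; exact absurd hk hab
      · exact h0
    have hna : ∀ j, 0 < j → j < k → (f^[j]) a ≠ a := by
      intro j hj hjk he
      refine hmin (k - j) (by omega) ?_
      rw [← hk]
      conv_rhs => rw [show k = (k - j) + j by omega, Function.iterate_add_apply, he]
    have hagree : ∀ j < k, (f'^[j]) a = (f^[j]) a := by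
      intro j
      induction j with
      | zero => intro _; rfl
      | succ j ih =>
        intro hj
        rw [hstep j (ih (by omega)), Equiv.swap_apply_of_ne_of_ne (hna _ (by omega) hj) (hmin _ hj)]
    have hper : (f'^[k]) a = a := by
      have h1 := hstep (k - 1) (hagree _ (by omega))
      rw [Nat.sub_add_cancel hk0, hk, Equiv.swap_apply_right] at h1
      exact h1
    have hmod := Function.IsPeriodicPt.iterate_mod_apply
      (show Function.IsPeriodicPt f' k a from hper) n
    have hlt := Nat.mod_lt n hk0
    exact hmin _ hlt (by rw [← hagree _ hlt, hmod, hn])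
  · intro hs
    have hna : ∀ j, (f^[j]) a ≠ b := fun j hj => hs (hsame.2 ⟨j, hj⟩)
    -- `f'` follows `f` for a full period and is sent to `b` at the moment when `f` would return to
    -- `a`.
    set m := Function.minimalPeriod f a
    have hm : 0 < m := Function.minimalPeriod_pos_of_mem_periodicPts
      (f.injective.mem_periodicPts a)
    have hagree : ∀ j < m, (f'^[j]) a = (f^[j]) a := by
      intro j
      induction j with
      | zero => intro _; rfl
      | succ j ih =>
        intro hj
        rw [hstep j (ih (by omega)), Equiv.swap_apply_of_ne_of_ne
          (Function.not_isPeriodicPt_of_pos_of_lt_minimalPeriod (by omega) hj) (hna _)]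
    refine hsame.2 ⟨m, ?_⟩
    have h1 := hstep (m - 1) (hagree _ (by omega))
    rw [Nat.sub_add_cancel hm] at h1
    rw [h1, Function.iterate_minimalPeriod, Equiv.swap_apply_left]

section Permutation

variable [Fintype X] [DecidableEq X] [Fintype D] [Fintype F] (L : LinkDiagram X D F)

/-- The pairing of the ends at the crossings in the resolution `L_S`. -/
def endPairing (S : Finset X) : Equiv.Perm (X × ZMod 4) :=
  -- The reflection i ↦ 1 - i exchanges 0, 1 and 2, 3, whereas i ↦ 3 - i exchanges 1, 2 and 3, 0.
  Function.Involutive.toPerm (fun x => (x.1, (if x.1 ∈ S then 3 else 1) - x.2))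
    (fun x => by simp)

/-- The oriented edges which leave a crossing. -/
def dartEmbedding : X × ZMod 4 ↪ D :=
  ⟨fun x => L.dart x.1 x.2, fun _ _ h => Prod.ext (L.dart_injective h).1 (L.dart_injective h).2⟩

/-- The edge joined to the given one at its initial point in `L_S`. -/
noncomputable def partner (S : Finset X) : Equiv.Perm D :=
  (endPairing S).viaEmbedding L.dartEmbedding

theorem partner_dart (S : Finset X) (c : X) (i : ZMod 4) :
    L.partner S (L.dart c i) = L.dart c ((if c ∈ S then 3 else 1) - i) :=
  Equiv.Perm.viaEmbedding_apply (endPairing S) L.dartEmbedding (c, i)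

theorem partner_of_closed (S : Finset X) {d : D} (h : ¬ ∃ c i, d = L.dart c i) :
    L.partner S d = d :=
  Equiv.Perm.viaEmbedding_apply_of_notMem _ _ _ (by
    rintro ⟨⟨c, i⟩, h'⟩
    exact h ⟨c, i, h'.symm⟩)

theorem partner_partner (S : Finset X) (d : D) : L.partner S (L.partner S d) = d := by
  by_cases h : ∃ c i, d = L.dart c i
  · obtain ⟨c, i, rfl⟩ := h
    rw [partner_dart, partner_dart, sub_sub_cancel]
  · rw [L.partner_of_closed S h, L.partner_of_closed S h]

theorem circ_partner (S : Finset X) (d : D) : L.circ S (L.partner S d) = L.circ S d := by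
  by_cases h : ∃ c i, d = L.dart c i
  · obtain ⟨c, i, rfl⟩ := h
    rw [partner_dart]
    by_cases hc : c ∈ S
    · rw [if_pos hc]
      exact forall_zmod_four
        (P := fun i => L.circ S (L.dart c (3 - i)) = L.circ S (L.dart c i))
        (L.circ_three_zero hc) (L.circ_one_two hc).symm (L.circ_one_two hc)
        (L.circ_three_zero hc).symm i
    · rw [if_neg hc]
      exact forall_zmod_four
        (P := fun i => L.circ S (L.dart c (1 - i)) = L.circ S (L.dart c i))
        (L.circ_zero_one hc).symm (L.circ_zero_one hc) (L.circ_two_three hc).symm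
        (L.circ_two_three hc) i
  · rw [L.partner_of_closed S h]

theorem Join.eq_rev_or {L : LinkDiagram X D F} {S : Finset X} {d d' : D} (h : L.Join S d d') :
    d' = L.rev d ∨ d' = L.partner S d := by
  cases h with
  | edge => exact Or.inl rfl
  | zero_left c hc => right; rw [partner_dart, if_neg hc]; rfl
  | zero_right c hc => right; rw [partner_dart, if_neg hc]; rfl
  | one_left c hc => right; rw [partner_dart, if_pos hc]; rfl
  | one_right c hc => right; rw [partner_dart, if_pos hc]; rfl

/-- The next edge along the circles of `L_S`. -/
noncomputable def next (S : Finset X) : Equiv.Perm D :=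
  L.partner S * Function.Involutive.toPerm L.rev L.rev_rev

theorem next_apply (S : Finset X) (d : D) : L.next S d = L.partner S (L.rev d) := rfl

theorem circ_next (S : Finset X) (d : D) : L.circ S (L.next S d) = L.circ S d := by
  rw [next_apply, circ_partner, circ_rev]

theorem sameCycle_iff (S : Finset X) (d d' : D) : (L.next S).SameCycle d d' ↔
    ∃ n : ℕ, ((L.next S)^[n]) d = d' := by
  constructor
  · intro hs
    obtain ⟨n, -, hn⟩ := hs.exists_pow_eq'
    exact ⟨n, by rw [← hn, Equiv.Perm.iterate_eq_pow]⟩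
  · rintro ⟨n, hn⟩
    exact ⟨n, by rw [← hn, Equiv.Perm.iterate_eq_pow]; simp⟩

/-- Iterating `next` traverses a circle in one direction, so an edge of the circle is met either as
it is or reversed. The union of the two cases is invariant under reversal and under passing to the
partner. -/
theorem circ_eq_iff (S : Finset X) (d d' : D) : L.circ S d = L.circ S d' ↔
    (L.next S).SameCycle d d' ∨ (L.next S).SameCycle d (L.rev d') := by
  constructor
  · intro h
    refine (L.circ_induction (S := S) (r := fun x y =>
      ((L.next S).SameCycle d x ∨ (L.next S).SameCycle d (L.rev x)) ↔
      ((L.next S).SameCycle d y ∨ (L.next S).SameCycle d (L.rev y)))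
      ⟨fun _ => Iff.rfl, Iff.symm, Iff.trans⟩ ?_ h).1 (Or.inl (.refl _ _))
    intro a b hab
    rcases hab.eq_rev_or with rfl | rfl
    · rw [L.rev_rev, or_comm]
    · have h1 : L.next S (L.rev (L.partner S a)) = a := by
        rw [next_apply, L.rev_rev, partner_partner]
      have h2 : L.next S (L.rev a) = L.partner S a := by rw [next_apply, L.rev_rev]
      conv_lhs => rw [← h1, Equiv.Perm.sameCycle_apply_right]
      rw [← h2, Equiv.Perm.sameCycle_apply_right, h2, or_comm]
      conv_lhs => rw [h1]
  · have key : ∀ d', (L.next S).SameCycle d d' → L.circ S d = L.circ S d' := by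
      intro d' h
      obtain ⟨n, rfl⟩ := (L.sameCycle_iff S d d').1 h
      induction n with
      | zero => rfl
      | succ n ih =>
        rw [Function.iterate_succ_apply', circ_next]
        exact ih ((L.sameCycle_iff S _ _).2 ⟨n, rfl⟩)
    rintro (h | h)
    · exact key _ h
    · rw [key _ h, circ_rev]

/-- The crossing edges which have the color `b` on their left side. -/
def colored (χ : F → Bool) (b : Bool) : Set D :=
  {d | (∃ c i, d = L.dart c i) ∧ χ (L.left d) = b}

variable {L}

theorem IsCheckerboard.odd {χ : F → Bool} (h : L.IsCheckerboard χ) (c : X) :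
    χ (L.left (L.dart c 1)) = !χ (L.left (L.dart c 0)) ∧
    χ (L.left (L.dart c 2)) = χ (L.left (L.dart c 0)) ∧
    χ (L.left (L.dart c 3)) = !χ (L.left (L.dart c 0)) := by
  have h1 : χ (L.left (L.dart c 0)) ≠ χ (L.left (L.dart c 1)) := h.corner_ne c 1
  have h2 : χ (L.left (L.dart c 1)) ≠ χ (L.left (L.dart c 2)) := h.corner_ne c 2
  have h3 : χ (L.left (L.dart c 2)) ≠ χ (L.left (L.dart c 3)) := h.corner_ne c 3
  revert h1 h2 h3
  generalize χ _ = a, χ _ = b, χ _ = c, χ _ = d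
  revert a b c d
  decide

/-- Reversing an edge changes the color on its left, and so does passing to the partner; together
they preserve it. Keeping a fixed color on the left thus directs all circles consistently. -/
theorem IsCheckerboard.next_mem {χ : F → Bool} (h : L.IsCheckerboard χ) (S : Finset X) {b : Bool}
    {d : D} (hd : d ∈ L.colored χ b) : L.next S d ∈ L.colored χ b := by
  obtain ⟨⟨c, i, rfl⟩, hb⟩ := hd
  obtain ⟨c', i', h'⟩ := L.rev_dart c i
  have h1 := h (L.dart c i)
  rw [next_apply, h', partner_dart]
  refine ⟨⟨_, _, rfl⟩, ?_⟩
  rw [h', hb] at h1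
  obtain ⟨o1, o2, o3⟩ := h.odd c'
  have key : ∀ i', χ (L.left (L.dart c' ((if c' ∈ S then 3 else 1) - i'))) =
      !χ (L.left (L.dart c' i')) := by
    split_ifs
    · exact forall_zmod_four
        (P := fun i' => χ (L.left (L.dart c' (3 - i'))) = !χ (L.left (L.dart c' i')))
        o3 (o2.trans (by simp [o1])) (o1.trans (by simp [o2]))
        ((congrArg (fun j => χ (L.left (L.dart c' j)))
          (show (3 - 3 : ZMod 4) = 0 by decide)).trans (by simp [o3]))
    · exact forall_zmod_four
        (P := fun i' => χ (L.left (L.dart c' (1 - i'))) = !χ (L.left (L.dart c' i')))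
        o1 ((congrArg (fun j => χ (L.left (L.dart c' j)))
          (show (1 - 1 : ZMod 4) = 0 by decide)).trans (by simp [o1]))
        (o3.trans (by simp [o2]))
        ((congrArg (fun j => χ (L.left (L.dart c' j)))
          (show (1 - 3 : ZMod 4) = 2 by decide)).trans (by simp [o3, o2]))
  rw [key]
  have key : ∀ a b : Bool, a ≠ b → (!a) = b := by decide
  exact key _ _ h1

variable (L)

/-- Exactly one of the two resolutions of a crossing divides the circles there. -/
theorem circ_insert_eq_iff_ne (p : D) {S : Finset X} {c : X} (hc : c ∉ S) :
    L.circ (insert c S) (L.dart c 1) = L.circ (insert c S) (L.dart c 3) ↔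
      L.circ S (L.dart c 0) ≠ L.circ S (L.dart c 2) := by
  classical
  obtain ⟨χ, hχ⟩ := L.exists_isCheckerboard p
  set b := χ (L.left (L.dart c 0)) with hb
  have ha : L.dart c 0 ∈ L.colored χ b := ⟨⟨c, 0, rfl⟩, rfl⟩
  -- Ends 0 and 2 have the same color on their left and the reverse of end 2 has the other one, so
  -- the reversed alternative cannot occur.
  have hcirc : ∀ S : Finset X, L.circ S (L.dart c 0) = L.circ S (L.dart c 2) ↔
      (L.next S).SameCycle (L.dart c 0) (L.dart c 2) := by
    intro S
    rw [circ_eq_iff, or_iff_left]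
    intro h
    obtain ⟨n, hn⟩ := (L.sameCycle_iff S _ _).1 h
    have hmem : ∀ n, ((L.next S)^[n]) (L.dart c 0) ∈ L.colored χ b := by
      intro n
      induction n with
      | zero => exact ha
      | succ n ih => rw [Function.iterate_succ_apply']; exact hχ.next_mem S ih
    have h1 := (hmem n).2
    rw [hn, left_rev_dart_two, (hχ.odd c).1, ← hb] at h1
    simp at h1
  have hmem : c ∈ insert c S := Finset.mem_insert_self c S
  rw [L.circ_one_two hmem, L.circ_three_zero hmem, eq_comm, hcirc, Ne, hcirc]
  -- On the edges with color `b` to the left, the two resolutions differ only in that paths leaving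
  -- `c` through ends 0 and 2 are exchanged.
  refine sameCycle_iff_not_of_swap (A := L.colored χ b) ?_ ha (fun x => hχ.next_mem S) ?_
  · intro h
    exact absurd (L.dart_injective h).2 (by decide)
  · intro x hx
    have hy := hχ.next_mem S hx
    obtain ⟨⟨c1, i1, rfl⟩, -⟩ := hx
    obtain ⟨c2, i2, h2⟩ := L.rev_dart c1 i1
    rw [next_apply, h2, partner_dart] at hy ⊢
    rw [next_apply, h2, partner_dart]
    by_cases hcc : c2 = c
    · subst hcc
      rw [if_neg hc] at hy ⊢
      rw [if_pos hmem]
      have hy2 := hy.2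
      obtain ⟨o1, -, o3⟩ := hχ.odd c2
      revert hy2
      refine forall_zmod_four (P := fun i => χ (L.left (L.dart c2 (1 - i))) = b →
        L.dart c2 (3 - i) = Equiv.swap (L.dart c2 0) (L.dart c2 2) (L.dart c2 (1 - i)))
        ?_ ?_ ?_ ?_ i2
      · intro h
        have h := h.symm.trans (o1.trans (congrArg _ hb.symm))
        simp at h
      · intro _
        rw [show (3 - 1 : ZMod 4) = 2 by decide, show (1 - 1 : ZMod 4) = 0 by decide,
          Equiv.swap_apply_left]
      · intro h
        have h := h.symm.trans (o3.trans (congrArg _ hb.symm))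
        simp at h
      · intro _
        rw [show (3 - 3 : ZMod 4) = 0 by decide, show (1 - 3 : ZMod 4) = 2 by decide,
          Equiv.swap_apply_right]
    · rw [Equiv.swap_apply_of_ne_of_ne]
      · simp [Finset.mem_insert, hcc]
      · exact fun h => hcc (L.dart_injective h).1
      · exact fun h => hcc (L.dart_injective h).1

/-! ### Merging and dividing circles -/

/-- If `S` and `S'` agree away from `c` and `L_{S'}` has only one circle at `c`, then `L_{S'}`
arises from `L_S` by merging the circles at `c`. -/
theorem circ_eq_iff_of_merge {S S' : Finset X} {c : X} (hS : ∀ x, x ≠ c → (x ∈ S ↔ x ∈ S'))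
    (h : ∀ i, L.circ S' (L.dart c i) = L.circ S' (L.dart c 0)) (d d' : D) :
    L.circ S' d = L.circ S' d' ↔ L.circ S d = L.circ S d' ∨
      (∃ i, L.circ S d = L.circ S (L.dart c i)) ∧ ∃ i, L.circ S d' = L.circ S (L.dart c i) := by
  have hle : ∀ d d', L.circ S d = L.circ S d' → L.circ S' d = L.circ S' d' := by
    intro d d' hd
    refine L.circ_induction (r := fun d d' => L.circ S' d = L.circ S' d')
      ⟨fun _ => rfl, Eq.symm, Eq.trans⟩ ?_ hd
    intro a b hab
    have key : ∀ x i j, ((x = c → L.circ S' (L.dart x i) = L.circ S' (L.dart x j))) := by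
      rintro _ i j rfl
      rw [h i, h j]
    cases hab with
    | edge => exact (L.circ_rev S' _).symm
    | zero_left x hx =>
      by_cases hxc : x = c
      · exact key x _ _ hxc
      · exact L.circ_zero_one (by rwa [← hS x hxc])
    | zero_right x hx =>
      by_cases hxc : x = c
      · exact key x _ _ hxc
      · exact L.circ_two_three (by rwa [← hS x hxc])
    | one_left x hx =>
      by_cases hxc : x = c
      · exact key x _ _ hxc
      · exact L.circ_one_two (by rwa [← hS x hxc])
    | one_right x hx =>
      by_cases hxc : x = c
      · exact key x _ _ hxc
      · exact L.circ_three_zero (by rwa [← hS x hxc])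
  constructor
  · intro hd
    refine L.circ_induction (S := S') (r := fun d d' => L.circ S d = L.circ S d' ∨
      (∃ i, L.circ S d = L.circ S (L.dart c i)) ∧ ∃ i, L.circ S d' = L.circ S (L.dart c i))
      ⟨fun _ => Or.inl rfl, ?_, ?_⟩ ?_ hd
    · rintro a b (h | ⟨h1, h2⟩)
      · exact Or.inl h.symm
      · exact Or.inr ⟨h2, h1⟩
    · rintro a b e (h | ⟨h1, h2⟩) (h' | ⟨h1', h2'⟩)
      · exact Or.inl (h.trans h')
      · exact Or.inr ⟨by rwa [h], h2'⟩
      · exact Or.inr ⟨h1, by rwa [← h']⟩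
      · exact Or.inr ⟨h1, h2'⟩
    · intro a b hab
      cases hab with
      | edge => exact Or.inl (L.circ_rev S _).symm
      | zero_left x hx =>
        by_cases hxc : x = c
        · subst hxc; exact Or.inr ⟨⟨_, rfl⟩, ⟨_, rfl⟩⟩
        · exact Or.inl (L.circ_zero_one (by rwa [hS x hxc]))
      | zero_right x hx =>
        by_cases hxc : x = c
        · subst hxc; exact Or.inr ⟨⟨_, rfl⟩, ⟨_, rfl⟩⟩
        · exact Or.inl (L.circ_two_three (by rwa [hS x hxc]))
      | one_left x hx =>
        by_cases hxc : x = c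
        · subst hxc; exact Or.inr ⟨⟨_, rfl⟩, ⟨_, rfl⟩⟩
        · exact Or.inl (L.circ_one_two (by rwa [hS x hxc]))
      | one_right x hx =>
        by_cases hxc : x = c
        · subst hxc; exact Or.inr ⟨⟨_, rfl⟩, ⟨_, rfl⟩⟩
        · exact Or.inl (L.circ_three_zero (by rwa [hS x hxc]))
  · rintro (hd | ⟨⟨i, hi⟩, ⟨j, hj⟩⟩)
    · exact hle _ _ hd
    · rw [hle _ _ hi, hle _ _ hj, h i, h j]

/-- Omitting the circle of `y` leaves exactly one representative of every circle of the merged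
resolution. -/
theorem card_circle_of_merge {S S' : Finset X} {x y : D} (hxy : L.circ S x ≠ L.circ S y)
    (h : ∀ d d', L.circ S' d = L.circ S' d' ↔ L.circ S d = L.circ S d' ∨
      (L.circ S d = L.circ S x ∨ L.circ S d = L.circ S y) ∧
        (L.circ S d' = L.circ S x ∨ L.circ S d' = L.circ S y)) :
    Fintype.card (L.Circle S) = Fintype.card (L.Circle S') + 1 := by
  classical
  have hsurj := Function.surjInv_eq (L.circ_surjective S)
  have hcard : (Finset.univ.erase (L.circ S y)).card =
      (Finset.univ : Finset (L.Circle S')).card := by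
    refine Finset.card_bij (fun C _ => L.circ S' (Function.surjInv (L.circ_surjective S) C))
      (fun _ _ => Finset.mem_univ _) ?_ ?_
    · intro C hC C' hC' he
      rw [h] at he
      simp only [hsurj] at he
      have h1 := Finset.ne_of_mem_erase hC
      have h2 := Finset.ne_of_mem_erase hC'
      rcases he with he | ⟨he1 | he1, he2 | he2⟩
      · exact he
      · exact he1.trans he2.symm
      · exact absurd he2 h2
      · exact absurd he1 h1
      · exact absurd he1 h1
    · intro C' _
      obtain ⟨d, rfl⟩ := L.circ_surjective S' C'
      by_cases hd : L.circ S d = L.circ S y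
      · refine ⟨L.circ S x, by simp [hxy], ?_⟩
        rw [h, hsurj]
        exact Or.inr ⟨Or.inl rfl, Or.inr hd⟩
      · refine ⟨L.circ S d, by simp [hd], ?_⟩
        rw [h, hsurj]
        exact Or.inl rfl
  rw [Finset.card_erase_of_mem (Finset.mem_univ _), Finset.card_univ, Finset.card_univ] at hcard
  have : 0 < Fintype.card (L.Circle S) := Fintype.card_pos_iff.2 ⟨L.circ S x⟩
  omega

variable {L}

section Surgery

variable {S : Finset X} {c : X} (hc : c ∉ S)
include hc

theorem exists_circ_dart_iff (d : D) : (∃ i, L.circ S d = L.circ S (L.dart c i)) ↔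
    (L.circ S d = L.circ S (L.dart c 0) ∨ L.circ S d = L.circ S (L.dart c 2)) := by
  constructor
  · rintro ⟨i, hi⟩
    rw [hi]
    exact forall_zmod_four (P := fun i => L.circ S (L.dart c i) = L.circ S (L.dart c 0) ∨
      L.circ S (L.dart c i) = L.circ S (L.dart c 2)) (Or.inl rfl) (Or.inl (L.circ_zero_one hc).symm)
      (Or.inr rfl) (Or.inr (L.circ_two_three hc).symm) i
  · rintro (h | h)
    · exact ⟨0, h⟩
    · exact ⟨2, h⟩

theorem exists_circ_insert_dart_iff (d : D) :
    (∃ i, L.circ (insert c S) d = L.circ (insert c S) (L.dart c i)) ↔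
      (L.circ (insert c S) d = L.circ (insert c S) (L.dart c 1) ∨
        L.circ (insert c S) d = L.circ (insert c S) (L.dart c 3)) := by
  have hm : c ∈ insert c S := Finset.mem_insert_self c S
  constructor
  · rintro ⟨i, hi⟩
    rw [hi]
    exact forall_zmod_four (P := fun i =>
      L.circ (insert c S) (L.dart c i) = L.circ (insert c S) (L.dart c 1) ∨
      L.circ (insert c S) (L.dart c i) = L.circ (insert c S) (L.dart c 3))
      (Or.inr (L.circ_three_zero hm).symm) (Or.inl rfl) (Or.inl (L.circ_one_two hm).symm)
      (Or.inr rfl) i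
  · rintro (h | h)
    · exact ⟨1, h⟩
    · exact ⟨3, h⟩

theorem insert_agree (x : X) (hx : x ≠ c) : x ∈ S ↔ x ∈ insert c S := by
  simp [hx]

/-- A merge: the circles of `L_{S ∪ {c}}` in terms of those of `L_S`. -/
theorem circ_merge_iff (p : D) (h : L.circ S (L.dart c 0) ≠ L.circ S (L.dart c 2)) (d d' : D) :
    L.circ (insert c S) d = L.circ (insert c S) d' ↔ L.circ S d = L.circ S d' ∨
      (L.circ S d = L.circ S (L.dart c 0) ∨ L.circ S d = L.circ S (L.dart c 2)) ∧
      (L.circ S d' = L.circ S (L.dart c 0) ∨ L.circ S d' = L.circ S (L.dart c 2)) := by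
  have hm : c ∈ insert c S := Finset.mem_insert_self c S
  have h13 := (L.circ_insert_eq_iff_ne p hc).2 h
  rw [← exists_circ_dart_iff hc, ← exists_circ_dart_iff hc]
  refine L.circ_eq_iff_of_merge (insert_agree hc) (fun i => ?_) d d'
  have h30 := L.circ_three_zero hm
  exact forall_zmod_four (P := fun i =>
    L.circ (insert c S) (L.dart c i) = L.circ (insert c S) (L.dart c 0)) rfl (h13.trans h30)
    ((L.circ_one_two hm).symm.trans (h13.trans h30)) h30 i

/-- A division: the circles of `L_S` in terms of those of `L_{S ∪ {c}}`. -/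
theorem circ_split_iff (h : L.circ S (L.dart c 0) = L.circ S (L.dart c 2)) (d d' : D) :
    L.circ S d = L.circ S d' ↔ L.circ (insert c S) d = L.circ (insert c S) d' ∨
      (L.circ (insert c S) d = L.circ (insert c S) (L.dart c 1) ∨
        L.circ (insert c S) d = L.circ (insert c S) (L.dart c 3)) ∧
      (L.circ (insert c S) d' = L.circ (insert c S) (L.dart c 1) ∨
        L.circ (insert c S) d' = L.circ (insert c S) (L.dart c 3)) := by
  rw [← exists_circ_insert_dart_iff hc, ← exists_circ_insert_dart_iff hc]
  refine L.circ_eq_iff_of_merge (fun x hx => (insert_agree hc x hx).symm) (fun i => ?_) d d'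
  exact forall_zmod_four (P := fun i => L.circ S (L.dart c i) = L.circ S (L.dart c 0)) rfl
    (L.circ_zero_one hc).symm h.symm ((L.circ_two_three hc).symm.trans h.symm) i

theorem card_circle_merge (p : D) (h : L.circ S (L.dart c 0) ≠ L.circ S (L.dart c 2)) :
    Fintype.card (L.Circle S) = Fintype.card (L.Circle (insert c S)) + 1 :=
  L.card_circle_of_merge h (circ_merge_iff hc p h)

theorem card_circle_split (p : D) (h : L.circ S (L.dart c 0) = L.circ S (L.dart c 2)) :
    Fintype.card (L.Circle (insert c S)) = Fintype.card (L.Circle S) + 1 :=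
  L.card_circle_of_merge (fun h' => (L.circ_insert_eq_iff_ne p hc).1 h' h) (circ_split_iff hc h)

end Surgery

end Permutation

end LinkDiagram

namespace LinkDiagram

variable {X D F : Type*} [Fintype X] [DecidableEq X] [Fintype D] [Fintype F]

/-! ### Pure states -/

section States

variable {L : LinkDiagram X D F} {p : D}

theorem State.ext_circ {S : Finset X} {ε ε' : L.State p S}
    (h : ∀ d, ε.1 (L.circ S d) = ε'.1 (L.circ S d)) : ε = ε' := by
  refine Subtype.ext (funext fun C => ?_)
  obtain ⟨d, rfl⟩ := L.circ_surjective S C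
  exact h d

theorem State.lower_apply {S : Finset X} (ε : L.State p S) (C C' : L.Circle S) :
    (ε.lower C).1 C' = if C' = C then false else ε.1 C' := Function.update_apply _ _ _ _

/-- Change the decoration of an unmarked circle to `v₊`. -/
noncomputable def State.raise {S : Finset X} (ε : L.State p S) (C : L.Circle S)
    (hC : C ≠ L.circ S p) : L.State p S :=
  ⟨Function.update ε.1 C true, by rw [Function.update_of_ne hC.symm]; exact ε.2⟩

theorem State.raise_apply {S : Finset X} (ε : L.State p S) (C C' : L.Circle S)
    (hC : C ≠ L.circ S p) : (ε.raise C hC).1 C' = if C' = C then true else ε.1 C' :=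
  Function.update_apply _ _ _ _

theorem State.lower_raise {S : Finset X} (ε : L.State p S) (C : L.Circle S)
    (hC : C ≠ L.circ S p) (h : ε.1 C = false) : (ε.raise C hC).lower C = ε := by
  refine Subtype.ext (funext fun C' => ?_)
  rw [State.lower_apply, State.raise_apply]
  by_cases h' : C' = C <;> simp [h', h]

theorem State.raise_lower {S : Finset X} (ε : L.State p S) (C : L.Circle S)
    (hC : C ≠ L.circ S p) (h : ε.1 C = true) : (ε.lower C).raise C hC = ε := by
  refine Subtype.ext (funext fun C' => ?_)
  rw [State.raise_apply, State.lower_apply]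
  by_cases h' : C' = C <;> simp [h', h]

theorem State.raise_lower_comm {S : Finset X} (ε : L.State p S) (C C' : L.Circle S)
    (hC : C ≠ L.circ S p) (h : C' ≠ C) : (ε.lower C').raise C hC = (ε.raise C hC).lower C' := by
  refine Subtype.ext (funext fun C₁ => ?_)
  rw [State.raise_apply, State.lower_apply, State.lower_apply, State.raise_apply]
  by_cases h' : C₁ = C
  · simp [h', h.symm]
  · simp [h']

theorem State.lower_comm {S : Finset X} (ε : L.State p S) (C C' : L.Circle S) :
    (ε.lower C').lower C = (ε.lower C).lower C' := by
  refine Subtype.ext (funext fun C₁ => ?_)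
  simp only [State.lower_apply]
  split_ifs <;> rfl

theorem State.ne_marked {S : Finset X} {ε : L.State p S} {C : L.Circle S} (h : ε.1 C = true) :
    C ≠ L.circ S p := by
  rintro rfl
  rw [ε.2] at h
  cases h

variable (L p) in
/-- The pure state all of whose unmarked circles are decorated by `v₊`. -/
noncomputable def allPlus (S : Finset X) : L.State p S :=
  ⟨fun C => decide (C ≠ L.circ S p), by simp⟩

theorem allPlus_apply (S : Finset X) (C : L.Circle S) :
    (L.allPlus p S).1 C = decide (C ≠ L.circ S p) := rfl

/-- Raising an unmarked v₋ decreases the number of v₋, so every state is reached from the all-v₊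
state by lowering. In module terms, 𝒱(L_S) is cyclic over the lowering operators. -/
theorem state_induction {S : Finset X} {P : L.State p S → Prop} (h1 : P (L.allPlus p S))
    (h2 : ∀ ε C, ε.1 C = true → P ε → P (ε.lower C)) (ε : L.State p S) : P ε := by
  induction hn : (Finset.univ.filter fun C => ε.1 C = false).card using Nat.strong_induction_on
    generalizing ε with
  | _ n ih =>
  by_cases h : ∃ C, C ≠ L.circ S p ∧ ε.1 C = false
  · obtain ⟨C, hC, hε⟩ := h
    rw [← ε.lower_raise C hC hε]
    refine h2 _ _ (by rw [State.raise_apply, if_pos rfl]) (ih _ ?_ _ rfl)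
    rw [← hn]
    refine Finset.card_lt_card ⟨fun C' hC' => ?_, fun h' => ?_⟩
    · simp only [Finset.mem_filter, State.raise_apply] at hC' ⊢
      split_ifs at hC' with h'
      · simp at hC'
      · exact hC'
    · have := h' (Finset.mem_filter.2 ⟨Finset.mem_univ C, hε⟩)
      simp [State.raise_apply] at this
  · have : ε = L.allPlus p S := by
      refine Subtype.ext (funext fun C => ?_)
      rw [allPlus_apply]
      by_cases hC : C = L.circ S p
      · rw [hC, ε.2]; simp
      · have h' : ε.1 C ≠ false := fun h' => h ⟨C, hC, h'⟩
        simpa [hC] using h'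
    rw [this]
    exact h1

/-! ### The Khovanov map on pure states -/

/-- The edge `d` lies on a circle of `L_S` through the crossing `c`. -/
def Through (L : LinkDiagram X D F) (S : Finset X) (c : X) (d : D) : Prop :=
  L.circ S d = L.circ S (L.dart c 0) ∨ L.circ S d = L.circ S (L.dart c 2)

section Surgery

variable {S : Finset X} {c : X} (hc : c ∉ S)
include hc

theorem through_dart (i : ZMod 4) : L.Through S c (L.dart c i) :=
  (exists_circ_dart_iff hc _).1 ⟨i, rfl⟩

/-- The change at `c` affects only circles through `c`; all others keep their edges. -/
theorem circ_insert_of_not_through (p : D) {d : D} (hd : ¬ L.Through S c d) (e : D) :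
    L.circ (insert c S) e = L.circ (insert c S) d ↔ L.circ S e = L.circ S d := by
  have hd' := hd
  unfold Through at hd'
  by_cases h : L.circ S (L.dart c 0) = L.circ S (L.dart c 2)
  · rw [circ_split_iff hc h e d, or_iff_left]
    rintro ⟨-, h'⟩
    refine hd (Or.inl ?_)
    rw [circ_split_iff hc h]
    refine Or.inr ⟨h', ?_⟩
    exact Or.inr (L.circ_three_zero (Finset.mem_insert_self c S)).symm
  · rw [circ_merge_iff hc p h, or_iff_left]
    rintro ⟨-, h'⟩
    exact hd h'

theorem circ_insert_of_through (p : D) (h : L.circ S (L.dart c 0) ≠ L.circ S (L.dart c 2)) {d e : D}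
    (hd : L.Through S c d) (he : L.Through S c e) :
    L.circ (insert c S) d = L.circ (insert c S) e :=
  (circ_merge_iff hc p h d e).2 (Or.inr ⟨hd, he⟩)

theorem circ_insert_or_of_through (h : L.circ S (L.dart c 0) = L.circ S (L.dart c 2)) {d : D}
    (hd : L.Through S c d) : L.circ (insert c S) d = L.circ (insert c S) (L.dart c 1) ∨
      L.circ (insert c S) d = L.circ (insert c S) (L.dart c 3) := by
  have h0 : L.circ S d = L.circ S (L.dart c 1) := by
    rw [← L.circ_zero_one hc]
    exact hd.elim id fun h' => h'.trans h.symm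
  rcases (circ_split_iff hc h _ _).1 h0 with h' | h'
  · exact Or.inl h'
  · exact h'.1

theorem khTerm_merge_iff (h : L.circ S (L.dart c 0) ≠ L.circ S (L.dart c 2)) (ε : L.State p S)
    (ε' : L.State p (insert c S)) : L.KhTerm p S c ε ε' ↔
      (∀ d, ¬ L.Through S c d → ε'.1 (L.circ (insert c S) d) = ε.1 (L.circ S d)) ∧
      MulTerm (ε.1 (L.circ S (L.dart c 0))) (ε.1 (L.circ S (L.dart c 2)))
        (ε'.1 (L.circ (insert c S) (L.dart c 1))) := by
  rw [KhTerm, if_neg h]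
  simp only [Through, not_or, and_imp, Ne]

theorem khTerm_split_iff (h : L.circ S (L.dart c 0) = L.circ S (L.dart c 2)) (ε : L.State p S)
    (ε' : L.State p (insert c S)) : L.KhTerm p S c ε ε' ↔
      (∀ d, ¬ L.Through S c d → ε'.1 (L.circ (insert c S) d) = ε.1 (L.circ S d)) ∧
      ComulTerm (ε.1 (L.circ S (L.dart c 0))) (ε'.1 (L.circ (insert c S) (L.dart c 1)))
        (ε'.1 (L.circ (insert c S) (L.dart c 3))) := by
  rw [KhTerm, if_pos h]
  simp only [Through, not_or, and_imp, Ne]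

theorem lower_not_through (p : D) {ε : L.State p S} {ε' : L.State p (insert c S)}
    (h : ∀ d, ¬ L.Through S c d → ε'.1 (L.circ (insert c S) d) = ε.1 (L.circ S d)) (e d : D)
    (hd : ¬ L.Through S c d) : (ε'.lower (L.circ (insert c S) e)).1 (L.circ (insert c S) d) =
      (ε.lower (L.circ S e)).1 (L.circ S d) := by
  rw [State.lower_apply, State.lower_apply, h d hd]
  refine if_congr ?_ rfl rfl
  rw [eq_comm, circ_insert_of_not_through hc p hd, eq_comm]

/-- A v₊ in the output of μ or Δ can only come from v₊ on the circles that feed it, and lowering it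
corresponds to multiplying the input by v₋. Together with `KhTerm.exists_raise` this matches the
terms on the two sides of `khC_lowerD`. -/
theorem KhTerm.of_true {ε : L.State p S} {ε' : L.State p (insert c S)} (h : L.KhTerm p S c ε ε')
    {d : D} (hd : ε'.1 (L.circ (insert c S) d) = true) : ε.1 (L.circ S d) = true ∧
      L.KhTerm p S c (ε.lower (L.circ S d)) (ε'.lower (L.circ (insert c S) d)) := by
  by_cases h02 : L.circ S (L.dart c 0) = L.circ S (L.dart c 2)
  · rw [khTerm_split_iff hc h02] at h ⊢
    obtain ⟨h1, h2⟩ := h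
    have h13 : L.circ (insert c S) (L.dart c 1) ≠ L.circ (insert c S) (L.dart c 3) :=
      fun h => (L.circ_insert_eq_iff_ne p hc).1 h h02
    refine ⟨?_, lower_not_through hc p h1 d, ?_⟩
    · by_cases ht : L.Through S c d
      · have h0 : L.circ S d = L.circ S (L.dart c 0) := ht.elim id fun h' => h'.trans h02.symm
        rcases circ_insert_or_of_through hc h02 ht with h' | h' <;> rw [h'] at hd <;>
        simp [ComulTerm, hd] at h2 <;> rw [h0, h2.1]
      · rw [← h1 d ht, hd]
    · by_cases ht : L.Through S c d
      · have h0 : L.circ S d = L.circ S (L.dart c 0) := ht.elim id fun h' => h'.trans h02.symm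
        rcases circ_insert_or_of_through hc h02 ht with h' | h' <;> rw [h'] at hd ⊢ <;>
        simp [ComulTerm, hd, State.lower_apply, h0, h13, h13.symm] at h2 ⊢ <;> exact h2.2
      · have n0 := fun i => mt (circ_insert_of_not_through hc p ht (L.dart c i)).1
          (fun h => ht (by rcases through_dart (L := L) hc i with h' | h'
                           · exact Or.inl (h.symm.trans h')
                           · exact Or.inr (h.symm.trans h')))
        have n1 : L.circ S (L.dart c 0) ≠ L.circ S d := fun h => ht (Or.inl h.symm)
        rw [State.lower_apply, State.lower_apply, State.lower_apply, if_neg (n0 1), if_neg (n0 3),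
          if_neg n1]
        exact h2
  · rw [khTerm_merge_iff hc h02] at h ⊢
    obtain ⟨h1, h2⟩ := h
    refine ⟨?_, lower_not_through hc p h1 d, ?_⟩
    · by_cases ht : L.Through S c d
      · rw [circ_insert_of_through hc p h02 ht (through_dart hc 1)] at hd
        simp [MulTerm, hd] at h2
        rcases ht with h' | h' <;> rw [h'] <;> simp [h2]
      · rw [← h1 d ht, hd]
    · by_cases ht : L.Through S c d
      · have h' := circ_insert_of_through hc p h02 ht (through_dart hc 1)
        rw [h'] at hd
        simp [MulTerm, hd] at h2
        rcases ht with ht | ht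
        · simp [MulTerm, State.lower_apply, ht, h', h2, Ne.symm h02]
        · simp [MulTerm, State.lower_apply, ht, h', h2, h02]
      · have n0 := mt (circ_insert_of_not_through hc p ht (L.dart c 1)).1
          (fun h => ht (by rcases through_dart (L := L) hc 1 with h' | h'
                           · exact Or.inl (h.symm.trans h')
                           · exact Or.inr (h.symm.trans h')))
        have n1 : L.circ S (L.dart c 0) ≠ L.circ S d := fun h => ht (Or.inl h.symm)
        have n2 : L.circ S (L.dart c 2) ≠ L.circ S d := fun h => ht (Or.inr h.symm)
        rw [State.lower_apply, State.lower_apply, State.lower_apply, if_neg n0, if_neg n1,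
          if_neg n2]
        exact h2

/-- Converse of `KhTerm.of_true`. The circle of `d` in the new resolution is unmarked in all cases:
were a circle through `c` marked, its v₋ would contradict the v₊ required of the input. Hence it can
be raised. -/
theorem KhTerm.exists_raise {ε : L.State p S} {ε' : L.State p (insert c S)} {d : D}
    (hd : ε.1 (L.circ S d) = true) (h : L.KhTerm p S c (ε.lower (L.circ S d)) ε') :
    ∃ ε'' : L.State p (insert c S), ε''.1 (L.circ (insert c S) d) = true ∧
      ε''.lower (L.circ (insert c S) d) = ε' ∧ L.KhTerm p S c ε ε'' := by
  have hpd := State.ne_marked hd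
  by_cases ht : L.Through S c d
  · by_cases h02 : L.circ S (L.dart c 0) = L.circ S (L.dart c 2)
    · rw [khTerm_split_iff hc h02] at h
      obtain ⟨h1, h2⟩ := h
      have h13 : L.circ (insert c S) (L.dart c 1) ≠ L.circ (insert c S) (L.dart c 3) :=
        fun h => (L.circ_insert_eq_iff_ne p hc).1 h h02
      have h0 : L.circ S d = L.circ S (L.dart c 0) := ht.elim id fun h' => h'.trans h02.symm
      simp [ComulTerm, State.lower_apply, h0] at h2
      have hpt : ¬ L.Through S c p := fun hp => hpd
        (h0.trans (hp.elim Eq.symm fun h' => h02.trans h'.symm))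
      have hpd' := mt (circ_insert_of_not_through hc p hpt d).1 hpd
      refine ⟨ε'.raise _ hpd', by rw [State.raise_apply, if_pos rfl],
        State.lower_raise _ _ _ ?_, ?_⟩
      · rcases circ_insert_or_of_through hc h02 ht with h' | h' <;> rw [h']
        · exact h2.1
        · exact h2.2
      · rw [khTerm_split_iff hc h02]
        refine ⟨fun e he => ?_, ?_⟩
        · have hne : L.circ S e ≠ L.circ S d := fun h => he (by
            rcases ht with h' | h'
            · exact Or.inl (h.trans h')
            · exact Or.inr (h.trans h'))
          have hne' := mt (circ_insert_of_not_through hc p he d).1 hne.symm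
          rw [State.raise_apply, if_neg (Ne.symm hne'), h1 e he, State.lower_apply, if_neg hne]
        · rw [h0] at hd
          rcases circ_insert_or_of_through hc h02 ht with h' | h'
          · simp [ComulTerm, State.raise_apply, h', h13.symm, h2, hd]
          · simp [ComulTerm, State.raise_apply, h', h13, h2, hd]
    · rw [khTerm_merge_iff hc h02] at h
      obtain ⟨h1, h2⟩ := h
      have h' := circ_insert_of_through hc p h02 ht (through_dart hc 1)
      have hval : ε.1 (L.circ S (L.dart c 0)) = true ∧ ε.1 (L.circ S (L.dart c 2)) = true ∧
          ε'.1 (L.circ (insert c S) (L.dart c 1)) = false := by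
        rcases ht with ht | ht
        · rw [ht] at hd
          simpa [MulTerm, State.lower_apply, ht, hd, Ne.symm h02] using h2
        · rw [ht] at hd
          simpa [MulTerm, State.lower_apply, ht, hd, h02] using h2
      obtain ⟨v0, v2, v1⟩ := hval
      have hpt : ¬ L.Through S c p := by
        rintro (hp | hp)
        · exact State.ne_marked v0 hp.symm
        · exact State.ne_marked v2 hp.symm
      have hpd' := mt (circ_insert_of_not_through hc p hpt d).1 hpd
      refine ⟨ε'.raise _ hpd', by rw [State.raise_apply, if_pos rfl],
        State.lower_raise _ _ _ (by rw [h', v1]), ?_⟩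
      rw [khTerm_merge_iff hc h02]
      refine ⟨fun e he => ?_, ?_⟩
      · have hne : L.circ S e ≠ L.circ S d := fun h => he (by
          rcases ht with h' | h'
          · exact Or.inl (h.trans h')
          · exact Or.inr (h.trans h'))
        have hne' := mt (circ_insert_of_not_through hc p he d).1 hne.symm
        rw [State.raise_apply, if_neg (Ne.symm hne'), h1 e he, State.lower_apply, if_neg hne]
      · simp [MulTerm, State.raise_apply, h', v0, v2]
  · have n0 : ∀ e, L.Through S c e → L.circ S e ≠ L.circ S d := fun e he h => ht (by
      rcases he with h' | h'
      · exact Or.inl (h.symm.trans h')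
      · exact Or.inr (h.symm.trans h'))
    have n1 := fun e he => mt (circ_insert_of_not_through hc p ht e).1 (n0 e he)
    have hpd' : L.circ (insert c S) d ≠ L.circ (insert c S) p := fun h' =>
      hpd ((circ_insert_of_not_through hc p ht p).1 h'.symm).symm
    have key : ∀ e, ¬ L.Through S c e → ε'.1 (L.circ (insert c S) e) =
        (ε.lower (L.circ S d)).1 (L.circ S e) →
        (ε'.raise _ hpd').1 (L.circ (insert c S) e) = ε.1 (L.circ S e) := by
      intro e he h
      rw [State.raise_apply, h, State.lower_apply]
      by_cases hed : L.circ S e = L.circ S d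
      · rw [if_pos ((circ_insert_of_not_through hc p ht e).2 hed), hed, hd]
      · rw [if_neg (mt (circ_insert_of_not_through hc p ht e).1 hed), if_neg hed]
    refine ⟨ε'.raise _ hpd', by rw [State.raise_apply, if_pos rfl],
        State.lower_raise _ _ _ ?_, ?_⟩
    · have h1 : ∀ e, ¬ L.Through S c e → ε'.1 (L.circ (insert c S) e) =
          (ε.lower (L.circ S d)).1 (L.circ S e) := by
        intro e he
        by_cases h02 : L.circ S (L.dart c 0) = L.circ S (L.dart c 2)
        · exact ((khTerm_split_iff hc h02 _ _).1 h).1 e he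
        · exact ((khTerm_merge_iff hc h02 _ _).1 h).1 e he
      rw [h1 d ht, State.lower_apply, if_pos rfl]
    · have t := fun i => through_dart (L := L) hc i
      by_cases h02 : L.circ S (L.dart c 0) = L.circ S (L.dart c 2)
      · rw [khTerm_split_iff hc h02] at h ⊢
        refine ⟨fun e he => key e he (h.1 e he), ?_⟩
        have h2 := h.2
        rw [State.lower_apply, if_neg (n0 _ (t 0))] at h2
        rw [State.raise_apply, State.raise_apply, if_neg (n1 _ (t 1)), if_neg (n1 _ (t 3))]
        exact h2
      · rw [khTerm_merge_iff hc h02] at h ⊢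
        refine ⟨fun e he => key e he (h.1 e he), ?_⟩
        have h2 := h.2
        rw [State.lower_apply, if_neg (n0 _ (t 0)), State.lower_apply, if_neg (n0 _ (t 2))] at h2
        rw [State.raise_apply, if_neg (n1 _ (t 1))]
        exact h2

theorem allPlus_insert_of_not_through (p : D) {d : D} (hd : ¬ L.Through S c d) :
    (L.allPlus p (insert c S)).1 (L.circ (insert c S) d) = (L.allPlus p S).1 (L.circ S d) := by
  rw [allPlus_apply, allPlus_apply, decide_eq_decide, not_iff_not, eq_comm,
    circ_insert_of_not_through hc p hd, eq_comm]

/-- This is 1 · 1 = 1. If one of the circles is marked, the product is v₋ on the new marked circle,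
which is again what the all-v₊ state prescribes. -/
theorem khTerm_allPlus_merge (h : L.circ S (L.dart c 0) ≠ L.circ S (L.dart c 2))
    (ε' : L.State p (insert c S)) :
    L.KhTerm p S c (L.allPlus p S) ε' ↔ ε' = L.allPlus p (insert c S) := by
  have hmul : MulTerm ((L.allPlus p S).1 (L.circ S (L.dart c 0)))
      ((L.allPlus p S).1 (L.circ S (L.dart c 2))) (ε'.1 (L.circ (insert c S) (L.dart c 1))) ↔
      ε'.1 (L.circ (insert c S) (L.dart c 1)) =
        (L.allPlus p (insert c S)).1 (L.circ (insert c S) (L.dart c 1)) := by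
    by_cases hp : L.Through S c p
    · have h1 := circ_insert_of_through hc p h (through_dart hc 1) hp
      simp only [allPlus_apply, h1]
      rcases hp with hp | hp <;> simp [MulTerm, hp, h, Ne.symm h]
    · have n : ∀ i, L.circ S (L.dart c i) ≠ L.circ S p := fun i h' => hp (by
        rcases through_dart (L := L) hc i with h'' | h''
        · exact Or.inl (h'.symm.trans h'')
        · exact Or.inr (h'.symm.trans h''))
      have n1 := mt (circ_insert_of_not_through hc p hp (L.dart c 1)).1 (n 1)
      simp [allPlus_apply, n1, n, MulTerm]
  rw [khTerm_merge_iff hc h, hmul]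
  constructor
  · rintro ⟨h1, h2⟩
    refine State.ext_circ fun d => ?_
    by_cases hd : L.Through S c d
    · rw [circ_insert_of_through hc p h hd (through_dart hc 1), h2]
    · rw [h1 d hd, allPlus_insert_of_not_through hc p hd]
  · rintro rfl
    exact ⟨fun d hd => allPlus_insert_of_not_through hc p hd, rfl⟩

theorem lower_apply_of_not_through (p : D) (ε : L.State p (insert c S)) {d e : D}
    (hd : ¬ L.Through S c d) (he : L.Through S c e) :
    (ε.lower (L.circ (insert c S) e)).1 (L.circ (insert c S) d) =
      ε.1 (L.circ (insert c S) d) := by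
  rw [State.lower_apply, if_neg]
  intro h
  rw [eq_comm, circ_insert_of_not_through hc p hd] at h
  exact hd (he.imp h.symm.trans h.symm.trans)

/-- This is Δ(1) = x ⊗ 1 + 1 ⊗ x. If the marked circle divides, Δ(v₋) = v₋ ⊗ v₋ has one term, the
one lowering the new unmarked circle; the condition that the lowered circle carries v₊ covers both
cases. -/
theorem khTerm_allPlus_split (h : L.circ S (L.dart c 0) = L.circ S (L.dart c 2))
    (ε' : L.State p (insert c S)) : L.KhTerm p S c (L.allPlus p S) ε' ↔
      ∃ i : ZMod 4, (i = 1 ∨ i = 3) ∧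
        (L.allPlus p (insert c S)).1 (L.circ (insert c S) (L.dart c i)) = true ∧
        ε' = (L.allPlus p (insert c S)).lower (L.circ (insert c S) (L.dart c i)) := by
  have h13 : L.circ (insert c S) (L.dart c 1) ≠ L.circ (insert c S) (L.dart c 3) :=
    fun h' => (L.circ_insert_eq_iff_ne p hc).1 h' h
  have hoff : ∀ i, (∀ d, ¬ L.Through S c d →
      ((L.allPlus p (insert c S)).lower (L.circ (insert c S) (L.dart c i))).1
        (L.circ (insert c S) d) = (L.allPlus p S).1 (L.circ S d)) := by
    intro i d hd
    rw [lower_apply_of_not_through hc p _ hd (through_dart hc i),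
      allPlus_insert_of_not_through hc p hd]
  have hext : ∀ i, (∀ d, ¬ L.Through S c d → ε'.1 (L.circ (insert c S) d) =
      (L.allPlus p S).1 (L.circ S d)) →
      ε'.1 (L.circ (insert c S) (L.dart c 1)) = ((L.allPlus p (insert c S)).lower
        (L.circ (insert c S) (L.dart c i))).1 (L.circ (insert c S) (L.dart c 1)) →
      ε'.1 (L.circ (insert c S) (L.dart c 3)) = ((L.allPlus p (insert c S)).lower
        (L.circ (insert c S) (L.dart c i))).1 (L.circ (insert c S) (L.dart c 3)) →
      ε' = (L.allPlus p (insert c S)).lower (L.circ (insert c S) (L.dart c i)) := by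
    intro i h1 h2 h3
    refine State.ext_circ fun d => ?_
    by_cases hd : L.Through S c d
    · rcases circ_insert_or_of_through hc h hd with h' | h' <;> rw [h']
      · exact h2
      · exact h3
    · rw [h1 d hd, hoff i d hd]
  rw [khTerm_split_iff hc h]
  by_cases hp : L.Through S c p
  · have hpc : L.circ S (L.dart c 0) = L.circ S p := hp.elim Eq.symm fun h' => h.trans h'.symm
    have hpi := circ_insert_or_of_through hc h hp
    constructor
    · rintro ⟨h1, h2⟩
      simp only [ComulTerm, allPlus_apply, hpc] at h2
      simp at h2
      rcases hpi with hpi | hpi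
      · refine ⟨3, Or.inr rfl, by simp [allPlus_apply, hpi, h13.symm], hext 3 h1 ?_ ?_⟩
        · simp [State.lower_apply, allPlus_apply, h2, hpi]
        · simp [State.lower_apply, h2]
      · refine ⟨1, Or.inl rfl, by simp [allPlus_apply, hpi, h13], hext 1 h1 ?_ ?_⟩
        · simp [State.lower_apply, h2]
        · simp [State.lower_apply, allPlus_apply, h2, hpi]
    · rintro ⟨i, hi, h1, rfl⟩
      refine ⟨hoff i, ?_⟩
      rcases hpi with hpi | hpi <;> rcases hi with rfl | rfl <;>
        simp [allPlus_apply, hpi, h13, h13.symm, ComulTerm, State.lower_apply, hpc] at h1 ⊢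
  · have n : ∀ i, L.circ S (L.dart c i) ≠ L.circ S p := fun i h' => hp
      ((through_dart (L := L) hc i).imp h'.symm.trans h'.symm.trans)
    have n1 := fun i => mt (circ_insert_of_not_through hc p hp (L.dart c i)).1 (n i)
    constructor
    · rintro ⟨h1, h2⟩
      simp only [ComulTerm, allPlus_apply] at h2
      simp [n] at h2
      by_cases hv : ε'.1 (L.circ (insert c S) (L.dart c 1)) = true
      · refine ⟨3, Or.inr rfl, by simp [allPlus_apply, n1], hext 3 h1 ?_ ?_⟩
        · simp [State.lower_apply, allPlus_apply, hv, h13, n1]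
        · rw [hv] at h2
          simpa [State.lower_apply] using h2
      · rw [Bool.not_eq_true] at hv
        refine ⟨1, Or.inl rfl, by simp [allPlus_apply, n1], hext 1 h1 ?_ ?_⟩
        · simp [State.lower_apply, hv]
        · rw [hv] at h2
          simpa [State.lower_apply, allPlus_apply, h13.symm, n1] using h2
    · rintro ⟨i, hi, h1, rfl⟩
      refine ⟨hoff i, ?_⟩
      rcases hi with rfl | rfl <;>
        simp [allPlus_apply, h13, h13.symm, ComulTerm, State.lower_apply, n, n1]

end Surgery

end States

end LinkDiagram

namespace LinkDiagram

theorem sum_sum_eq_zero {ι M : Type*} [Fintype ι] [DecidableEq ι] [AddCommMonoid M]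
    (f : ι → ι → M) (h0 : ∀ i, f i i = 0) (h : ∀ i j, i ≠ j → f i j + f j i = 0) :
    ∑ i, ∑ j, f i j = 0 := by
  rw [← Fintype.sum_prod_type' f]
  refine Finset.sum_involution (fun x _ => x.swap) ?_ ?_ (fun _ _ => Finset.mem_univ _)
    (fun x _ => Prod.swap_swap x)
  · rintro ⟨i, j⟩ -
    by_cases hij : i = j
    · subst hij; simp [h0]
    · exact h i j hij
  · rintro ⟨i, j⟩ - hne he
    refine hne ?_
    have : j = i := congrArg Prod.fst he
    subst this
    exact h0 j

variable {X D F : Type*} [Fintype X] [DecidableEq X] [Fintype D] [Fintype F]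

/-! ### Lowering operators and the edge maps of the cube of resolutions. -/

section Operators

variable (L : LinkDiagram X D F) (p : D) (A : Type*) [CommRing A] [Algebra (FaceRing F) A]

/-- The basis vector of a pure state. -/
noncomputable abbrev pure (S : Finset X) (ε : L.State p S) : L.KT p A :=
  Finsupp.single (⟨S, ε⟩ : L.KTGen p) 1

/-- The operator `v₊ ↦ v₋`, `v₋ ↦ 0` on the circle through the edge `d`, for all resolutions. -/
noncomputable def lowerD (d : D) : L.KT p A →ₗ[A] L.KT p A :=
  Finsupp.linearCombination A fun g : L.KTGen p =>
    if g.2.1 (L.circ g.1 d) = true then L.pure p A g.1 (g.2.lower (L.circ g.1 d)) else 0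

open scoped Classical in
/-- The part of the Khovanov differential which changes the resolution of the crossing `c`. -/
noncomputable def khC (c : X) : L.KT p A →ₗ[A] L.KT p A :=
  Finsupp.linearCombination A fun g : L.KTGen p =>
    if c ∈ g.1 then (0 : L.KT p A) else
      ∑ ε' : L.State p (insert c g.1), if L.KhTerm p g.1 c g.2 ε' then
        L.pure p A (insert c g.1) ε' else 0

theorem khD_eq_sum (x : L.KT p A) : L.khD p A x = ∑ c, L.khC p A c x := by
  rw [← LinearMap.sum_apply]
  congr 1
  refine Finsupp.lhom_ext' fun g => LinearMap.ext_ring ?_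
  simp [khD, khC]

theorem lowerD_pure (d : D) (S : Finset X) (ε : L.State p S) :
    L.lowerD p A d (L.pure p A S ε) =
      if ε.1 (L.circ S d) = true then L.pure p A S (ε.lower (L.circ S d)) else 0 := by
  exact (Finsupp.linearCombination_single _ _ _).trans (one_smul _ _)

open scoped Classical in
theorem khC_pure (c : X) (S : Finset X) (ε : L.State p S) :
    L.khC p A c (L.pure p A S ε) = if c ∈ S then (0 : L.KT p A) else
      ∑ ε' : L.State p (insert c S), if L.KhTerm p S c ε ε' then
        L.pure p A (insert c S) ε' else 0 := by
  exact (Finsupp.linearCombination_single _ _ _).trans (one_smul _ _)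

theorem koszulD_pure (S : Finset X) (ε : L.State p S) :
    L.koszulD p A (L.pure p A S ε) = ∑ C : L.Circle S, if ε.1 C = true then
      algebraMap (FaceRing F) A (L.area p S C) • L.pure p A S (ε.lower C) else 0 := by
  refine ((Finsupp.linearCombination_single _ _ _).trans (one_smul _ _)).trans ?_
  refine Finset.sum_congr rfl fun C _ => ?_
  split_ifs
  · exact (Finsupp.smul_single_one _ _).symm
  · rfl

theorem kt_ext {M : Type*} [AddCommMonoid M] [Module A M] {f g : L.KT p A →ₗ[A] M}
    (h : ∀ S ε, f (L.pure p A S ε) = g (L.pure p A S ε)) : f = g :=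
  Finsupp.lhom_ext' fun x => LinearMap.ext_ring (h x.1 x.2)

/-- The basis vector all of whose unmarked circles are decorated by `v₊`. -/
noncomputable def top (S : Finset X) : L.KT p A := L.pure p A S (L.allPlus p S)

theorem two_eq_zero (F A : Type*) [CommRing A] [Algebra (FaceRing F) A] : (2 : A) = 0 := by
  have : ((2 : ZMod 2) : ZMod 2) = 0 := by decide
  have h := congrArg ((algebraMap (FaceRing F) A).comp MvPolynomial.C) this
  rwa [map_ofNat, map_zero] at h

variable {L p A}

theorem add_self_module (F A : Type*) [CommRing A] [Algebra (FaceRing F) A] {M : Type*}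
    [AddCommGroup M] [Module A M] (x : M) : x + x = 0 := by
  rw [← two_smul A x, two_eq_zero F A, zero_smul]

theorem state_lowerD_induction {S : Finset X} {P : L.KT p A → Prop} (h1 : P (L.top p A S))
    (h2 : ∀ d ε, ε.1 (L.circ S d) = true → P (L.pure p A S ε) →
      P (L.lowerD p A d (L.pure p A S ε))) (ε : L.State p S) : P (L.pure p A S ε) := by
  refine state_induction (P := fun ε => P (L.pure p A S ε)) h1 (fun ε C hC hε => ?_) ε
  obtain ⟨d, rfl⟩ := L.circ_surjective S C
  have := h2 d ε hC hε
  rwa [lowerD_pure, if_pos hC] at this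

/-- Linear maps which commute with the lowering operators are determined by their values on the
top pure states. -/
theorem eq_of_top {M : Type*} [AddCommMonoid M] [Module A M] {f g : L.KT p A →ₗ[A] M}
    (T : D → M →ₗ[A] M) (hf : ∀ d x, f (L.lowerD p A d x) = T d (f x))
    (hg : ∀ d x, g (L.lowerD p A d x) = T d (g x))
    (h : ∀ S, f (L.top p A S) = g (L.top p A S)) : f = g := by
  refine L.kt_ext p A fun S ε => ?_
  refine state_lowerD_induction (P := fun x => f x = g x) (h S) (fun d ε _ he => ?_) ε
  rw [hf, hg, he]

theorem lowerD_comm (d d' : D) (x : L.KT p A) :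
    L.lowerD p A d (L.lowerD p A d' x) = L.lowerD p A d' (L.lowerD p A d x) := by
  have : L.lowerD p A d ∘ₗ L.lowerD p A d' = L.lowerD p A d' ∘ₗ L.lowerD p A d := by
    refine L.kt_ext p A fun S ε => ?_
    simp only [LinearMap.comp_apply, lowerD_pure]
    by_cases h : L.circ S d = L.circ S d'
    · rw [h]
      split_ifs with h1 <;> simp [lowerD_pure, State.lower_apply, h]
    · have h' := Ne.symm h
      split_ifs with h1 h2 h2 <;>
        simp [lowerD_pure, State.lower_apply, h, h', h1, h2, State.lower_comm]
  exact LinearMap.congr_fun this x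

theorem lowerD_self (d : D) (x : L.KT p A) : L.lowerD p A d (L.lowerD p A d x) = 0 := by
  have : L.lowerD p A d ∘ₗ L.lowerD p A d = 0 := by
    refine L.kt_ext p A fun S ε => ?_
    simp only [LinearMap.comp_apply, lowerD_pure]
    split_ifs with h1 <;> simp [lowerD_pure, State.lower_apply]
  exact LinearMap.congr_fun this x

/-- Lowering at `d` is multiplication by x in the algebra ℤ/2[x]/(x²) of the circle through `d`, and
the product and coproduct of this Frobenius algebra are linear over it. -/
theorem khC_lowerD (c : X) (d : D) (x : L.KT p A) :
    L.khC p A c (L.lowerD p A d x) = L.lowerD p A d (L.khC p A c x) := by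
  classical
  have : L.khC p A c ∘ₗ L.lowerD p A d = L.lowerD p A d ∘ₗ L.khC p A c := by
    refine L.kt_ext p A fun S ε => ?_
    simp only [LinearMap.comp_apply]
    by_cases hc : c ∈ S
    · rw [lowerD_pure, khC_pure, if_pos hc, map_zero]
      split_ifs
      · rw [khC_pure, if_pos hc]
      · rw [map_zero]
    · have hR : L.lowerD p A d (L.khC p A c (L.pure p A S ε)) =
          ∑ ε'' : L.State p (insert c S) with L.KhTerm p S c ε ε'' ∧
            ε''.1 (L.circ (insert c S) d) = true,
            L.pure p A (insert c S) (ε''.lower (L.circ (insert c S) d)) := by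
        rw [khC_pure, if_neg hc, map_sum, Finset.sum_filter]
        refine Finset.sum_congr rfl fun ε'' _ => ?_
        by_cases h : L.KhTerm p S c ε ε''
        · simp only [h, if_true, true_and]
          rw [lowerD_pure]
        · simp [h]
      have hL : L.khC p A c (L.lowerD p A d (L.pure p A S ε)) =
          ∑ ε' : L.State p (insert c S) with ε.1 (L.circ S d) = true ∧
            L.KhTerm p S c (ε.lower (L.circ S d)) ε', L.pure p A (insert c S) ε' := by
        rw [lowerD_pure, Finset.sum_filter]
        by_cases h : ε.1 (L.circ S d) = true
        · simp only [h, if_true, true_and]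
          rw [khC_pure, if_neg hc]
        · simp [h]
      rw [hR, hL]
      symm
      -- Lowering at `d` is a bijection between the output terms with v₊ there and the terms of the
      -- image of the lowered state.
      refine Finset.sum_bij (fun ε'' _ => ε''.lower (L.circ (insert c S) d)) ?_ ?_ ?_ ?_
      · intro ε'' h
        simp only [Finset.mem_filter, Finset.mem_univ, true_and] at h ⊢
        exact KhTerm.of_true hc h.1 h.2
      · intro a ha b hb hab
        simp only [Finset.mem_filter, Finset.mem_univ, true_and] at ha hb
        rw [← a.raise_lower _ (State.ne_marked ha.2) ha.2,
          ← b.raise_lower _ (State.ne_marked hb.2) hb.2]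
        simp only [hab]
      · intro ε' h
        simp only [Finset.mem_filter, Finset.mem_univ, true_and] at h
        obtain ⟨ε'', h1, h2, h3⟩ := KhTerm.exists_raise hc h.1 h.2
        exact ⟨ε'', by simp [h1, h3], h2⟩
      · intro _ _
        rfl
  exact LinearMap.congr_fun this x

theorem lowerD_top_congr {S : Finset X} {d d' : D} (h : L.circ S d = L.circ S d') :
    L.lowerD p A d (L.top p A S) = L.lowerD p A d' (L.top p A S) := by
  rw [top, lowerD_pure, lowerD_pure, h]

theorem khC_top_of_mem {S : Finset X} {c : X} (hc : c ∈ S) : L.khC p A c (L.top p A S) = 0 := by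
  rw [top, khC_pure, if_pos hc]

theorem khC_top_merge {S : Finset X} {c : X} (hc : c ∉ S)
    (h : L.circ S (L.dart c 0) ≠ L.circ S (L.dart c 2)) :
    L.khC p A c (L.top p A S) = L.top p A (insert c S) := by
  classical
  rw [top, khC_pure, if_neg hc]
  simp only [khTerm_allPlus_merge hc h, Finset.sum_ite_eq', Finset.mem_univ, if_true]
  rfl

theorem khC_top_split {S : Finset X} {c : X} (hc : c ∉ S)
    (h : L.circ S (L.dart c 0) = L.circ S (L.dart c 2)) :
    L.khC p A c (L.top p A S) = L.lowerD p A (L.dart c 1) (L.top p A (insert c S)) +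
      L.lowerD p A (L.dart c 3) (L.top p A (insert c S)) := by
  classical
  have h13 : L.circ (insert c S) (L.dart c 1) ≠ L.circ (insert c S) (L.dart c 3) :=
    fun h' => (L.circ_insert_eq_iff_ne p hc).1 h' h
  set ε := L.allPlus p (insert c S) with hε
  have hterm : ∀ ε', L.KhTerm p S c (L.allPlus p S) ε' ↔
      (ε.1 (L.circ (insert c S) (L.dart c 1)) = true ∧
        ε' = ε.lower (L.circ (insert c S) (L.dart c 1))) ∨
      (ε.1 (L.circ (insert c S) (L.dart c 3)) = true ∧
        ε' = ε.lower (L.circ (insert c S) (L.dart c 3))) := by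
    intro ε'
    rw [khTerm_allPlus_split hc h]
    constructor
    · rintro ⟨i, rfl | rfl, h'⟩
      · exact Or.inl h'
      · exact Or.inr h'
    · rintro (h' | h')
      · exact ⟨1, Or.inl rfl, h'⟩
      · exact ⟨3, Or.inr rfl, h'⟩
  have hne : ε.1 (L.circ (insert c S) (L.dart c 1)) = true →
      ε.lower (L.circ (insert c S) (L.dart c 1)) ≠ ε.lower (L.circ (insert c S) (L.dart c 3)) := by
    intro h1 h'
    have := congrArg (fun e => e.1 (L.circ (insert c S) (L.dart c 1))) h'
    simp [State.lower_apply, h13, h1] at this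
  have hsplit : ∀ ε', (if L.KhTerm p S c (L.allPlus p S) ε' then L.pure p A (insert c S) ε'
      else 0) = (if ε' = ε.lower (L.circ (insert c S) (L.dart c 1)) then
        (if ε.1 (L.circ (insert c S) (L.dart c 1)) = true then
          L.pure p A (insert c S) ε' else 0) else 0) +
      (if ε' = ε.lower (L.circ (insert c S) (L.dart c 3)) then
        (if ε.1 (L.circ (insert c S) (L.dart c 3)) = true then
          L.pure p A (insert c S) ε' else 0) else 0) := by
    intro ε'
    simp only [hterm]
    rcases Classical.propComplete (ε.1 (L.circ (insert c S) (L.dart c 1)) = true) with h1 | h1 <;>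
    rcases Classical.propComplete (ε.1 (L.circ (insert c S) (L.dart c 3)) = true) with h3 | h3 <;>
    rcases Classical.propComplete (ε' = ε.lower (L.circ (insert c S) (L.dart c 1)))
      with e1 | e1 <;>
    rcases Classical.propComplete (ε' = ε.lower (L.circ (insert c S) (L.dart c 3)))
      with e3 | e3 <;>
    first
    | exact absurd ((of_eq_true e1).symm.trans (of_eq_true e3)) (hne (of_eq_true h1))
    | simp only [h1, h3, e1, e3, if_true, if_false, and_true, and_false, or_true, or_false,
        add_zero, zero_add]
  simp only [top]
  rw [khC_pure, if_neg hc, lowerD_pure, lowerD_pure, Finset.sum_congr rfl fun ε' _ => hsplit ε',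
    Finset.sum_add_distrib, Finset.sum_ite_eq', Finset.sum_ite_eq', if_pos (Finset.mem_univ _),
    if_pos (Finset.mem_univ _)]

/-! ### The Khovanov differential -/

/-- Both crossings join the same two circles of L_S: after merging at `c`, the crossing `c'` meets a
single circle. Hence the two circles after both changes pass through `c'` as well as through `c`. -/
theorem circ_merge_split {S : Finset X} {c c' : X} (hc : c ∉ S) (hc' : c' ∉ S) (hcc : c ≠ c')
    (p : D) (h : L.circ S (L.dart c 0) ≠ L.circ S (L.dart c 2))
    (h' : L.circ S (L.dart c' 0) ≠ L.circ S (L.dart c' 2))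
    (h1 : L.circ (insert c S) (L.dart c' 0) = L.circ (insert c S) (L.dart c' 2)) (i : ZMod 4) :
    L.circ (insert c' (insert c S)) (L.dart c i) = L.circ (insert c' (insert c S)) (L.dart c' 1) ∨
    L.circ (insert c' (insert c S)) (L.dart c i) =
      L.circ (insert c' (insert c S)) (L.dart c' 3) := by
  have hc1 : c' ∉ insert c S := by simp [hc', hcc.symm]
  have ht : L.Through S c (L.dart c' 0) := (((circ_merge_iff hc p h _ _).1 h1).resolve_left h').1
  exact circ_insert_or_of_through hc1 h1
    (Or.inl (circ_insert_of_through hc p h (through_dart hc i) ht))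

/-- Commutativity of a face of the cube, checked on the generator 1. Each path is a product of
merges (1 ↦ 1) and divisions (1 ↦ x + y), and lowering operators commute with everything. -/
theorem khC_khC_top (c c' : X) (hcc : c ≠ c') (S : Finset X) :
    L.khC p A c' (L.khC p A c (L.top p A S)) + L.khC p A c (L.khC p A c' (L.top p A S)) = 0 := by
  have hadd := add_self_module F A (M := L.KT p A)
  by_cases hc : c ∈ S
  · rw [khC_top_of_mem hc, map_zero, zero_add]
    by_cases hc' : c' ∈ S
    · rw [khC_top_of_mem hc', map_zero]
    · have hm : c ∈ insert c' S := Finset.mem_insert_of_mem hc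
      by_cases h : L.circ S (L.dart c' 0) = L.circ S (L.dart c' 2)
      · rw [khC_top_split hc' h, map_add, khC_lowerD, khC_lowerD, khC_top_of_mem hm]
        simp
      · rw [khC_top_merge hc' h, khC_top_of_mem hm]
  by_cases hc' : c' ∈ S
  · rw [khC_top_of_mem hc', map_zero, add_zero]
    have hm : c' ∈ insert c S := Finset.mem_insert_of_mem hc'
    by_cases h : L.circ S (L.dart c 0) = L.circ S (L.dart c 2)
    · rw [khC_top_split hc h, map_add, khC_lowerD, khC_lowerD, khC_top_of_mem hm]
      simp
    · rw [khC_top_merge hc h, khC_top_of_mem hm]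
  have hc1 : c' ∉ insert c S := by simp [hc', hcc.symm]
  have hc1' : c ∉ insert c' S := by simp [hc, hcc]
  have hins : insert c (insert c' S) = insert c' (insert c S) := Finset.insert_comm _ _ _
  have main : L.circ S (L.dart c 0) ≠ L.circ S (L.dart c 2) →
      L.circ S (L.dart c' 0) ≠ L.circ S (L.dart c' 2) →
      L.circ (insert c S) (L.dart c' 0) = L.circ (insert c S) (L.dart c' 2) →
      L.circ (insert c' S) (L.dart c 0) = L.circ (insert c' S) (L.dart c 2) →
      L.lowerD p A (L.dart c 1) (L.top p A (insert c' (insert c S))) +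
        L.lowerD p A (L.dart c 3) (L.top p A (insert c' (insert c S))) =
      L.lowerD p A (L.dart c' 1) (L.top p A (insert c' (insert c S))) +
        L.lowerD p A (L.dart c' 3) (L.top p A (insert c' (insert c S))) := by
    intro h h' h1 h1'
    have hne : L.circ (insert c (insert c' S)) (L.dart c 1) ≠
        L.circ (insert c (insert c' S)) (L.dart c 3) :=
      fun h2 => (L.circ_insert_eq_iff_ne p hc1').1 h2 h1'
    rw [hins] at hne
    rcases circ_merge_split hc hc' hcc p h h' h1 1 with e1 | e1 <;>
    rcases circ_merge_split hc hc' hcc p h h' h1 3 with e3 | e3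
    · exact absurd (e1.trans e3.symm) hne
    · rw [lowerD_top_congr e1, lowerD_top_congr e3]
    · rw [lowerD_top_congr e1, lowerD_top_congr e3, add_comm]
    · exact absurd (e1.trans e3.symm) hne
  have hcard : ∀ {S : Finset X} {c : X}, c ∉ S → Fintype.card (L.Circle S) =
      Fintype.card (L.Circle (insert c S)) + 1 ∧
        L.circ S (L.dart c 0) ≠ L.circ S (L.dart c 2) ∨
      Fintype.card (L.Circle (insert c S)) = Fintype.card (L.Circle S) + 1 ∧
        L.circ S (L.dart c 0) = L.circ S (L.dart c 2) := by
    intro S c hc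
    by_cases h : L.circ S (L.dart c 0) = L.circ S (L.dart c 2)
    · exact Or.inr ⟨card_circle_split hc p h, h⟩
    · exact Or.inl ⟨card_circle_merge hc p h, h⟩
  have k1 := hcard hc
  have k2 := hcard hc1
  have k3 := hcard hc'
  have k4 := hcard hc1'
  rw [hins] at k4
  have hz : ∀ {c c' : X}, c ∉ insert c' S →
      L.circ (insert c' S) (L.dart c 0) ≠ L.circ (insert c' S) (L.dart c 2) →
      L.lowerD p A (L.dart c 1) (L.top p A (insert c (insert c' S))) =
        L.lowerD p A (L.dart c 3) (L.top p A (insert c (insert c' S))) :=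
    fun hn h => lowerD_top_congr ((L.circ_insert_eq_iff_ne p hn).2 h)
  -- Both paths end with the same number of circles, so counting leaves six of the sixteen
  -- combinations.
  rcases k1 with ⟨n1, h1⟩ | ⟨n1, h1⟩ <;> rcases k3 with ⟨n3, h3⟩ | ⟨n3, h3⟩ <;>
    rcases k2 with ⟨n2, h2⟩ | ⟨n2, h2⟩ <;> rcases k4 with ⟨n4, h4⟩ | ⟨n4, h4⟩ <;> try omega
  · rw [khC_top_merge hc h1, khC_top_merge hc' h3, khC_top_merge hc1 h2, khC_top_merge hc1' h4,
      hins, hadd]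
  · rw [khC_top_merge hc h1, khC_top_merge hc' h3, khC_top_split hc1 h2, khC_top_split hc1' h4,
      hins, main h1 h3 h2 h4, hadd]
  · rw [khC_top_merge hc h1, khC_top_split hc' h3, khC_top_split hc1 h2, map_add, khC_lowerD,
      khC_lowerD, khC_top_merge hc1' h4, hins, hadd]
  · rw [khC_top_split hc h1, khC_top_merge hc' h3, khC_top_split hc1' h4, map_add, khC_lowerD,
      khC_lowerD, khC_top_merge hc1 h2, hins, hadd]
  -- Division followed by merging is zero on both paths: it gives x + x in characteristic two.
  · have e4 := hz hc1' h4
    rw [hins] at e4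
    rw [khC_top_split hc h1, khC_top_split hc' h3, map_add, map_add, khC_lowerD, khC_lowerD,
      khC_lowerD, khC_lowerD, khC_top_merge hc1 h2, khC_top_merge hc1' h4, hins, e4, hadd,
      hz hc1 h2, hadd, add_zero]
  · rw [khC_top_split hc h1, khC_top_split hc' h3, map_add, map_add, khC_lowerD, khC_lowerD,
      khC_lowerD, khC_lowerD, khC_top_split hc1 h2, khC_top_split hc1' h4, hins]
    simp only [map_add]
    rw [lowerD_comm (L.dart c' 1) (L.dart c 1), lowerD_comm (L.dart c' 1) (L.dart c 3),
      lowerD_comm (L.dart c' 3) (L.dart c 1), lowerD_comm (L.dart c' 3) (L.dart c 3),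
      add_add_add_comm (L.lowerD p A (L.dart c 1) (L.lowerD p A (L.dart c' 1) _)), hadd]

theorem khC_self (c : X) (x : L.KT p A) : L.khC p A c (L.khC p A c x) = 0 := by
  have : L.khC p A c ∘ₗ L.khC p A c = 0 := by
    refine eq_of_top (L.lowerD p A) (fun d x => ?_) (fun d x => ?_) (fun S => ?_)
    · simp only [LinearMap.comp_apply, khC_lowerD]
    · simp
    · rw [LinearMap.comp_apply, LinearMap.zero_apply]
      by_cases hc : c ∈ S
      · rw [khC_top_of_mem hc, map_zero]
      · have hm := Finset.mem_insert_self c S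
        by_cases h : L.circ S (L.dart c 0) = L.circ S (L.dart c 2)
        · rw [khC_top_split hc h, map_add, khC_lowerD, khC_lowerD, khC_top_of_mem hm]
          simp
        · rw [khC_top_merge hc h, khC_top_of_mem hm]
  exact LinearMap.congr_fun this x

theorem khC_khC (c c' : X) (hcc : c ≠ c') (x : L.KT p A) :
    L.khC p A c' (L.khC p A c x) + L.khC p A c (L.khC p A c' x) = 0 := by
  have : L.khC p A c' ∘ₗ L.khC p A c + L.khC p A c ∘ₗ L.khC p A c' = 0 := by
    refine eq_of_top (L.lowerD p A) (fun d x => ?_) (fun d x => ?_) (fun S => ?_)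
    · simp only [LinearMap.comp_apply, LinearMap.add_apply, khC_lowerD, map_add]
    · simp
    · exact khC_khC_top c c' hcc S
  exact LinearMap.congr_fun this x

theorem khD_khD (x : L.KT p A) : L.khD p A (L.khD p A x) = 0 := by
  rw [khD_eq_sum L p A x, map_sum]
  simp only [khD_eq_sum]
  exact sum_sum_eq_zero (fun i j => L.khC p A j (L.khC p A i x)) (fun i => khC_self i x)
    fun i j hij => khC_khC i j hij x

/-! ### The Koszul differential -/

variable (L) in
/-- An edge on a circle. -/
noncomputable def rep {S : Finset X} (C : L.Circle S) : D :=
  Function.surjInv (L.circ_surjective S) C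

theorem circ_rep {S : Finset X} (C : L.Circle S) : L.circ S (L.rep C) = C :=
  Function.surjInv_eq _ _

/-- The marked circle may be included in the sum, since lowering kills its v₋. In this form
commutation with other operators reduces to that of the lowering operators. -/
theorem koszulD_pure_eq (S : Finset X) (ε : L.State p S) :
    L.koszulD p A (L.pure p A S ε) = ∑ C : L.Circle S,
      algebraMap (FaceRing F) A (L.area p S C) • L.lowerD p A (L.rep C) (L.pure p A S ε) := by
  rw [koszulD_pure]
  refine Finset.sum_congr rfl fun C _ => ?_
  rw [lowerD_pure, circ_rep]
  split_ifs <;> simp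

theorem koszulD_lowerD (d : D) (x : L.KT p A) :
    L.koszulD p A (L.lowerD p A d x) = L.lowerD p A d (L.koszulD p A x) := by
  have : L.koszulD p A ∘ₗ L.lowerD p A d = L.lowerD p A d ∘ₗ L.koszulD p A := by
    refine L.kt_ext p A fun S ε => ?_
    simp only [LinearMap.comp_apply]
    rw [koszulD_pure_eq, map_sum]
    simp only [map_smul, lowerD_comm d]
    rw [lowerD_pure]
    split_ifs with h
    · rw [koszulD_pure_eq]
    · simp
  exact LinearMap.congr_fun this x

theorem koszulD_koszulD (x : L.KT p A) : L.koszulD p A (L.koszulD p A x) = 0 := by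
  have : L.koszulD p A ∘ₗ L.koszulD p A = 0 := by
    refine L.kt_ext p A fun S ε => ?_
    rw [LinearMap.comp_apply, LinearMap.zero_apply]
    conv_lhs => rw [koszulD_pure_eq, map_sum]
    simp only [map_smul, koszulD_lowerD]
    rw [koszulD_pure_eq]
    simp only [map_sum, Finset.smul_sum, map_smul]
    refine sum_sum_eq_zero _ (fun C => ?_) fun C C' _ => ?_
    · rw [lowerD_self, smul_zero, smul_zero]
    · rw [lowerD_comm, smul_comm]
      exact add_self_module F A _
  exact LinearMap.congr_fun this x

/-- The circles of the resolution with more circles map to those of the other one. Lowering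
operators within a fibre agree on the image `w`, and the areas in the fibre add up to the area of
the target. -/
theorem koszulD_khC_top (c : X) (S : Finset X) :
    L.koszulD p A (L.khC p A c (L.top p A S)) = L.khC p A c (L.koszulD p A (L.top p A S)) := by
  by_cases hc : c ∈ S
  · rw [khC_top_of_mem hc, map_zero, top, koszulD_pure_eq, map_sum]
    simp only [map_smul, khC_lowerD]
    have := khC_top_of_mem (L := L) (p := p) (A := A) hc
    rw [top] at this
    simp [this]
  set w := L.khC p A c (L.top p A S) with hw
  have hS : ∀ d d', L.circ S d = L.circ S d' → L.lowerD p A d w = L.lowerD p A d' w := by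
    intro d d' h
    rw [hw, ← khC_lowerD, ← khC_lowerD, lowerD_top_congr h]
  have hR : L.khC p A c (L.koszulD p A (L.top p A S)) = ∑ C : L.Circle S,
      algebraMap (FaceRing F) A (L.area p S C) • L.lowerD p A (L.rep C) w := by
    rw [top, koszulD_pure_eq, map_sum]
    simp only [map_smul, khC_lowerD]
    rfl
  have htop : L.koszulD p A (L.top p A (insert c S)) = ∑ C' : L.Circle (insert c S),
      algebraMap (FaceRing F) A (L.area p (insert c S) C') •
        L.lowerD p A (L.rep C') (L.top p A (insert c S)) := by
    rw [top, koszulD_pure_eq]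
  rw [hR]
  by_cases h : L.circ S (L.dart c 0) = L.circ S (L.dart c 2)
  · have hw' := khC_top_split (p := p) (A := A) hc h
    rw [← hw] at hw'
    have hL : L.koszulD p A w = ∑ C' : L.Circle (insert c S),
        algebraMap (FaceRing F) A (L.area p (insert c S) C') • L.lowerD p A (L.rep C') w := by
      conv_lhs => rw [hw']
      rw [map_add, koszulD_lowerD, koszulD_lowerD, htop, map_sum, map_sum, ← Finset.sum_add_distrib]
      refine Finset.sum_congr rfl fun C' _ => ?_
      rw [map_smul, map_smul, ← smul_add, hw', map_add, lowerD_comm (L.dart c 1),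
        lowerD_comm (L.dart c 3)]
    have hwd : ∀ d d', L.circ (insert c S) d = L.circ (insert c S) d' →
        L.circ S d = L.circ S d' := fun d d' hd => (circ_split_iff hc h d d').2 (Or.inl hd)
    let φ : L.Circle (insert c S) → L.Circle S := fun C' => L.circ S (L.rep C')
    have hφ : ∀ d, φ (L.circ (insert c S) d) = L.circ S d := fun d => hwd _ _ (circ_rep _)
    -- Collect the circles after the division according to the circle from which they arise.
    rw [hL, ← Finset.sum_fiberwise (s := Finset.univ) (g := φ)]
    refine Finset.sum_congr rfl fun C _ => ?_
    rw [area_eq_sum φ hφ C, map_sum, Finset.sum_smul]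
    refine Finset.sum_congr rfl fun C' hC' => ?_
    have hC'' : φ C' = C := (Finset.mem_filter.1 hC').2
    congr 1
    exact hS _ _ (by rw [circ_rep]; exact hC'')
  · have hw' := khC_top_merge (p := p) (A := A) hc h
    rw [← hw] at hw'
    have hwd : ∀ d d', L.circ S d = L.circ S d' →
        L.circ (insert c S) d = L.circ (insert c S) d' :=
      fun d d' hd => (circ_merge_iff hc p h d d').2 (Or.inl hd)
    let φ : L.Circle S → L.Circle (insert c S) := fun C => L.circ (insert c S) (L.rep C)
    have hφ : ∀ d, φ (L.circ S d) = L.circ (insert c S) d := fun d => hwd _ _ (circ_rep _)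
    rw [hw', htop, ← Finset.sum_fiberwise (s := Finset.univ) (g := φ)]
    refine Finset.sum_congr rfl fun C' _ => ?_
    rw [area_eq_sum φ hφ C', map_sum, Finset.sum_smul]
    refine Finset.sum_congr rfl fun C hC => ?_
    have hC' : φ C = C' := (Finset.mem_filter.1 hC).2
    congr 1
    exact lowerD_top_congr (by rw [circ_rep]; exact hC'.symm)

theorem koszulD_khD (x : L.KT p A) :
    L.koszulD p A (L.khD p A x) = L.khD p A (L.koszulD p A x) := by
  have : ∀ c, L.koszulD p A ∘ₗ L.khC p A c = L.khC p A c ∘ₗ L.koszulD p A := by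
    intro c
    refine eq_of_top (L.lowerD p A) (fun d x => ?_) (fun d x => ?_) (fun S => ?_)
    · simp only [LinearMap.comp_apply, khC_lowerD, koszulD_lowerD]
    · simp only [LinearMap.comp_apply, khC_lowerD, koszulD_lowerD]
    · exact koszulD_khC_top c S
  simp only [khD_eq_sum, map_sum]
  exact Finset.sum_congr rfl fun c _ => LinearMap.congr_fun (this c) x

theorem ktD_ktD (x : L.KT p A) : L.ktD p A (L.ktD p A x) = 0 := by
  simp only [ktD, LinearMap.add_apply, map_add]
  rw [khD_khD, koszulD_koszulD, koszulD_khD, zero_add, add_zero]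
  exact add_self_module F A _

end Operators

end LinkDiagram

/-! ### The grading and the filtration of the totally twisted complex. -/

theorem Finsupp.map_mem_of_mem_supported {α A N : Type*} [CommRing A] [AddCommGroup N] [Module A N]
    {s : Set α} {q : Submodule A N} (f : (α →₀ A) →ₗ[A] N)
    (h : ∀ a ∈ s, f (Finsupp.single a 1) ∈ q) {x : α →₀ A} (hx : x ∈ Finsupp.supported A A s) :
    f x ∈ q := by
  rw [Finsupp.supported_eq_span_single] at hx
  refine (Submodule.span_le (p := q.comap f)).2 ?_ hx
  rintro _ ⟨a, ha, rfl⟩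
  exact h a ha

theorem Finsupp.isInternal_supported {α A ι : Type*} [CommRing A] [DecidableEq ι] (deg : α → ι) :
    DirectSum.IsInternal fun n => Finsupp.supported A A {a | deg a = n} := by
  refine DirectSum.isInternal_submodule_of_iSupIndep_of_iSup_eq_top ?_ ?_
  · intro n
    have h : (⨆ j, ⨆ (_ : j ≠ n), Finsupp.supported A A {a | deg a = j}) ≤
        Finsupp.supported A A {a | deg a ≠ n} := by
      refine iSup₂_le fun j hj => Finsupp.supported_mono ?_
      rintro a rfl
      exact hj
    refine Disjoint.mono_right h (Finsupp.disjoint_supported_supported ?_)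
    rw [Set.disjoint_left]
    intro a h1 h2
    exact h2 h1
  · rw [← Finsupp.supported_iUnion]
    have h : ⋃ n, {a | deg a = n} = Set.univ := by
      ext a
      simp
    rw [h, Finsupp.supported_univ]

namespace LinkDiagram

variable {X D F : Type*} [Fintype X] [DecidableEq X] [Fintype D] [Fintype F]

section Grading

variable {L : LinkDiagram X D F} {p : D} {A : Type*} [CommRing A] [Algebra (FaceRing F) A]

theorem ktDeg_lower {S : Finset X} (ε : L.State p S) {C : L.Circle S} (h : ε.1 C = true) :
    L.ktDeg p ⟨S, ε.lower C⟩ = L.ktDeg p ⟨S, ε⟩ + 2 := by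
  have hC := State.ne_marked h
  have key : ∀ C', (if C' = L.circ S p then (0 : ℤ) else
      if (ε.lower C).1 C' = true then 1 else -1) =
      (if C' = L.circ S p then 0 else if ε.1 C' = true then 1 else -1) -
        if C' = C then 2 else 0 := by
    intro C'
    rw [State.lower_apply]
    by_cases h' : C' = C
    · subst h'
      simp [hC, h]
    · simp [h']
  simp only [ktDeg, qDeg]
  rw [Finset.sum_congr rfl fun C' _ => key C', Finset.sum_sub_distrib, Finset.sum_ite_eq',
    if_pos (Finset.mem_univ _)]
  ring

/-- The subtracted circle count omits the marked circle, so on single circle resolutions the degree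
reduces to |S| - n₊. -/
theorem ktDeg_allPlus (S : Finset X) : L.ktDeg p ⟨S, L.allPlus p S⟩ =
    S.card - (Fintype.card (L.Circle S) - 1) - L.nPlus := by
  have key : ∀ C', (if C' = L.circ S p then (0 : ℤ) else
      if (L.allPlus p S).1 C' = true then 1 else -1) = 1 - if C' = L.circ S p then 1 else 0 := by
    intro C'
    rw [allPlus_apply]
    by_cases h' : C' = L.circ S p <;> simp [h']
  simp only [ktDeg, qDeg]
  rw [Finset.sum_congr rfl fun C' _ => key C', Finset.sum_sub_distrib, Finset.sum_ite_eq',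
    if_pos (Finset.mem_univ _), Finset.sum_const, Finset.card_univ]
  simp
  ring

theorem pure_mem_ktGr (S : Finset X) (ε : L.State p S) :
    L.pure p A S ε ∈ L.ktGr p A (L.ktDeg p ⟨S, ε⟩) :=
  Finsupp.single_mem_supported A _ rfl

theorem lowerD_mem_ktGr (d : D) {n : ℤ} {x : L.KT p A} (hx : x ∈ L.ktGr p A n) :
    L.lowerD p A d x ∈ L.ktGr p A (n + 2) := by
  refine Finsupp.map_mem_of_mem_supported _ ?_ hx
  rintro ⟨S, ε⟩ rfl
  change L.lowerD p A d (L.pure p A S ε) ∈ _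
  rw [lowerD_pure]
  split_ifs with h
  · rw [← ktDeg_lower ε h]
    exact pure_mem_ktGr _ _
  · exact zero_mem _

/-- On the all-v₊ state a merge raises |S| and removes a circle, a gain of two; a division leaves
|S| minus the number of circles unchanged and then lowers once, also a gain of two. The other states
follow because lowering has degree two and commutes with the edge map. -/
theorem khC_pure_mem_ktGr (c : X) (S : Finset X) (ε : L.State p S) :
    L.khC p A c (L.pure p A S ε) ∈ L.ktGr p A (L.ktDeg p ⟨S, ε⟩ + 2) := by
  induction ε using state_induction with
  | h1 =>
    change L.khC p A c (L.top p A S) ∈ _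
    by_cases hc : c ∈ S
    · rw [khC_top_of_mem hc]
      exact zero_mem _
    have htop := pure_mem_ktGr (A := A) (insert c S) (L.allPlus p (insert c S))
    rw [ktDeg_allPlus, Finset.card_insert_of_notMem hc] at htop
    rw [ktDeg_allPlus]
    by_cases h : L.circ S (L.dart c 0) = L.circ S (L.dart c 2)
    · rw [khC_top_split hc h]
      have hcard := card_circle_split hc p h
      have e : (S.card : ℤ) - (Fintype.card (L.Circle S) - 1) - L.nPlus + 2 =
          ((S.card + 1 : ℕ) - (Fintype.card (L.Circle (insert c S)) - 1) - L.nPlus) + 2 := by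
        rw [hcard]; push_cast; ring
      rw [e]
      exact add_mem (lowerD_mem_ktGr _ htop) (lowerD_mem_ktGr _ htop)
    · rw [khC_top_merge hc h]
      have hcard := card_circle_merge hc p h
      have e : (S.card : ℤ) - (Fintype.card (L.Circle S) - 1) - L.nPlus + 2 =
          ((S.card + 1 : ℕ) - (Fintype.card (L.Circle (insert c S)) - 1) - L.nPlus) := by
        rw [hcard]; push_cast; ring
      rw [e]
      exact htop
  | h2 ε C hC ih =>
    obtain ⟨d, rfl⟩ := L.circ_surjective S C
    have hl : L.pure p A S (ε.lower (L.circ S d)) = L.lowerD p A d (L.pure p A S ε) := by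
      rw [lowerD_pure, if_pos hC]
    rw [hl, khC_lowerD, ktDeg_lower ε hC]
    exact lowerD_mem_ktGr d ih

theorem khD_mem_ktGr {n : ℤ} {x : L.KT p A} (hx : x ∈ L.ktGr p A n) :
    L.khD p A x ∈ L.ktGr p A (n + 2) := by
  rw [khD_eq_sum]
  refine sum_mem fun c _ => ?_
  refine Finsupp.map_mem_of_mem_supported _ ?_ hx
  rintro ⟨S, ε⟩ rfl
  exact khC_pure_mem_ktGr c S ε

theorem koszulD_mem_ktGr {n : ℤ} {x : L.KT p A} (hx : x ∈ L.ktGr p A n) :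
    L.koszulD p A x ∈ L.ktGr p A (n + 2) := by
  refine Finsupp.map_mem_of_mem_supported _ ?_ hx
  rintro ⟨S, ε⟩ rfl
  change L.koszulD p A (L.pure p A S ε) ∈ _
  rw [koszulD_pure_eq]
  exact sum_mem fun C _ => Submodule.smul_mem _ _ (lowerD_mem_ktGr _ (pure_mem_ktGr S ε))

/-- The sum of the spaces of the resolutions `S` with `Q S`. -/
noncomputable def part (L : LinkDiagram X D F) (p : D) (A : Type*) [CommRing A]
    (Q : Finset X → Prop) : Submodule A (L.KT p A) :=
  Finsupp.supported A A {g | Q g.1}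

theorem pure_mem_part {Q : Finset X → Prop} {S : Finset X} (h : Q S) (ε : L.State p S) :
    L.pure p A S ε ∈ L.part p A Q :=
  Finsupp.single_mem_supported A _ h

theorem koszulD_mem_part {Q : Finset X → Prop} {x : L.KT p A} (hx : x ∈ L.part p A Q) :
    L.koszulD p A x ∈ L.part p A Q := by
  refine Finsupp.map_mem_of_mem_supported _ ?_ hx
  rintro ⟨S, ε⟩ h
  change L.koszulD p A (L.pure p A S ε) ∈ _
  rw [koszulD_pure]
  refine sum_mem fun C _ => ?_
  split_ifs
  · exact Submodule.smul_mem _ _ (pure_mem_part h _)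
  · exact zero_mem _

theorem khC_mem_part {c : X} {Q Q' : Finset X → Prop} (hQ : ∀ S, c ∉ S → Q S → Q' (insert c S))
    {x : L.KT p A} (hx : x ∈ L.part p A Q) : L.khC p A c x ∈ L.part p A Q' := by
  classical
  refine Finsupp.map_mem_of_mem_supported _ ?_ hx
  rintro ⟨S, ε⟩ h
  change L.khC p A c (L.pure p A S ε) ∈ _
  rw [khC_pure]
  split_ifs with hc
  · exact zero_mem _
  · refine sum_mem fun ε' _ => ?_
    split_ifs
    · exact pure_mem_part (hQ S hc h) _
    · exact zero_mem _

theorem khD_mem_part {Q Q' : Finset X → Prop} (hQ : ∀ c S, c ∉ S → Q S → Q' (insert c S))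
    {x : L.KT p A} (hx : x ∈ L.part p A Q) : L.khD p A x ∈ L.part p A Q' := by
  rw [khD_eq_sum]
  exact sum_mem fun c _ => khC_mem_part (hQ c) hx

/-- The strict increase is what makes the perturbation nilpotent. -/
theorem khD_mem_ktFil {i : ℤ} {x : L.KT p A} (hx : x ∈ L.ktFil p A i) :
    L.khD p A x ∈ L.ktFil p A (i + 1) := by
  refine khD_mem_part (Q := fun S => i ≤ S.card) (Q' := fun S => i + 1 ≤ S.card) ?_ hx
  intro c S hc h
  rw [Finset.card_insert_of_notMem hc]
  push_cast
  omega

theorem ktFil_antitone : Antitone (L.ktFil p A) :=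
  fun _ _ hij => Finsupp.supported_mono fun _ h => hij.trans h

theorem ktD_mem_ktFil {i : ℤ} {x : L.KT p A} (hx : x ∈ L.ktFil p A i) :
    L.ktD p A x ∈ L.ktFil p A i :=
  add_mem (ktFil_antitone (by omega) (khD_mem_ktFil hx))
    (koszulD_mem_part (Q := fun S => i ≤ S.card) hx)

variable (L p A) in
theorem isFilteredComplex : IsFilteredComplex (L.ktGr p A) (L.ktFil p A) (L.ktD p A) where
  internal := Finsupp.isInternal_supported (A := A) (L.ktDeg p)
  d_d := ktD_ktD
  d_mem _ _ hx := add_mem (khD_mem_ktGr hx) (koszulD_mem_ktGr hx)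
  antitone := ktFil_antitone
  exists_eq_top := by
    refine ⟨0, ?_⟩
    rw [ktFil, ← Finsupp.supported_univ]
    congr 1
    ext g
    simp
  exists_eq_bot := by
    -- No resolution has |S| > |X|.
    refine ⟨Fintype.card X + 1, ?_⟩
    rw [ktFil, ← Finsupp.supported_empty]
    congr 1
    ext g
    have := Finset.card_le_univ g.1
    simp only [Set.mem_ofPred_eq, Set.mem_empty_iff_false, iff_false, not_le]
    exact_mod_cast Nat.lt_succ_of_le this
  homogeneous := by
    intro i
    refine le_antisymm (fun x hx => ?_) (iSup_le fun n => inf_le_left)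
    refine Finsupp.map_mem_of_mem_supported LinearMap.id ?_ hx
    intro g hg
    exact Submodule.mem_iSup_of_mem (L.ktDeg p g)
      ⟨Finsupp.single_mem_supported A _ hg, Finsupp.single_mem_supported A _ rfl⟩
  d_mem_fil _ _ hx := ktD_mem_ktFil hx

end Grading

/-! ### The contracting homotopy of the Koszul differential -/

section Homotopy

variable (L : LinkDiagram X D F) (p : D)

open scoped Classical in
/-- The homotopy `v₋ ↦ v₊ / [C]`, `v₊ ↦ 0` on a chosen unmarked circle `C`, if there is one. -/
noncomputable def raiseH : L.KT p (FaceField F) →ₗ[FaceField F] L.KT p (FaceField F) :=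
  Finsupp.linearCombination (FaceField F) fun g : L.KTGen p =>
    if h : ∃ C : L.Circle g.1, C ≠ L.circ g.1 p then
      if g.2.1 h.choose = false then
        (algebraMap (FaceRing F) (FaceField F) (L.area p g.1 h.choose))⁻¹ •
          L.pure p (FaceField F) g.1 (g.2.raise h.choose h.choose_spec)
      else 0
    else 0

open scoped Classical in
/-- The projection onto the single circle resolutions. -/
noncomputable def singleProj : L.KT p (FaceField F) →ₗ[FaceField F] L.KT p (FaceField F) :=
  Finsupp.linearCombination (FaceField F) fun g : L.KTGen p =>
    if ∃ C : L.Circle g.1, C ≠ L.circ g.1 p then 0 else L.pure p (FaceField F) g.1 g.2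

variable {L p} {S : Finset X} (ε : L.State p S)

theorem raiseH_pure_of_not (h : ¬ ∃ C : L.Circle S, C ≠ L.circ S p) :
    L.raiseH p (L.pure p _ S ε) = 0 := by
  refine ((Finsupp.linearCombination_single _ _ _).trans (one_smul _ _)).trans ?_
  rw [dif_neg h]

theorem raiseH_pure (h : ∃ C : L.Circle S, C ≠ L.circ S p) :
    L.raiseH p (L.pure p _ S ε) = if ε.1 h.choose = false then
      (algebraMap (FaceRing F) (FaceField F) (L.area p S h.choose))⁻¹ •
        L.pure p (FaceField F) S (ε.raise h.choose h.choose_spec) else 0 := by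
  refine ((Finsupp.linearCombination_single _ _ _).trans (one_smul _ _)).trans ?_
  rw [dif_pos h]

theorem singleProj_pure_of_not (h : ¬ ∃ C : L.Circle S, C ≠ L.circ S p) :
    L.singleProj p (L.pure p _ S ε) = L.pure p _ S ε := by
  refine ((Finsupp.linearCombination_single _ _ _).trans (one_smul _ _)).trans ?_
  rw [if_neg h]

theorem singleProj_pure (h : ∃ C : L.Circle S, C ≠ L.circ S p) :
    L.singleProj p (L.pure p _ S ε) = 0 := by
  refine ((Finsupp.linearCombination_single _ _ _).trans (one_smul _ _)).trans ?_
  rw [if_pos h]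

theorem koszulD_pure_of_not (h : ¬ ∃ C : L.Circle S, C ≠ L.circ S p) :
    L.koszulD p (FaceField F) (L.pure p _ S ε) = 0 := by
  rw [koszulD_pure]
  refine Finset.sum_eq_zero fun C _ => if_neg fun hC => h ⟨C, State.ne_marked hC⟩

theorem raiseH_raiseH (x) : L.raiseH p (L.raiseH p x) = 0 := by
  have : L.raiseH p ∘ₗ L.raiseH p = 0 := by
    refine L.kt_ext p _ fun S ε => ?_
    rw [LinearMap.comp_apply]
    by_cases h : ∃ C : L.Circle S, C ≠ L.circ S p
    · rw [raiseH_pure ε h]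
      split_ifs
      · rw [map_smul, raiseH_pure _ h, State.raise_apply]
        simp
      · simp
    · rw [raiseH_pure_of_not ε h]
      simp
  exact LinearMap.congr_fun this x

theorem raiseH_singleProj (x) : L.raiseH p (L.singleProj p x) = 0 := by
  have : L.raiseH p ∘ₗ L.singleProj p = 0 := by
    refine L.kt_ext p _ fun S ε => ?_
    rw [LinearMap.comp_apply]
    by_cases h : ∃ C : L.Circle S, C ≠ L.circ S p
    · rw [singleProj_pure ε h]
      simp
    · rw [singleProj_pure_of_not ε h, raiseH_pure_of_not ε h]
      simp
  exact LinearMap.congr_fun this x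

theorem singleProj_raiseH (x) : L.singleProj p (L.raiseH p x) = 0 := by
  have : L.singleProj p ∘ₗ L.raiseH p = 0 := by
    refine L.kt_ext p _ fun S ε => ?_
    rw [LinearMap.comp_apply]
    by_cases h : ∃ C : L.Circle S, C ≠ L.circ S p
    · rw [raiseH_pure ε h]
      split_ifs
      · rw [map_smul, singleProj_pure _ h]
        simp
      · simp
    · rw [raiseH_pure_of_not ε h]
      simp
  exact LinearMap.congr_fun this x

theorem koszulD_singleProj (x) : L.koszulD p (FaceField F) (L.singleProj p x) = 0 := by
  have : L.koszulD p (FaceField F) ∘ₗ L.singleProj p = 0 := by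
    refine L.kt_ext p _ fun S ε => ?_
    rw [LinearMap.comp_apply]
    by_cases h : ∃ C : L.Circle S, C ≠ L.circ S p
    · rw [singleProj_pure ε h]
      simp
    · rw [singleProj_pure_of_not ε h, koszulD_pure_of_not ε h]
      simp
  exact LinearMap.congr_fun this x

theorem singleProj_koszulD (x) : L.singleProj p (L.koszulD p (FaceField F) x) = 0 := by
  have : L.singleProj p ∘ₗ L.koszulD p (FaceField F) = 0 := by
    refine L.kt_ext p _ fun S ε => ?_
    rw [LinearMap.comp_apply]
    by_cases h : ∃ C : L.Circle S, C ≠ L.circ S p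
    · rw [koszulD_pure, map_sum]
      refine Finset.sum_eq_zero fun C _ => ?_
      split_ifs
      · rw [map_smul, singleProj_pure _ h, smul_zero]
      · rw [map_zero]
    · rw [koszulD_pure_of_not ε h]
      simp
  exact LinearMap.congr_fun this x

theorem algebraMap_area_ne_zero (S : Finset X) (C : L.Circle S) :
    algebraMap (FaceRing F) (FaceField F) (L.area p S C) ≠ 0 := by
  rw [Ne, map_eq_zero_iff _ (IsFractionRing.injective (FaceRing F) (FaceField F))]
  exact L.area_ne_zero p S C

/-- A Koszul complex is contracted by a homotopy on one factor with invertible coefficient. Without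
an unmarked circle both composites vanish, and the right side is x + x = 0. -/
theorem koszulD_raiseH (x) : L.koszulD p (FaceField F) (L.raiseH p x) +
    L.raiseH p (L.koszulD p (FaceField F) x) = x + L.singleProj p x := by
  have hadd := add_self_module F (FaceField F) (M := L.KT p (FaceField F))
  have : L.koszulD p (FaceField F) ∘ₗ L.raiseH p + L.raiseH p ∘ₗ L.koszulD p (FaceField F) =
      LinearMap.id + L.singleProj p := by
    refine L.kt_ext p _ fun S ε => ?_
    simp only [LinearMap.add_apply, LinearMap.comp_apply, LinearMap.id_apply]
    by_cases h : ∃ C : L.Circle S, C ≠ L.circ S p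
    · rw [singleProj_pure ε h, add_zero]
      -- The choice depends on S only, so the same circle is used for all states on L_S.
      set C₀ := h.choose with hC₀
      have hne : C₀ ≠ L.circ S p := h.choose_spec
      have hR : ∀ ε : L.State p S, L.raiseH p (L.pure p _ S ε) = if ε.1 C₀ = false then
          (algebraMap (FaceRing F) (FaceField F) (L.area p S C₀))⁻¹ •
            L.pure p (FaceField F) S (ε.raise C₀ hne) else 0 := fun ε => raiseH_pure ε h
      have ha := algebraMap_area_ne_zero (p := p) S C₀
      have ha' := algebraMap_smul (FaceField F) (M := L.KT p (FaceField F)) (L.area p S C₀)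
      rw [koszulD_pure L p _ S ε, map_sum]
      by_cases hε : ε.1 C₀ = false
      · rw [hR ε, if_pos hε, map_smul, koszulD_pure, Finset.smul_sum,
          ← Finset.sum_add_distrib, Finset.sum_eq_single C₀]
        · rw [State.raise_apply, if_pos rfl, if_pos rfl, State.lower_raise _ _ _ hε,
            if_neg (by simp [hε]), map_zero, add_zero, smul_smul, inv_mul_cancel₀ ha, one_smul]
        · intro C _ hC
          rw [State.raise_apply, if_neg hC]
          -- Raising C₀ and lowering C ≠ C₀ commute, so the two contributions of C cancel modulo 2.
          split_ifs with hεC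
          · rw [map_smul, hR, State.lower_apply, if_neg hC.symm, if_pos hε,
              State.raise_lower_comm _ _ _ _ hC, smul_comm, hadd]
          · simp
        · simp
      · rw [hR ε, if_neg hε, map_zero, zero_add, Finset.sum_eq_single C₀]
        · rw [Bool.not_eq_false] at hε
          rw [if_pos hε, map_smul, hR, State.lower_apply, if_pos rfl, if_pos rfl,
            State.raise_lower _ _ _ hε, smul_smul, mul_inv_cancel₀ ha, one_smul]
        · intro C _ hC
          split_ifs with hεC
          · rw [map_smul, hR, State.lower_apply, if_neg hC.symm, if_neg hε, smul_zero]
          · simp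
        · simp
    · rw [raiseH_pure_of_not ε h, koszulD_pure_of_not ε h, singleProj_pure_of_not ε h, hadd]
      simp
  exact LinearMap.congr_fun this x

theorem raiseH_mem_part {Q : Finset X → Prop} {x : L.KT p (FaceField F)}
    (hx : x ∈ L.part p _ Q) : L.raiseH p x ∈ L.part p _ Q := by
  refine Finsupp.map_mem_of_mem_supported _ ?_ hx
  rintro ⟨S, ε⟩ h
  change L.raiseH p (L.pure p _ S ε) ∈ _
  by_cases hS : ∃ C : L.Circle S, C ≠ L.circ S p
  · rw [raiseH_pure ε hS]
    split_ifs
    · exact Submodule.smul_mem _ _ (pure_mem_part h _)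
    · exact zero_mem _
  · rw [raiseH_pure_of_not ε hS]
    exact zero_mem _

theorem raiseH_mem_ktGr {n : ℤ} {x : L.KT p (FaceField F)} (hx : x ∈ L.ktGr p _ n) :
    L.raiseH p x ∈ L.ktGr p _ (n - 2) := by
  refine Finsupp.map_mem_of_mem_supported _ ?_ hx
  rintro ⟨S, ε⟩ rfl
  change L.raiseH p (L.pure p _ S ε) ∈ _
  by_cases hS : ∃ C : L.Circle S, C ≠ L.circ S p
  · rw [raiseH_pure ε hS]
    split_ifs with hε
    · refine Submodule.smul_mem _ _ ?_
      have h1 := ktDeg_lower (ε.raise hS.choose hS.choose_spec) (C := hS.choose)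
        (by rw [State.raise_apply, if_pos rfl])
      rw [State.lower_raise _ _ _ hε] at h1
      rw [h1, add_sub_cancel_right]
      exact pure_mem_ktGr _ _
    · exact zero_mem _
  · rw [raiseH_pure_of_not ε hS]
    exact zero_mem _

end Homotopy

end LinkDiagram

/-! ### The perturbation lemma in characteristic two -/

section Perturbation

variable {R : Type*} [Ring R] {a k H P G G' : R}

theorem one_add_mul_geom (h2 : ∀ x : R, x + x = 0) {f : R} {n : ℕ} (h : f ^ n = 0) :
    (1 + f) * ∑ i ∈ Finset.range n, f ^ i = 1 ∧
      (∑ i ∈ Finset.range n, f ^ i) * (1 + f) = 1 := by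
  have hneg : 1 + f = 1 - f := by
    rw [sub_eq_add_neg, neg_eq_of_add_eq_zero_left (h2 f)]
  rw [hneg, mul_neg_geom_sum, geom_sum_mul_neg, h, sub_zero]
  exact ⟨rfl, rfl⟩

/-- Up to a correction passing through P, multiplication by 1 + Hk intertwines the perturbed
differential with the unperturbed one. The rest of the perturbation lemma follows from this and its
mirror image. -/
theorem perturbation_mul_left (hk : k * k = 0) (hak : a * k = k * a)
    (haH : a * H + H * a = 1 + P) (h2 : ∀ x : R, x + x = 0) :
    (1 + H * k) * (a + k) = a * (1 + H * k) + P * k := by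
  have e : H * a = 1 + P + a * H := by
    rw [← haH, add_comm (a * H), add_assoc, h2, add_zero]
  calc (1 + H * k) * (a + k) = a + k + H * (k * a) + H * (k * k) := by noncomm_ring
    _ = a + k + (H * a) * k := by rw [hk, ← hak]; noncomm_ring
    _ = a * (1 + H * k) + P * k + (k + k) := by rw [e]; noncomm_ring
    _ = _ := by rw [h2, add_zero]

theorem perturbation_mul_right (hk : k * k = 0) (hak : a * k = k * a)
    (haH : a * H + H * a = 1 + P) (h2 : ∀ x : R, x + x = 0) :
    (a + k) * (1 + k * H) = (1 + k * H) * a + k * P := by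
  have e : a * H = 1 + P + H * a := by
    rw [← haH, add_assoc, h2, add_zero]
  calc (a + k) * (1 + k * H) = a + k + (a * k) * H + (k * k) * H := by noncomm_ring
    _ = a + k + k * (a * H) := by rw [hk, hak]; noncomm_ring
    _ = (1 + k * H) * a + k * P + (k + k) := by rw [e]; noncomm_ring
    _ = _ := by rw [h2, add_zero]

/-- The image of GP is a subcomplex with induced differential P k G P: after conjugation only the
correction through P survives, as aP = 0. -/
theorem perturbation_d_mul (hk : k * k = 0) (hak : a * k = k * a)
    (haH : a * H + H * a = 1 + P) (h2 : ∀ x : R, x + x = 0) (haP : a * P = 0)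
    (hG1 : G * (1 + H * k) = 1) (hG2 : (1 + H * k) * G = 1) :
    (a + k) * (G * P) = G * P * (k * G * P) := by
  have h1 := perturbation_mul_left hk hak haH h2
  calc (a + k) * (G * P) = G * ((1 + H * k) * (a + k)) * G * P := by
        rw [← mul_assoc G, hG1, one_mul, mul_assoc]
    _ = G * (a * ((1 + H * k) * G) * P + P * k * G * P) := by rw [h1]; noncomm_ring
    _ = G * P * (k * G * P) := by rw [hG2, mul_one, haP, zero_add]; noncomm_ring

theorem perturbation_mul_d (hk : k * k = 0) (hak : a * k = k * a)
    (haH : a * H + H * a = 1 + P) (h2 : ∀ x : R, x + x = 0) (hPa : P * a = 0)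
    (hG1 : G' * (1 + k * H) = 1) (hG2 : (1 + k * H) * G' = 1) :
    P * G' * (a + k) = P * G' * k * P * G' := by
  have h1 := perturbation_mul_right hk hak haH h2
  calc P * G' * (a + k) = P * G' * ((a + k) * (1 + k * H)) * G' := by
        rw [mul_assoc (P * G'), mul_assoc (a + k), hG2, mul_one]
    _ = P * (G' * (1 + k * H)) * a * G' + P * G' * k * P * G' := by rw [h1]; noncomm_ring
    _ = P * G' * k * P * G' := by rw [hG1, mul_one, hPa, zero_mul, zero_add]

theorem perturbation_intertwine (hG : G * (1 + H * k) = 1) (hG' : (1 + k * H) * G' = 1) :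
    G * H = H * G' := by
  calc G * H = G * H * ((1 + k * H) * G') := by rw [hG', mul_one]
    _ = G * (1 + H * k) * H * G' := by noncomm_ring
    _ = H * G' := by rw [hG, one_mul]

/-- G and G' differ from 1 by terms beginning, respectively ending, with H. The side conditions H² =
PH = HP = 0 kill them all. -/
theorem perturbation_proj (hHH : H * H = 0) (hPH : P * H = 0) (hHP : H * P = 0) (hPP : P * P = P)
    (h2 : ∀ x : R, x + x = 0) (hG : (1 + H * k) * G = 1) (hG' : G' * (1 + k * H) = 1) :
    P * G' * (G * P) = P := by
  have hneg : ∀ x : R, -x = x := fun x => neg_eq_of_add_eq_zero_left (h2 x)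
  have e : G = 1 + H * k * G := by
    calc G = (1 + H * k) * G + -(H * k * G) := by noncomm_ring
      _ = 1 + H * k * G := by rw [hG, hneg]
  have e' : G' = 1 + G' * k * H := by
    calc G' = G' * (1 + k * H) + -(G' * k * H) := by noncomm_ring
      _ = 1 + G' * k * H := by rw [hG', hneg]
  have h1 : G * P = P + H * (k * G * P) := by
    conv_lhs => rw [e]
    noncomm_ring
  have h1' : P * G' = P + P * G' * k * H := by
    conv_lhs => rw [e']
    noncomm_ring
  rw [h1, h1']
  calc _ = P * P + (P * H) * (k * G * P) + P * G' * k * (H * P) +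
        P * G' * k * (H * H) * (k * G * P) := by noncomm_ring
    _ = P := by rw [hPP, hPH, hHP, hHH]; noncomm_ring

/-- Multiplying by 1 + Hk on the left and 1 + kH on the right clears both inverses; what remains is
an identity of polynomials in a, k, H, P, and these factors can be cancelled since they are
invertible. -/
theorem perturbation_homotopy (hk : k * k = 0) (hak : a * k = k * a)
    (haH : a * H + H * a = 1 + P) (h2 : ∀ x : R, x + x = 0)
    (hG1 : G * (1 + H * k) = 1) (hG2 : (1 + H * k) * G = 1) (hG1' : G' * (1 + k * H) = 1)
    (hG2' : (1 + k * H) * G' = 1) :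
    (a + k) * (G * H) + (G * H) * (a + k) = 1 + G * P * G' := by
  have hGH := perturbation_intertwine hG1 hG2'
  have h1 := perturbation_mul_left hk hak haH h2
  have h1' := perturbation_mul_right hk hak haH h2
  have e : a * H = 1 + P + H * a := by
    rw [← haH, add_assoc, h2, add_zero]
  have e' : H * a = 1 + P + a * H := by
    rw [← haH, add_comm (a * H), add_assoc, h2, add_zero]
  -- GH = HG', so the right factor 1 + kH cancels G'; in `e2` the left factor cancels G directly.
  have e1 : (1 + H * k) * ((a + k) * (G * H)) * (1 + k * H) = (a * (1 + H * k) + P * k) * H := by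
    calc _ = ((1 + H * k) * (a + k)) * (G * H * (1 + k * H)) := by noncomm_ring
      _ = _ := by rw [hGH, mul_assoc H, hG1', mul_one, h1]
  have e2 : (1 + H * k) * (G * H * (a + k)) * (1 + k * H) = H * ((1 + k * H) * a + k * P) := by
    calc _ = ((1 + H * k) * G) * H * ((a + k) * (1 + k * H)) := by noncomm_ring
      _ = _ := by rw [hG2, one_mul, h1']
  have e3 : (a * (1 + H * k) + P * k) * H + H * ((1 + k * H) * a + k * P) =
      (1 + H * k) * (1 + k * H) + P := by
    calc (a * (1 + H * k) + P * k) * H + H * ((1 + k * H) * a + k * P)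
        = (a * H + H * a) + (a * H) * (k * H) + P * k * H + (H * k) * (H * a) + H * k * P := by
          noncomm_ring
      _ = (1 + P) + (1 + P + H * a) * (k * H) + P * k * H + (H * k) * (1 + P + a * H) +
          H * k * P := by
          have e5 : a * H * (k * H) = (1 + P + H * a) * (k * H) := by rw [e]
          have e6 : H * k * (H * a) = H * k * (1 + P + a * H) := by rw [e']
          rw [haH, e5, e6]
      _ = (1 + H * k) * (1 + k * H) + P - H * (k * k) * H + (P * k * H + P * k * H) +
          (H * k * P + H * k * P) + (H * (a * k) * H + H * (k * a) * H) := by noncomm_ring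
      _ = _ := by rw [hak, hk, h2, h2, h2]; noncomm_ring
  have e4 : (1 + H * k) * ((a + k) * (G * H) + (G * H) * (a + k)) * (1 + k * H) =
      (1 + H * k) * (1 + k * H) + P := by
    rw [mul_add (1 + H * k), add_mul _ _ (1 + k * H), e1, e2, e3]
  calc (a + k) * (G * H) + (G * H) * (a + k)
      = G * (1 + H * k) * ((a + k) * (G * H) + (G * H) * (a + k)) * ((1 + k * H) * G') := by
        rw [hG1, hG2', one_mul, mul_one]
    _ = G * ((1 + H * k) * ((a + k) * (G * H) + (G * H) * (a + k)) * (1 + k * H)) * G' := by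
        simp only [mul_assoc]
    _ = (G * (1 + H * k)) * ((1 + k * H) * G') + G * P * G' := by rw [e4]; noncomm_ring
    _ = 1 + G * P * G' := by rw [hG1, hG2', one_mul]

end Perturbation

/-- An endomorphism which raises a finite filtration is nilpotent. -/
theorem Module.End.pow_eq_zero_of_raises {K M : Type*} [CommRing K] [AddCommGroup M] [Module K M]
    {fil : ℤ → Submodule K M} {f : Module.End K M} {n : ℕ} (h0 : fil 0 = ⊤) (hn : fil n = ⊥)
    (hf : ∀ i, ∀ x ∈ fil i, f x ∈ fil (i + 1)) : f ^ n = 0 := by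
  have h : ∀ (n : ℕ) x, (f ^ n) x ∈ fil (n : ℤ) := by
    intro n x
    induction n with
    | zero => rw [Nat.cast_zero, h0]; trivial
    | succ n ih =>
      rw [pow_succ', Module.End.mul_apply]
      push_cast
      exact hf _ _ ih
  refine LinearMap.ext fun x => ?_
  have := h n x
  rwa [hn, Submodule.mem_bot] at this

/-- A contraction of the differential `a` onto `N` together with a commuting differential `k`, in
characteristic two. -/
structure PerturbedContraction (K M N : Type*) [CommRing K] [AddCommGroup M] [Module K M]
    [AddCommGroup N] [Module K N] where
  a : Module.End K M
  k : Module.End K M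
  H : Module.End K M
  incl : N →ₗ[K] M
  proj : M →ₗ[K] N
  bound : ℕ
  add_self : ∀ x : M, x + x = 0
  k_k : ∀ x, k (k x) = 0
  a_k : ∀ x, a (k x) = k (a x)
  a_H : ∀ x, a (H x) + H (a x) = x + incl (proj x)
  H_H : ∀ x, H (H x) = 0
  H_incl : ∀ y, H (incl y) = 0
  proj_H : ∀ x, proj (H x) = 0
  a_incl : ∀ y, a (incl y) = 0
  proj_a : ∀ x, proj (a x) = 0
  proj_incl : ∀ y, proj (incl y) = y
  pow_Hk : (H * k) ^ bound = 0
  pow_kH : (k * H) ^ bound = 0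

namespace PerturbedContraction

variable {K M N : Type*} [CommRing K] [AddCommGroup M] [Module K M] [AddCommGroup N] [Module K N]
  (c : PerturbedContraction K M N)

/-- The inverse of `1 + H k`. -/
def resolvent : Module.End K M := ∑ i ∈ Finset.range c.bound, (c.H * c.k) ^ i

/-- The inverse of `1 + k H`. -/
def resolvent' : Module.End K M := ∑ i ∈ Finset.range c.bound, (c.k * c.H) ^ i

/-- The perturbed inclusion. -/
def emb : N →ₗ[K] M := c.resolvent ∘ₗ c.incl

/-- The perturbed projection. -/
def ret : M →ₗ[K] N := c.proj ∘ₗ c.resolvent'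

/-- The perturbed homotopy. -/
def homotopy : Module.End K M := c.resolvent * c.H

/-- The induced differential. -/
def diff : Module.End K N := c.proj ∘ₗ c.k ∘ₗ c.resolvent ∘ₗ c.incl

theorem end_add_self (c : PerturbedContraction K M N) (f : Module.End K M) : f + f = 0 :=
  LinearMap.ext fun _ => c.add_self _

theorem resolvent_spec : (1 + c.H * c.k) * c.resolvent = 1 ∧
    c.resolvent * (1 + c.H * c.k) = 1 :=
  one_add_mul_geom c.end_add_self c.pow_Hk

theorem resolvent'_spec : (1 + c.k * c.H) * c.resolvent' = 1 ∧
    c.resolvent' * (1 + c.k * c.H) = 1 :=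
  one_add_mul_geom c.end_add_self c.pow_kH

theorem geom_mem {f : Module.End K M} {n : ℕ} {W : Submodule K M} (hf : ∀ x ∈ W, f x ∈ W) {x : M}
    (hx : x ∈ W) : (∑ i ∈ Finset.range n, f ^ i) x ∈ W := by
  rw [LinearMap.sum_apply]
  refine sum_mem fun i hi => ?_
  clear hi
  induction i with
  | zero => exact hx
  | succ i ih =>
    rw [pow_succ', Module.End.mul_apply]
    exact hf _ ih

theorem resolvent_mem {W : Submodule K M} (h : ∀ x ∈ W, c.H (c.k x) ∈ W) {x : M} (hx : x ∈ W) :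
    c.resolvent x ∈ W :=
  geom_mem (f := c.H * c.k) h hx

theorem resolvent'_mem {W : Submodule K M} (h : ∀ x ∈ W, c.k (c.H x) ∈ W) {x : M} (hx : x ∈ W) :
    c.resolvent' x ∈ W :=
  geom_mem (f := c.k * c.H) h hx

/-- The recursion G = 1 + HkG, which allows expanding G to any order. -/
theorem resolvent_apply (x : M) : c.resolvent x = x + c.H (c.k (c.resolvent x)) := by
  have h : c.resolvent x + c.H (c.k (c.resolvent x)) = x :=
    LinearMap.congr_fun c.resolvent_spec.1 x
  calc c.resolvent x
      = c.resolvent x + c.H (c.k (c.resolvent x)) + c.H (c.k (c.resolvent x)) := by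
        rw [add_assoc, c.add_self, add_zero]
    _ = x + c.H (c.k (c.resolvent x)) := by rw [h]

theorem k_mul_k : c.k * c.k = 0 := LinearMap.ext c.k_k

theorem a_mul_k : c.a * c.k = c.k * c.a := LinearMap.ext c.a_k

theorem a_mul_H : c.a * c.H + c.H * c.a = 1 + (c.incl ∘ₗ c.proj : Module.End K M) :=
  LinearMap.ext c.a_H

theorem d_emb (y : N) : c.a (c.emb y) + c.k (c.emb y) = c.emb (c.diff y) := by
  have h := perturbation_d_mul c.k_mul_k c.a_mul_k c.a_mul_H c.end_add_self
    (LinearMap.ext fun x => c.a_incl _) c.resolvent_spec.2 c.resolvent_spec.1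
  have h' := LinearMap.congr_fun h (c.incl y)
  simp only [Module.End.mul_apply, LinearMap.add_apply, LinearMap.comp_apply, c.proj_incl] at h'
  exact h'

theorem ret_d (x : M) : c.ret (c.a x + c.k x) = c.diff (c.ret x) := by
  have h := perturbation_mul_d c.k_mul_k c.a_mul_k c.a_mul_H c.end_add_self
    (LinearMap.ext fun x => (congrArg c.incl (c.proj_a x)).trans (map_zero _))
    c.resolvent'_spec.2 c.resolvent'_spec.1
  have h' := congrArg c.proj (LinearMap.congr_fun h x)
  -- kG = G'k, so the differential obtained on the side of the retraction equals the one on the side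
  -- of the embedding.
  have hk : ∀ x, c.k (c.resolvent x) = c.resolvent' (c.k x) := fun x => LinearMap.congr_fun
    (perturbation_intertwine (H := c.k) (k := c.H) c.resolvent'_spec.2 c.resolvent_spec.1).symm x
  simp only [Module.End.mul_apply, LinearMap.add_apply, LinearMap.comp_apply, c.proj_incl,
    ← hk] at h'
  exact h'

theorem ret_emb (y : N) : c.ret (c.emb y) = y := by
  have h := perturbation_proj (R := Module.End K M) (H := c.H) (k := c.k)
    (P := (c.incl ∘ₗ c.proj : Module.End K M)) (LinearMap.ext c.H_H)
    (LinearMap.ext fun x => (congrArg c.incl (c.proj_H x)).trans (map_zero _))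
    (LinearMap.ext fun x => c.H_incl _)
    (LinearMap.ext fun x => congrArg c.incl (c.proj_incl _)) c.end_add_self
    c.resolvent_spec.1 c.resolvent'_spec.2
  have h' := congrArg c.proj (LinearMap.congr_fun h (c.incl y))
  simp only [Module.End.mul_apply, LinearMap.comp_apply, c.proj_incl] at h'
  exact h'

theorem homotopy_spec (x : M) : c.a (c.homotopy x) + c.k (c.homotopy x) +
    c.homotopy (c.a x + c.k x) = x + c.emb (c.ret x) :=
  LinearMap.congr_fun (perturbation_homotopy c.k_mul_k c.a_mul_k c.a_mul_H c.end_add_self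
    c.resolvent_spec.2 c.resolvent_spec.1 c.resolvent'_spec.2 c.resolvent'_spec.1) x

end PerturbedContraction

/-! ### The spectral sequence of a filtered deformation retract -/

/-- A filtered deformation retraction of a filtered complex, in characteristic two, onto a complex
`N` which is graded by levels such that the differential raises the level by two. -/
structure FilteredRetraction {K M : Type*} (N : Type*) [CommRing K] [AddCommGroup M] [Module K M]
    [AddCommGroup N] [Module K N] (gr fil : ℤ → Submodule K M) (d : M →ₗ[K] M) where
  D : N →ₗ[K] N
  grN : ℤ → Submodule K N
  filN : ℤ → Submodule K N
  levN : ℤ → Submodule K N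
  lev : ℤ → N →ₗ[K] N
  shift : ℤ
  emb : N →ₗ[K] M
  ret : M →ₗ[K] N
  hom : M →ₗ[K] M
  add_self : ∀ x : M, x + x = 0
  d_emb : ∀ y, d (emb y) = emb (D y)
  ret_d : ∀ x, ret (d x) = D (ret x)
  ret_emb : ∀ y, ret (emb y) = y
  d_hom : ∀ x, d (hom x) + hom (d x) = x + emb (ret x)
  emb_fil : ∀ i, ∀ y ∈ filN i, emb y ∈ fil i
  emb_gr : ∀ n, ∀ y ∈ grN n, emb y ∈ gr n
  ret_fil : ∀ i, ∀ x ∈ fil i, ret x ∈ filN i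
  ret_gr : ∀ n, ∀ x ∈ gr n, ret x ∈ grN n
  hom_fil : ∀ i, ∀ x ∈ fil i, hom x ∈ fil i
  hom_gr : ∀ n, ∀ x ∈ gr n, hom x ∈ gr (n - 2)
  filN_antitone : Antitone filN
  gr_le_lev : ∀ n, grN n ≤ levN (n + shift)
  lev_le_fil : ∀ i, levN i ≤ filN i
  lev_mem : ∀ i y, lev i y ∈ levN i
  lev_gr : ∀ i n, ∀ y ∈ grN n, lev i y ∈ grN n
  lev_of_mem : ∀ i, ∀ y ∈ levN i, lev i y = y
  lev_eq_zero : ∀ i, ∀ y ∈ filN (i + 1), lev i y = 0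
  mem_fil_succ : ∀ i, ∀ y ∈ filN i, lev i y = 0 → y ∈ filN (i + 1)
  lev_D : ∀ i y, lev (i + 2) (D y) = D (lev i y)

namespace FilteredRetraction

variable {K M N : Type*} [CommRing K] [AddCommGroup M] [Module K M] [AddCommGroup N] [Module K N]
  {gr fil : ℤ → Submodule K M} {d : M →ₗ[K] M} (c : FilteredRetraction N gr fil d)

theorem eq_add (c : FilteredRetraction N gr fil d) (x : M) :
    x = c.emb (c.ret x) + d (c.hom x) + c.hom (d x) := by
  rw [add_assoc, c.d_hom, add_comm x, ← add_assoc, c.add_self, zero_add]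

/-- The homotopy identity at `d x` expresses this element by `d x` and its image under the
retraction and embedding, both in the same filtration step. -/
theorem d_hom_d_mem (h : IsFilteredComplex gr fil d) {j : ℤ} {x : M} (hx : d x ∈ fil j) :
    d (c.hom (d x)) ∈ fil j := by
  have e := c.d_hom (d x)
  rw [h.d_d, map_zero, add_zero] at e
  rw [e]
  exact add_mem hx (c.emb_fil _ _ (c.ret_fil _ _ hx))

theorem d_emb_ret_mem {j : ℤ} {x : M} (hx : d x ∈ fil j) : d (c.emb (c.ret x)) ∈ fil j := by
  rw [c.d_emb, ← c.ret_d]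
  exact c.emb_fil _ _ (c.ret_fil _ _ hx)

/-- The map `Z² → N` which induces the isomorphism of the page `E²`. -/
noncomputable def pageMap (i n : ℤ) : specZ gr fil d 2 i n →ₗ[K] ↥(c.levN i ⊓ c.grN n) :=
  LinearMap.codRestrict _ (c.lev i ∘ₗ c.ret ∘ₗ (specZ gr fil d 2 i n).subtype) fun x =>
    ⟨c.lev_mem _ _, c.lev_gr _ _ _ (c.ret_gr _ _ x.2.1.2)⟩

theorem pageMap_coe (i n : ℤ) (x : specZ gr fil d 2 i n) :
    (c.pageMap i n x : N) = c.lev i (c.ret x.1) := rfl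

/-- The embedding supplies preimages: an element of level i has its differential in level i + 2,
hence lies in Z². -/
theorem pageMap_surjective (i n : ℤ) : Function.Surjective (c.pageMap i n) := by
  rintro ⟨y, hy1, hy2⟩
  have hD : c.D y ∈ c.filN (i + 2) := by
    have e := c.lev_D i y
    rw [c.lev_of_mem i y hy1] at e
    rw [← e]
    exact c.lev_le_fil _ (c.lev_mem _ _)
  refine ⟨⟨c.emb y, ⟨c.emb_fil _ _ (c.lev_le_fil _ hy1), c.emb_gr _ _ hy2⟩, ?_⟩, Subtype.ext ?_⟩
  · change d (c.emb y) ∈ fil (i + 2)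
    rw [c.d_emb]
    exact c.emb_fil _ _ hD
  · rw [pageMap_coe, c.ret_emb]
    exact c.lev_of_mem i y hy1

/-- The class of x in E² is the leading term of its retraction. If that term vanishes, the homotopy
formula writes x as an element one step deeper plus a boundary. -/
theorem ker_pageMap (h : IsFilteredComplex gr fil d) (i n : ℤ) :
    (specB gr fil d 2 i n).comap (specZ gr fil d 2 i n).subtype =
      LinearMap.ker (c.pageMap i n) := by
  ext ⟨x, ⟨hx1, hx2⟩, hx3⟩
  replace hx3 : d x ∈ fil (i + 2) := hx3
  rw [LinearMap.mem_ker, ← Submodule.coe_eq_zero, pageMap_coe, Submodule.mem_comap]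
  change x ∈ specB gr fil d 2 i n ↔ c.lev i (c.ret x) = 0
  constructor
  · intro hx
    obtain ⟨z, hz, _, ⟨w, hw, rfl⟩, rfl⟩ := Submodule.mem_sup.1 hx
    rw [map_add, map_add, c.lev_eq_zero i _ (c.ret_fil _ _ hz.1.1), zero_add, c.ret_d]
    have hw1 := c.ret_fil _ _ hw.1.1
    -- w lies in step i - 1, so its level i - 2 vanishes, and D raises levels by two: nothing
    -- reaches level i.
    have e : i = i - 2 + 2 := by ring
    rw [e, c.lev_D, c.lev_eq_zero, map_zero]
    exact hw1
  · intro hx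
    have hy := c.mem_fil_succ i _ (c.ret_fil _ _ hx1) hx
    -- Split x as (emb ret x + hom d x) + d (hom x); the two summands match the two parts of the
    -- denominator.
    rw [c.eq_add x, add_right_comm]
    refine Submodule.add_mem_sup ?_ ⟨c.hom x, ⟨⟨?_, c.hom_gr _ _ hx2⟩, ?_⟩, rfl⟩
    · have e : i + 1 + (2 - 1) = i + 2 := by ring
      refine ⟨⟨add_mem (c.emb_fil _ _ hy) (h.antitone (by omega) (c.hom_fil _ _ hx3)),
        add_mem (c.emb_gr _ _ (c.ret_gr _ _ hx2)) ?_⟩, ?_⟩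
      · have := c.hom_gr _ _ (h.d_mem _ _ hx2)
        rwa [add_sub_cancel_right] at this
      · change d _ ∈ fil _
        rw [map_add, e]
        exact add_mem (c.d_emb_ret_mem hx3) (c.d_hom_d_mem h hx3)
    · exact h.antitone (by omega) (c.hom_fil _ _ hx1)
    · change d _ ∈ fil _
      exact h.antitone (by omega) (h.d_mem_fil _ _ (c.hom_fil _ _ hx1))

/-- The page `E²`. -/
theorem exists_pageEquiv (h : IsFilteredComplex gr fil d) :
    ∃ e : ∀ i n : ℤ, SpecPage gr fil d 2 i n ≃ₗ[K] ↥(c.levN i ⊓ c.grN n),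
      ∀ i n x, (e (i + 2) (n + 2) (h.pageD 2 i n x) : N) = c.D (e i n x) := by
  refine ⟨fun i n => (Submodule.quotEquivOfEq _ _ (c.ker_pageMap h i n)).trans
    ((c.pageMap i n).quotKerEquivOfSurjective (c.pageMap_surjective i n)), fun i n x => ?_⟩
  obtain ⟨x, rfl⟩ := Submodule.Quotient.mk_surjective _ x
  change c.lev (i + 2) (c.ret (d x.1)) = c.D (c.lev i (c.ret x.1))
  rw [c.ret_d, c.lev_D]

/-- The spectral sequence collapses at `E³`. -/
theorem pageD_eq_zero (c : FilteredRetraction N gr fil d) (h : IsFilteredComplex gr fil d)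
    (r : ℤ) (hr : 3 ≤ r) (i n : ℤ) :
    h.pageD r i n = 0 := by
  refine LinearMap.ext fun x => ?_
  obtain ⟨⟨x, ⟨hx1, hx2⟩, hx3⟩, rfl⟩ := Submodule.Quotient.mk_surjective _ x
  replace hx3 : d x ∈ fil (i + r) := hx3
  refine (Submodule.Quotient.mk_eq_zero _).2 ?_
  change d x ∈ specB gr fil d r (i + r) (n + 2)
  have e1 : i + r - r + 1 = i + 1 := by ring
  have e2 : n + 2 - 2 = n := by ring
  have e3 : i + 1 + (r - 1) = i + r := by ring
  have hy := c.gr_le_lev _ (c.ret_gr _ _ hx2)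
  have hDy : c.D (c.ret x) ∈ c.filN (i + r) := by
    rw [← c.ret_d]
    exact c.ret_fil _ _ hx3
  -- Both summands are differentials of elements to be placed in step i + 1; by `hmem` such
  -- differentials are zero on the page.
  have hdx : d x = d (c.emb (c.ret x)) + d (c.hom (d x)) := by
    conv_lhs => rw [c.eq_add x, map_add, map_add, h.d_d, add_zero]
  have hmem : ∀ z, z ∈ fil (i + 1) → z ∈ gr n → d z ∈ fil (i + r) →
      d z ∈ specB gr fil d r (i + r) (n + 2) := by
    intro z h1 h2 h3
    refine Submodule.mem_sup_right ⟨z, ?_, rfl⟩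
    rw [e1, e2]
    refine ⟨⟨h1, h2⟩, ?_⟩
    change d z ∈ fil _
    rw [e3]
    exact h3
  rw [hdx]
  refine add_mem ?_ (hmem _ (h.antitone (by omega) (c.hom_fil _ _ hx3)) ?_ (c.d_hom_d_mem h hx3))
  -- `ret x` lies at the single level n + shift. Either this is at least i + r - 2 ≥ i + 1, which
  -- uses r ≥ 3, or D (ret x) has level below i + r although it lies in step i + r, so it vanishes.
  · by_cases hj : i + r ≤ n + c.shift + 2
    · refine hmem _ (c.emb_fil _ _ (c.filN_antitone ?_ (c.lev_le_fil _ hy)))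
        (c.emb_gr _ _ (c.ret_gr _ _ hx2)) (c.d_emb_ret_mem hx3)
      omega
    · have e := c.lev_D (n + c.shift) (c.ret x)
      rw [c.lev_of_mem _ _ hy, c.lev_eq_zero _ _ (c.filN_antitone (by omega) hDy)] at e
      rw [c.d_emb, ← e, map_zero]
      exact zero_mem _
  · have := c.hom_gr _ _ (h.d_mem _ _ hx2)
    rwa [add_sub_cancel_right] at this

end FilteredRetraction

namespace LinkDiagram

variable {X D F : Type*} [Fintype X] [DecidableEq X] [Fintype D] [Fintype F]

/-! ### The spanning tree complex inside the totally twisted complex. -/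

section SpanningTreeComplex

variable (L : LinkDiagram X D F) (p : D)

/-- The inclusion of the spanning tree complex as the part of single circle resolutions. -/
noncomputable def treeIncl : L.CT →ₗ[FaceField F] L.KT p (FaceField F) :=
  Finsupp.linearCombination (FaceField F) fun T : L.singleCircle => L.top p (FaceField F) T.1

open scoped Classical in
/-- The projection to the spanning tree complex. -/
noncomputable def treeProj : L.KT p (FaceField F) →ₗ[FaceField F] L.CT :=
  Finsupp.linearCombination (FaceField F) fun g : L.KTGen p =>
    if h : g.1 ∈ L.singleCircle then (Finsupp.single ⟨g.1, h⟩ 1 : L.CT) else 0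

/-- The span of the single circle resolutions `T` with `Q T`. -/
noncomputable def ctPart (Q : Finset X → Prop) : Submodule (FaceField F) L.CT :=
  Finsupp.supported (FaceField F) (FaceField F) {T | Q T.1}

variable {L p}

theorem mem_singleCircle_iff (p : D) {S : Finset X} : S ∈ L.singleCircle ↔
    ¬ ∃ C : L.Circle S, C ≠ L.circ S p := by
  change Nat.card (L.Circle S) = 1 ↔ _
  rw [Nat.card_eq_fintype_card, Fintype.card_eq_one_iff]
  constructor
  · rintro ⟨C, hC⟩ ⟨C', hC'⟩
    exact hC' ((hC _).trans (hC _).symm)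
  · intro h
    exact ⟨L.circ S p, fun C => not_not.1 fun h' => h ⟨C, h'⟩⟩

theorem card_circle_of_mem {S : Finset X} (h : S ∈ L.singleCircle) :
    Fintype.card (L.Circle S) = 1 := by
  rw [← Nat.card_eq_fintype_card]
  exact h

theorem state_eq_allPlus {S : Finset X} (h : S ∈ L.singleCircle) (ε : L.State p S) :
    ε = L.allPlus p S := by
  refine Subtype.ext (funext fun C => ?_)
  have hC : C = L.circ S p := not_not.1 fun h' => (mem_singleCircle_iff p).1 h ⟨C, h'⟩
  rw [hC, ε.2, allPlus_apply]
  simp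

theorem treeIncl_single (T : L.singleCircle) :
    L.treeIncl p (Finsupp.single T 1) = L.top p (FaceField F) T.1 :=
  (Finsupp.linearCombination_single _ _ _).trans (one_smul _ _)

theorem treeProj_pure {S : Finset X} (h : S ∈ L.singleCircle) (ε : L.State p S) :
    L.treeProj p (L.pure p (FaceField F) S ε) = Finsupp.single ⟨S, h⟩ 1 := by
  refine ((Finsupp.linearCombination_single _ _ _).trans (one_smul _ _)).trans ?_
  rw [dif_pos h]

theorem treeProj_pure_of_not {S : Finset X} (h : S ∉ L.singleCircle) (ε : L.State p S) :
    L.treeProj p (L.pure p (FaceField F) S ε) = 0 := by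
  refine ((Finsupp.linearCombination_single _ _ _).trans (one_smul _ _)).trans ?_
  rw [dif_neg h]

theorem treeProj_treeIncl (y : L.CT) : L.treeProj p (L.treeIncl p y) = y := by
  have : L.treeProj p ∘ₗ L.treeIncl p = LinearMap.id := by
    refine Finsupp.lhom_ext' fun T => LinearMap.ext_ring ?_
    simp only [LinearMap.comp_apply, Finsupp.lsingle_apply, LinearMap.id_apply]
    rw [treeIncl_single, top, treeProj_pure T.2]
  exact LinearMap.congr_fun this y

theorem treeIncl_treeProj (x) : L.treeIncl p (L.treeProj p x) = L.singleProj p x := by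
  have : L.treeIncl p ∘ₗ L.treeProj p = L.singleProj p := by
    refine L.kt_ext p _ fun S ε => ?_
    rw [LinearMap.comp_apply]
    by_cases h : S ∈ L.singleCircle
    · rw [treeProj_pure h, singleProj_pure_of_not ε ((mem_singleCircle_iff p).1 h), treeIncl_single,
        top, state_eq_allPlus h ε]
    · rw [treeProj_pure_of_not h, singleProj_pure ε (not_not.1 (mt (mem_singleCircle_iff p).2 h)),
        map_zero]
  exact LinearMap.congr_fun this x

theorem singleProj_treeIncl (y : L.CT) :
    L.singleProj p (L.treeIncl p y) = L.treeIncl p y := by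
  rw [← treeIncl_treeProj, treeProj_treeIncl]

theorem treeProj_singleProj (x) : L.treeProj p (L.singleProj p x) = L.treeProj p x := by
  rw [← treeIncl_treeProj, treeProj_treeIncl]

theorem treeIncl_mem_part {Q : Finset X → Prop} {y : L.CT} (hy : y ∈ L.ctPart Q) :
    L.treeIncl p y ∈ L.part p (FaceField F) Q := by
  refine Finsupp.map_mem_of_mem_supported _ ?_ hy
  intro T hT
  rw [treeIncl_single]
  exact pure_mem_part hT _

theorem treeProj_mem_ctPart {Q : Finset X → Prop} {x} (hx : x ∈ L.part p (FaceField F) Q) :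
    L.treeProj p x ∈ L.ctPart Q := by
  refine Finsupp.map_mem_of_mem_supported _ ?_ hx
  rintro ⟨S, ε⟩ hS
  change L.treeProj p (L.pure p (FaceField F) S ε) ∈ _
  by_cases h : S ∈ L.singleCircle
  · rw [treeProj_pure h]
    exact Finsupp.single_mem_supported _ _ hS
  · rw [treeProj_pure_of_not h]
    exact zero_mem _

theorem treeIncl_mem_ktGr {n : ℤ} {y : L.CT} (hy : y ∈ L.ctGr n) :
    L.treeIncl p y ∈ L.ktGr p (FaceField F) n := by
  refine Finsupp.map_mem_of_mem_supported _ ?_ hy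
  rintro T rfl
  rw [treeIncl_single]
  have h := pure_mem_ktGr (p := p) (A := FaceField F) T.1 (L.allPlus p T.1)
  rw [ktDeg_allPlus, card_circle_of_mem T.2] at h
  change L.pure p (FaceField F) T.1 _ ∈ _
  simpa using h

theorem treeProj_mem_ctGr {n : ℤ} {x} (hx : x ∈ L.ktGr p (FaceField F) n) :
    L.treeProj p x ∈ L.ctGr n := by
  refine Finsupp.map_mem_of_mem_supported _ ?_ hx
  rintro ⟨S, ε⟩ rfl
  change L.treeProj p (L.pure p (FaceField F) S ε) ∈ _
  by_cases h : S ∈ L.singleCircle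
  · rw [treeProj_pure h]
    refine Finsupp.single_mem_supported _ _ ?_
    rw [state_eq_allPlus h ε, ktDeg_allPlus, card_circle_of_mem h]
    simp
  · rw [treeProj_pure_of_not h]
    exact zero_mem _

/-! ### The contraction onto the single circle resolutions -/

theorem ktFil_zero : L.ktFil p (FaceField F) 0 = ⊤ := by
  rw [ktFil, ← Finsupp.supported_univ]
  congr 1
  ext g
  simp

theorem ktFil_eq_bot : L.ktFil p (FaceField F) ((Fintype.card X + 1 : ℕ) : ℤ) = ⊥ := by
  rw [ktFil, ← Finsupp.supported_empty]
  congr 1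
  ext g
  have := Finset.card_le_univ g.1
  simp only [Set.mem_ofPred_eq, Set.mem_empty_iff_false, iff_false, not_le]
  exact_mod_cast Nat.lt_succ_of_le this

theorem raiseH_mem_ktFil {i : ℤ} {x} (hx : x ∈ L.ktFil p (FaceField F) i) :
    L.raiseH p x ∈ L.ktFil p (FaceField F) i :=
  raiseH_mem_part (Q := fun S => i ≤ S.card) hx

theorem raiseH_khD_mem_ktGr {n : ℤ} {x} (hx : x ∈ L.ktGr p (FaceField F) n) :
    L.raiseH p (L.khD p (FaceField F) x) ∈ L.ktGr p (FaceField F) n := by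
  have := raiseH_mem_ktGr (khD_mem_ktGr hx)
  rwa [add_sub_cancel_right] at this

theorem khD_raiseH_mem_ktGr {n : ℤ} {x} (hx : x ∈ L.ktGr p (FaceField F) n) :
    L.khD p (FaceField F) (L.raiseH p x) ∈ L.ktGr p (FaceField F) n := by
  have := khD_mem_ktGr (raiseH_mem_ktGr hx)
  rwa [sub_add_cancel] at this

variable (L p)

/-- The Koszul differential contracts onto the single circle resolutions, and the Khovanov
differential commutes with it. -/
noncomputable def contraction :
    PerturbedContraction (FaceField F) (L.KT p (FaceField F)) L.CT where
  a := L.koszulD p (FaceField F)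
  k := L.khD p (FaceField F)
  H := L.raiseH p
  incl := L.treeIncl p
  proj := L.treeProj p
  bound := Fintype.card X + 1
  add_self := add_self_module F (FaceField F)
  k_k := khD_khD
  a_k := koszulD_khD
  a_H x := by rw [treeIncl_treeProj]; exact koszulD_raiseH x
  H_H := raiseH_raiseH
  H_incl y := by rw [← singleProj_treeIncl]; exact raiseH_singleProj _
  proj_H x := by rw [← treeProj_singleProj, singleProj_raiseH]; exact map_zero _
  a_incl y := by rw [← singleProj_treeIncl]; exact koszulD_singleProj _
  proj_a x := by rw [← treeProj_singleProj, singleProj_koszulD]; exact map_zero _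
  proj_incl := treeProj_treeIncl
  pow_Hk := Module.End.pow_eq_zero_of_raises ktFil_zero ktFil_eq_bot
    fun _ _ hx => raiseH_mem_ktFil (khD_mem_ktFil hx)
  pow_kH := Module.End.pow_eq_zero_of_raises ktFil_zero ktFil_eq_bot
    fun _ _ hx => khD_mem_ktFil (raiseH_mem_ktFil hx)

variable {L p}

theorem resolvent_mem_ktFil {i : ℤ} {x} (hx : x ∈ L.ktFil p (FaceField F) i) :
    (L.contraction p).resolvent x ∈ L.ktFil p (FaceField F) i :=
  (L.contraction p).resolvent_mem (W := L.ktFil p (FaceField F) i)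
    (fun _ hx => ktFil_antitone (by omega) (raiseH_mem_ktFil (khD_mem_ktFil hx))) hx

theorem resolvent'_mem_ktFil {i : ℤ} {x} (hx : x ∈ L.ktFil p (FaceField F) i) :
    (L.contraction p).resolvent' x ∈ L.ktFil p (FaceField F) i :=
  (L.contraction p).resolvent'_mem (W := L.ktFil p (FaceField F) i)
    (fun _ hx => ktFil_antitone (by omega) (khD_mem_ktFil (raiseH_mem_ktFil hx))) hx

theorem resolvent_mem_ktGr {n : ℤ} {x} (hx : x ∈ L.ktGr p (FaceField F) n) :
    (L.contraction p).resolvent x ∈ L.ktGr p (FaceField F) n :=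
  (L.contraction p).resolvent_mem (W := L.ktGr p (FaceField F) n)
    (fun _ hx => raiseH_khD_mem_ktGr hx) hx

theorem resolvent'_mem_ktGr {n : ℤ} {x} (hx : x ∈ L.ktGr p (FaceField F) n) :
    (L.contraction p).resolvent' x ∈ L.ktGr p (FaceField F) n :=
  (L.contraction p).resolvent'_mem (W := L.ktGr p (FaceField F) n)
    (fun _ hx => khD_raiseH_mem_ktGr hx) hx

theorem resolvent_apply (x : L.KT p (FaceField F)) : (L.contraction p).resolvent x =
    x + L.raiseH p (L.khD p (FaceField F) ((L.contraction p).resolvent x)) :=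
  (L.contraction p).resolvent_apply x

/-! ### The differential of the spanning tree complex -/

/-- With two circles, lowering at the marked one gives zero. The other is lowered and then raised
back by the homotopy, leaving the inverse of its area. -/
theorem raiseH_lowerD_top {S : Finset X} {x y : D} (hxy : L.circ S x ≠ L.circ S y)
    (hall : ∀ C, C = L.circ S x ∨ C = L.circ S y) :
    L.raiseH p (L.lowerD p (FaceField F) x (L.top p (FaceField F) S) +
      L.lowerD p (FaceField F) y (L.top p (FaceField F) S)) =
      L.invArea p S • L.top p (FaceField F) S := by
  wlog hp : L.circ S p = L.circ S x generalizing x y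
  · rw [add_comm]
    exact this hxy.symm (fun C => (hall C).symm) ((hall _).resolve_left hp)
  have hy : L.circ S y ≠ L.circ S p := by rw [hp]; exact hxy.symm
  have huniq : ∀ C, C ≠ L.circ S p → C = L.circ S y := fun C hC =>
    (hall C).resolve_left (by rwa [hp] at hC)
  have h : ∃ C : L.Circle S, C ≠ L.circ S p := ⟨_, hy⟩
  have hinv : L.invArea p S = (algebraMap (FaceRing F) (FaceField F)
      (L.area p S (L.circ S y)))⁻¹ := by
    rw [invArea, Finset.sum_eq_single (L.circ S y)]
    · rw [if_neg hy]
    · intro C _ hC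
      rw [if_pos (not_not.1 (mt (huniq C) hC))]
    · simp
  have hch : h.choose = L.circ S y := huniq _ h.choose_spec
  rw [top, lowerD_pure, lowerD_pure, allPlus_apply, allPlus_apply, if_neg (by simp [hp]),
    if_pos (by simp [hy]), zero_add, raiseH_pure _ h, if_pos (by simp [State.lower_apply, hch]),
    hinv]
  simp only [hch]
  rw [State.raise_lower _ _ _ (by simp [allPlus_apply, hy])]

/-- Changing one crossing of a single circle divides it, so the homotopy acts on a two-circle
resolution. -/
theorem raiseH_khC_top {T : Finset X} (hT : T ∈ L.singleCircle) {c : X} (hc : c ∉ T) :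
    L.raiseH p (L.khC p (FaceField F) c (L.top p (FaceField F) T)) =
      L.invArea p (insert c T) • L.top p (FaceField F) (insert c T) := by
  have heq : ∀ d d', L.circ T d = L.circ T d' := by
    have := Fintype.card_le_one_iff.1 (card_circle_of_mem hT).le
    exact fun d d' => this _ _
  have h := heq (L.dart c 0) (L.dart c 2)
  rw [khC_top_split hc h]
  refine raiseH_lowerD_top (fun h' => (L.circ_insert_eq_iff_ne p hc).1 h' h) fun C => ?_
  obtain ⟨d, rfl⟩ := L.circ_surjective _ C
  exact circ_insert_or_of_through hc h (Or.inl (heq _ _))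

/-- A step that ends in a single circle must be a merge, since a division leaves at least two
circles; a merge has coefficient 1 on the all-v₊ state. -/
theorem treeProj_khC_top {S : Finset X} (c : X) (T' : L.singleCircle) :
    L.treeProj p (L.khC p (FaceField F) c (L.top p (FaceField F) S)) T' =
      if c ∉ S ∧ insert c S = T'.1 then 1 else 0 := by
  by_cases hc : c ∈ S
  · rw [khC_top_of_mem hc, if_neg (fun h => h.1 hc)]
    simp
  by_cases h : insert c S = T'.1
  · rw [if_pos ⟨hc, h⟩]
    have hs : insert c S ∈ L.singleCircle := h ▸ T'.2
    rw [khC_top_merge hc, top, treeProj_pure hs]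
    · have : (⟨insert c S, hs⟩ : L.singleCircle) = T' := Subtype.ext h
      rw [this, Finsupp.single_eq_same]
    · intro h02
      have h1 := card_circle_split hc p h02
      have h2 := card_circle_of_mem hs
      have h3 : 0 < Fintype.card (L.Circle S) := Fintype.card_pos_iff.2 ⟨L.circ S p⟩
      omega
  · rw [if_neg (fun h' => h h'.2)]
    have hm : L.khC p (FaceField F) c (L.top p (FaceField F) S) ∈
        L.part p (FaceField F) (fun S' => S' = insert c S) :=
      khC_mem_part (Q := fun S' => S' = S) (fun S' _ hS' => by rw [hS'])
        (pure_mem_part (Q := fun S' => S' = S) rfl _)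
    have := treeProj_mem_ctPart hm
    by_contra hne
    exact h ((Finsupp.mem_supported _ _).1 this (Finsupp.mem_support_iff.2 hne)).symm

theorem treeProj_khD_top {S : Finset X} (T' : L.singleCircle) (hcard : T'.1.card = S.card + 1) :
    L.treeProj p (L.khD p (FaceField F) (L.top p (FaceField F) S)) T' =
      if S ⊆ T'.1 then 1 else 0 := by
  rw [khD_eq_sum, map_sum, Finsupp.finsetSum_apply]
  simp only [treeProj_khC_top]
  by_cases h : S ⊆ T'.1
  · rw [if_pos h]
    have hd : (T'.1 \ S).card = 1 := by
      rw [Finset.card_sdiff_of_subset h, hcard]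
      omega
    obtain ⟨c, hc⟩ := Finset.card_eq_one.1 hd
    have hc' : ∀ x, (x ∈ T'.1 ∧ x ∉ S) ↔ x = c := by
      intro x
      rw [← Finset.mem_sdiff, hc, Finset.mem_singleton]
    have hins : insert c S = T'.1 := by
      refine Finset.eq_of_subset_of_card_le (Finset.insert_subset ((hc' c).2 rfl).1 h) ?_
      rw [Finset.card_insert_of_notMem ((hc' c).2 rfl).2, hcard]
    rw [Finset.sum_eq_single c]
    · rw [if_pos ⟨((hc' c).2 rfl).2, hins⟩]
    · rintro x - hx
      refine if_neg fun h' => hx ((hc' x).1 ⟨?_, h'.1⟩)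
      rw [← h'.2]
      exact Finset.mem_insert_self x S
    · simp
  · rw [if_neg h]
    refine Finset.sum_eq_zero fun c _ => if_neg fun h' => h ?_
    rw [← h'.2]
    exact Finset.subset_insert c S

theorem ctD_single_apply (T T' : L.singleCircle) : L.ctD p (Finsupp.single T 1) T' =
    if T.1 ⊆ T'.1 ∧ T'.1.card = T.1.card + 2 then L.pairing p T.1 T'.1 else 0 := by
  classical
  rw [ctD, Finsupp.linearCombination_single, one_smul, Finsupp.finsetSum_apply,
    Finset.sum_eq_single T']
  · split_ifs <;> simp
  · intro T'' _ hne
    split_ifs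
    · rw [Finsupp.single_eq_of_ne hne.symm]
    · rfl
  · intro h
    exact absurd (Finset.mem_univ _) h

theorem ct_apply_eq_zero {Q : Finset X → Prop} {y : L.CT} (hy : y ∈ L.ctPart Q) {T : L.singleCircle}
    (hT : ¬ Q T.1) : y T = 0 := by
  by_contra hne
  exact hT ((Finsupp.mem_supported _ _).1 hy (Finsupp.mem_support_iff.2 hne))

theorem ctGr_apply_eq_zero {n : ℤ} {y : L.CT} (hy : y ∈ L.ctGr n) {T : L.singleCircle}
    (hT : (T.1.card : ℤ) - L.nPlus ≠ n) : y T = 0 := by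
  by_contra hne
  exact hT ((Finsupp.mem_supported _ _).1 hy (Finsupp.mem_support_iff.2 hne))

/-- Expanding G = 1 + Hk + (Hk)²G, the number of changed crossings selects the term: πkHk changes
exactly two. Its two-step paths from T to T' pass through T ∪ {c} for c ∈ T' ∖ T, each with weight
1/[C]. -/
theorem ctD_eq (y : L.CT) :
    L.treeProj p (L.khD p (FaceField F) ((L.contraction p).resolvent (L.treeIncl p y))) =
      L.ctD p y := by
  have : L.treeProj p ∘ₗ L.khD p (FaceField F) ∘ₗ (L.contraction p).resolvent ∘ₗ L.treeIncl p =
      L.ctD p := by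
    refine Finsupp.lhom_ext' fun T => LinearMap.ext_ring (Finsupp.ext fun T' => ?_)
    simp only [LinearMap.comp_apply, Finsupp.lsingle_apply]
    rw [ctD_single_apply, treeIncl_single]
    by_cases hcard : T'.1.card = T.1.card + 2
    -- The zeroth order term reaches |T| + 1 only (`h10`), the remainder only |T| + 3 and beyond
    -- (`hz0`).
    · rw [resolvent_apply, resolvent_apply]
      set z := L.raiseH p (L.khD p (FaceField F) (L.raiseH p (L.khD p (FaceField F)
        ((L.contraction p).resolvent (L.top p (FaceField F) T.1)))))
        with hz
      have htop : L.top p (FaceField F) T.1 ∈ L.ktFil p (FaceField F) (T.1.card : ℤ) :=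
        pure_mem_part (Q := fun S => (T.1.card : ℤ) ≤ S.card) le_rfl _
      have hz' : L.khD p (FaceField F) z ∈ L.ktFil p (FaceField F) (T.1.card + 1 + 1 + 1 : ℤ) :=
        khD_mem_ktFil (raiseH_mem_ktFil (khD_mem_ktFil (raiseH_mem_ktFil (khD_mem_ktFil
          (resolvent_mem_ktFil htop)))))
      have hz0 := ct_apply_eq_zero (T := T')
        (treeProj_mem_ctPart (Q := fun S => (T.1.card + 1 + 1 + 1 : ℤ) ≤ S.card) hz')
        (by rw [hcard]; push_cast; omega)
      have h1 : L.khD p (FaceField F) (L.top p (FaceField F) T.1) ∈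
          L.part p (FaceField F) (fun S => S.card = T.1.card + 1) :=
        khD_mem_part (Q := fun S => S.card = T.1.card)
          (fun c S hc h => by rw [Finset.card_insert_of_notMem hc, h])
          (pure_mem_part (Q := fun S => S.card = T.1.card) rfl _)
      have h10 := ct_apply_eq_zero (T := T') (treeProj_mem_ctPart h1) (by omega)
      rw [map_add, map_add, map_add, map_add, map_add, map_add, Finsupp.add_apply,
        Finsupp.add_apply, h10, hz0, zero_add, add_zero]
      have hH : L.raiseH p (L.khD p (FaceField F) (L.top p (FaceField F) T.1)) =
          ∑ c, if c ∉ T.1 then L.invArea p (insert c T.1) • L.top p (FaceField F) (insert c T.1)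
            else 0 := by
        rw [khD_eq_sum, map_sum]
        refine Finset.sum_congr rfl fun c _ => ?_
        by_cases hc : c ∈ T.1
        · rw [khC_top_of_mem hc, map_zero, if_neg (not_not.2 hc)]
        · rw [raiseH_khC_top T.2 hc, if_pos hc]
      rw [hH, map_sum, map_sum, Finsupp.finsetSum_apply]
      have hterm : ∀ c, L.treeProj p (L.khD p (FaceField F) (if c ∉ T.1 then
          L.invArea p (insert c T.1) • L.top p (FaceField F) (insert c T.1) else 0)) T' =
          if c ∉ T.1 ∧ insert c T.1 ⊆ T'.1 then L.invArea p (insert c T.1) else 0 := by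
        intro c
        by_cases hc : c ∈ T.1
        · simp [hc]
        · rw [if_pos hc, map_smul, map_smul, Finsupp.smul_apply, treeProj_khD_top T' (by
            rw [Finset.card_insert_of_notMem hc, hcard])]
          by_cases h : insert c T.1 ⊆ T'.1 <;> simp [hc, h]
      rw [Finset.sum_congr rfl fun c _ => hterm c, ← Finset.sum_filter]
      by_cases hsub : T.1 ⊆ T'.1
      · rw [if_pos ⟨hsub, hcard⟩, pairing]
        refine Finset.sum_congr ?_ fun _ _ => rfl
        ext c
        simp only [Finset.mem_filter, Finset.mem_univ, true_and, Finset.mem_sdiff,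
          Finset.insert_subset_iff]
        tauto
      · rw [if_neg (fun h => hsub h.1)]
        refine Finset.sum_eq_zero fun c hc => absurd ?_ hsub
        exact (Finset.subset_insert c _).trans (Finset.mem_filter.1 hc).2.2
    · rw [if_neg (fun h => hcard h.2)]
      -- The map has degree 2, and the degree of a single circle resolution determines its number of
      -- 1-resolutions.
      have hT : (Finsupp.single T 1 : L.CT) ∈ L.ctGr (T.1.card - L.nPlus) :=
        Finsupp.single_mem_supported _ _ rfl
      have := treeProj_mem_ctGr (khD_mem_ktGr (resolvent_mem_ktGr (treeIncl_mem_ktGr (p := p) hT)))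
      rw [treeIncl_single] at this
      exact ctGr_apply_eq_zero this (by omega)
  exact LinearMap.congr_fun this y

theorem ctD_mem_ctGr {n : ℤ} {y : L.CT} (hy : y ∈ L.ctGr n) : L.ctD p y ∈ L.ctGr (n + 2) := by
  rw [← ctD_eq]
  exact treeProj_mem_ctGr (khD_mem_ktGr (resolvent_mem_ktGr (treeIncl_mem_ktGr hy)))

/-! ### The deformation retraction -/

variable (L p)

/-- The embedding of the spanning tree complex into the totally twisted Khovanov complex. -/
noncomputable def treeEmb : L.CT →ₗ[FaceField F] L.KT p (FaceField F) := (L.contraction p).emb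

/-- The retraction to the spanning tree complex. -/
noncomputable def treeRet : L.KT p (FaceField F) →ₗ[FaceField F] L.CT := (L.contraction p).ret

/-- The homotopy of the deformation retraction. -/
noncomputable def treeHomotopy : L.KT p (FaceField F) →ₗ[FaceField F] L.KT p (FaceField F) :=
  (L.contraction p).homotopy

variable {L p}

theorem ktD_apply (x : L.KT p (FaceField F)) : L.ktD p (FaceField F) x =
    (L.contraction p).a x + (L.contraction p).k x :=
  add_comm _ _

theorem diff_eq (y : L.CT) : (L.contraction p).diff y = L.ctD p y := ctD_eq y

theorem ktD_treeEmb (y : L.CT) :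
    L.ktD p (FaceField F) (L.treeEmb p y) = L.treeEmb p (L.ctD p y) := by
  rw [ktD_apply, ← diff_eq]
  exact (L.contraction p).d_emb y

theorem treeRet_ktD (x) : L.treeRet p (L.ktD p (FaceField F) x) = L.ctD p (L.treeRet p x) := by
  rw [ktD_apply, ← diff_eq]
  exact (L.contraction p).ret_d x

theorem treeRet_treeEmb (y : L.CT) : L.treeRet p (L.treeEmb p y) = y :=
  (L.contraction p).ret_emb y

theorem treeHomotopy_spec (x) : L.ktD p (FaceField F) (L.treeHomotopy p x) +
    L.treeHomotopy p (L.ktD p (FaceField F) x) = x + L.treeEmb p (L.treeRet p x) := by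
  rw [ktD_apply, ktD_apply]
  exact (L.contraction p).homotopy_spec x

theorem treeEmb_mem_ktFil {i : ℤ} {y : L.CT} (hy : y ∈ L.ctPart fun S => i ≤ S.card) :
    L.treeEmb p y ∈ L.ktFil p (FaceField F) i :=
  resolvent_mem_ktFil (treeIncl_mem_part hy)

theorem treeRet_mem_ctPart {i : ℤ} {x} (hx : x ∈ L.ktFil p (FaceField F) i) :
    L.treeRet p x ∈ L.ctPart fun S => i ≤ S.card :=
  treeProj_mem_ctPart (resolvent'_mem_ktFil hx)

theorem treeHomotopy_mem_ktFil {i : ℤ} {x} (hx : x ∈ L.ktFil p (FaceField F) i) :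
    L.treeHomotopy p x ∈ L.ktFil p (FaceField F) i :=
  resolvent_mem_ktFil (raiseH_mem_ktFil hx)

theorem treeEmb_mem_ktGr {n : ℤ} {y : L.CT} (hy : y ∈ L.ctGr n) :
    L.treeEmb p y ∈ L.ktGr p (FaceField F) n :=
  resolvent_mem_ktGr (treeIncl_mem_ktGr hy)

theorem treeRet_mem_ctGr {n : ℤ} {x} (hx : x ∈ L.ktGr p (FaceField F) n) :
    L.treeRet p x ∈ L.ctGr n :=
  treeProj_mem_ctGr (resolvent'_mem_ktGr hx)

theorem treeHomotopy_mem_ktGr {n : ℤ} {x} (hx : x ∈ L.ktGr p (FaceField F) n) :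
    L.treeHomotopy p x ∈ L.ktGr p (FaceField F) (n - 2) :=
  resolvent_mem_ktGr (raiseH_mem_ktGr hx)

variable (L p)

theorem isGradedComplex_ct : IsGradedComplex L.ctGr (L.ctD p) where
  internal := Finsupp.isInternal_supported fun T : L.singleCircle => (T.1.card : ℤ) - L.nPlus
  -- The square vanishes because the embedding is an injective chain map into a complex.
  d_d y := by
    have h := congrArg (L.treeRet p) (ktD_ktD (L.treeEmb p y))
    rwa [ktD_treeEmb, ktD_treeEmb, treeRet_treeEmb, map_zero] at h
  d_mem _ _ hy := ctD_mem_ctGr hy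

theorem treeEmb_injective : Function.Injective (L.treeEmb p) :=
  Function.LeftInverse.injective treeRet_treeEmb

theorem isDeformationRetract : IsDeformationRetract (L.ktGr p (FaceField F)) (L.ktD p (FaceField F))
    (LinearMap.range (L.treeEmb p)) where
  d_mem := by
    rintro _ ⟨y, rfl⟩
    rw [ktD_treeEmb]
    exact LinearMap.mem_range_self _ _
  exists_retraction := by
    refine ⟨(L.treeEmb p).rangeRestrict ∘ₗ L.treeRet p, L.treeHomotopy p, fun x => ?_, ?_,
      fun n x hx => ?_, fun n x hx => treeHomotopy_mem_ktGr hx, fun x => ?_⟩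
    · change L.treeEmb p (L.treeRet p _) = L.ktD p (FaceField F) (L.treeEmb p (L.treeRet p x))
      rw [treeRet_ktD, ktD_treeEmb]
    · rintro ⟨_, y, rfl⟩
      refine Subtype.ext ?_
      change L.treeEmb p (L.treeRet p (L.treeEmb p y)) = L.treeEmb p y
      rw [treeRet_treeEmb]
    · exact treeEmb_mem_ktGr (treeRet_mem_ctGr hx)
    · change L.treeEmb p (L.treeRet p x) - x = _
      rw [treeHomotopy_spec, sub_eq_add_neg,
        neg_eq_of_add_eq_zero_left (add_self_module F (FaceField F) x), add_comm]

theorem exists_equiv_retract : ∃ e : L.CT ≃ₗ[FaceField F] LinearMap.range (L.treeEmb p),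
    (∀ x, (e (L.ctD p x) : L.KT p (FaceField F)) = L.ktD p (FaceField F) (e x)) ∧
      ∀ n x, x ∈ L.ctGr n ↔ (e x : L.KT p (FaceField F)) ∈ L.ktGr p (FaceField F) n := by
  refine ⟨LinearEquiv.ofInjective _ (L.treeEmb_injective p), fun x => (ktD_treeEmb x).symm,
    fun n x => ⟨treeEmb_mem_ktGr, fun h => ?_⟩⟩
  have := treeRet_mem_ctGr h
  rwa [LinearEquiv.ofInjective_apply, treeRet_treeEmb] at this

end SpanningTreeComplex

end LinkDiagram

namespace LinkDiagram

variable {X D F : Type*} [Fintype X] [DecidableEq X] [Fintype D] [Fintype F]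

/-! ### The spectral sequence -/

section SpectralSequence

variable (L : LinkDiagram X D F) (p : D)

/-- The projection to the span of the single circle resolutions `T` with `|T| = i`. -/
noncomputable def levelProj (i : ℤ) : L.CT →ₗ[FaceField F] L.CT :=
  Finsupp.linearCombination (FaceField F) fun T : L.singleCircle =>
    if (T.1.card : ℤ) = i then (Finsupp.single T 1 : L.CT) else 0

variable {L p}

theorem levelProj_single (i : ℤ) (T : L.singleCircle) :
    L.levelProj i (Finsupp.single T 1) = if (T.1.card : ℤ) = i then Finsupp.single T 1 else 0 :=
  (Finsupp.linearCombination_single _ _ _).trans (one_smul _ _)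

theorem levelProj_apply (i : ℤ) (y : L.CT) (T : L.singleCircle) :
    L.levelProj i y T = if (T.1.card : ℤ) = i then y T else 0 := by
  classical
  have : Finsupp.lapply T ∘ₗ L.levelProj i =
      if (T.1.card : ℤ) = i then Finsupp.lapply (R := FaceField F) T else 0 := by
    refine Finsupp.lhom_ext' fun T' => LinearMap.ext_ring ?_
    simp only [LinearMap.comp_apply, Finsupp.lsingle_apply, levelProj_single, Finsupp.lapply_apply]
    by_cases h : T' = T
    · subst h
      split_ifs <;> simp
    · split_ifs <;> simp [Finsupp.single_eq_of_ne (Ne.symm h)]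
  have h := LinearMap.congr_fun this y
  rw [LinearMap.comp_apply, Finsupp.lapply_apply] at h
  rw [h]
  split_ifs <;> rfl

theorem mem_ctPart_iff {Q : Finset X → Prop} {y : L.CT} :
    y ∈ L.ctPart Q ↔ ∀ T : L.singleCircle, ¬ Q T.1 → y T = 0 := by
  refine ⟨fun h T hT => ct_apply_eq_zero h hT, fun h => ?_⟩
  refine (Finsupp.mem_supported _ _).2 fun T hT => ?_
  by_contra hQ
  exact (Finsupp.mem_support_iff.1 hT) (h T hQ)

/-- The tree differential is homogeneous of level two, which is why d₂ is all of it. -/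
theorem levelProj_ctD (i : ℤ) (y : L.CT) :
    L.levelProj (i + 2) (L.ctD p y) = L.ctD p (L.levelProj i y) := by
  have : L.levelProj (i + 2) ∘ₗ L.ctD p = L.ctD p ∘ₗ L.levelProj i := by
    refine Finsupp.lhom_ext' fun T => LinearMap.ext_ring (Finsupp.ext fun T' => ?_)
    simp only [LinearMap.comp_apply, Finsupp.lsingle_apply, levelProj_single, levelProj_apply]
    by_cases h : (T.1.card : ℤ) = i
    · rw [if_pos h, ctD_single_apply]
      split_ifs with h1 h2 <;> first | rfl | omega
    · rw [if_neg h, map_zero, ctD_single_apply]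
      split_ifs with h1 h2 <;> first | rfl | omega
  exact LinearMap.congr_fun this y

variable (L p)

/-- The deformation retraction to the spanning tree complex as a filtered retraction. -/
noncomputable def filteredRetraction : FilteredRetraction L.CT (L.ktGr p (FaceField F))
    (L.ktFil p (FaceField F)) (L.ktD p (FaceField F)) where
  D := L.ctD p
  grN := L.ctGr
  filN i := L.ctPart fun S => i ≤ S.card
  levN := L.ctLevel
  lev := L.levelProj
  shift := L.nPlus
  emb := L.treeEmb p
  ret := L.treeRet p
  hom := L.treeHomotopy p
  add_self := add_self_module F (FaceField F)
  d_emb := ktD_treeEmb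
  ret_d := treeRet_ktD
  ret_emb := treeRet_treeEmb
  d_hom := treeHomotopy_spec
  emb_fil _ _ := treeEmb_mem_ktFil
  emb_gr _ _ := treeEmb_mem_ktGr
  ret_fil _ _ := treeRet_mem_ctPart
  ret_gr _ _ := treeRet_mem_ctGr
  hom_fil _ _ := treeHomotopy_mem_ktFil
  hom_gr _ _ := treeHomotopy_mem_ktGr
  filN_antitone i j h := Finsupp.supported_mono fun T (hT : j ≤ _) => h.trans hT
  gr_le_lev n := Finsupp.supported_mono fun T (hT : _ = n) =>
    show (T.1.card : ℤ) = n + L.nPlus by omega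
  lev_le_fil i := Finsupp.supported_mono fun T (hT : _ = i) => hT.ge
  lev_mem i y := mem_ctPart_iff (Q := fun S => (S.card : ℤ) = i).2 fun T hT => by
    rw [levelProj_apply, if_neg hT]
  lev_gr i n y hy := mem_ctPart_iff (Q := fun S => (S.card : ℤ) - L.nPlus = n).2 fun T hT => by
    rw [levelProj_apply, ctGr_apply_eq_zero hy hT, ite_self]
  lev_of_mem i y hy := Finsupp.ext fun T => by
    rw [levelProj_apply]
    split_ifs with h
    · rfl
    · exact (ct_apply_eq_zero (Q := fun S => (S.card : ℤ) = i) hy h).symm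
  lev_eq_zero i y hy := Finsupp.ext fun T => by
    rw [levelProj_apply]
    split_ifs with h
    · exact ct_apply_eq_zero hy (by omega)
    · rfl
  mem_fil_succ i y hy h0 := mem_ctPart_iff.2 fun T hT => by
    by_cases h : (T.1.card : ℤ) = i
    · have := DFunLike.congr_fun h0 T
      rwa [levelProj_apply, if_pos h] at this
    · exact ct_apply_eq_zero hy (by omega)
  lev_D := levelProj_ctD

end SpectralSequence

end LinkDiagram

namespace LinkDiagram

variable {X D F : Type*} [Fintype X] [DecidableEq X] [Fintype D] [Fintype F]

/-! ### Single circle resolutions and spanning trees -/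

section Tait

variable {L : LinkDiagram X D F} {p : D} {χ : F → Bool} (hχ : L.IsCheckerboard χ) {S : Finset X}
  {b : Bool} {c : X} {i : ZMod 4}

theorem mem_bridged : c ∈ L.bridged χ b S ↔
    if c ∈ S then χ (L.left (L.dart c 0)) = b else χ (L.left (L.dart c 1)) = b := Iff.rfl

include hχ

theorem IsCheckerboard.color_add_two (c : X) (i : ZMod 4) :
    χ (L.left (L.dart c (i + 2))) = χ (L.left (L.dart c i)) := by
  obtain ⟨h1, h2, h3⟩ := hχ.odd c
  exact forall_zmod_four (P := fun i => χ (L.left (L.dart c (i + 2))) = χ (L.left (L.dart c i)))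
    h2 (h3.trans h1.symm) h2.symm (h1.trans h3.symm) i

theorem IsCheckerboard.color_add_one (c : X) (i : ZMod 4) :
    χ (L.left (L.dart c (i + 1))) = !χ (L.left (L.dart c i)) := by
  have h := hχ.corner_ne c (i + 1)
  rw [add_sub_cancel_right] at h
  exact (Bool.not_eq.2 h).symm ▸ by simp

theorem IsCheckerboard.exists_color (c : X) (b : Bool) : ∃ i, χ (L.left (L.dart c i)) = b := by
  by_cases h : χ (L.left (L.dart c 0)) = b
  · exact ⟨0, h⟩
  · exact ⟨1, by rw [(hχ.odd c).1]; exact Bool.not_eq.2 (Ne.symm h) ▸ by simp⟩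

theorem bridged_not (S : Finset X) (b : Bool) : L.bridged χ (!b) S = (L.bridged χ b S)ᶜ := by
  ext c
  rw [Set.mem_compl_iff, mem_bridged, mem_bridged]
  split_ifs <;> exact Bool.eq_not

/-- The coloring fixes which resolution of a crossing merges the corners of color `b`, so S can be
recovered from the merged crossings. Hence all subsets of X correspond bijectively. -/
theorem mem_iff_of_bridged (S : Finset X) (b : Bool) (c : X) :
    c ∈ S ↔ (c ∈ L.bridged χ b S ↔ χ (L.left (L.dart c 0)) = b) := by
  rw [mem_bridged, (hχ.odd c).1]
  by_cases hc : c ∈ S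
  · simp [hc]
  · rw [if_neg hc]
    refine iff_of_false hc ?_
    generalize χ _ = a
    revert a b
    decide

theorem bridged_injective (b : Bool) : Function.Injective (L.bridged χ b) := by
  intro S S' h
  ext c
  rw [mem_iff_of_bridged hχ S b, mem_iff_of_bridged hχ S' b, h]

theorem exists_bridged_eq (b : Bool) (T : Set X) : ∃ S, L.bridged χ b S = T := by
  classical
  refine ⟨Finset.univ.filter fun c => c ∈ T ↔ χ (L.left (L.dart c 0)) = b, Set.ext fun c => ?_⟩
  have h := mem_iff_of_bridged hχ (Finset.univ.filter fun c => c ∈ T ↔ χ (L.left (L.dart c 0)) = b)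
    b c
  rw [Finset.mem_filter, and_iff_right (Finset.mem_univ _)] at h
  tauto

/-- When corners i and i + 2 are merged, the two strands cut off the corners i + 1 and i + 3. -/
theorem circ_of_mem_bridged (hb : χ (L.left (L.dart c i)) = b) (hc : c ∈ L.bridged χ b S) :
    L.circ S (L.dart c (i + 1)) = L.circ S (L.dart c (i + 2)) := by
  subst hb
  obtain ⟨h1, h2, h3⟩ := hχ.odd c
  rw [mem_bridged] at hc
  split_ifs at hc with h
  · exact forall_zmod_four (P := fun i => χ (L.left (L.dart c 0)) = χ (L.left (L.dart c i)) →
      L.circ S (L.dart c (i + 1)) = L.circ S (L.dart c (i + 2))) (fun _ => L.circ_one_two h)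
      (fun e => by simp [h1] at e) (fun _ => L.circ_three_zero h) (fun e => by simp [h3] at e) i hc
  · exact forall_zmod_four (P := fun i => χ (L.left (L.dart c 1)) = χ (L.left (L.dart c i)) →
      L.circ S (L.dart c (i + 1)) = L.circ S (L.dart c (i + 2))) (fun e => by simp [h1] at e)
      (fun _ => L.circ_two_three h) (fun e => by simp [h1, h2] at e) (fun _ => L.circ_zero_one h)
      i hc

/-- Here ends i + 1 and i + 2 lie on different strands at `c`, as do ends 0 and 2, so both equations
say that the two strands belong to one circle. -/
theorem circ_of_not_mem_bridged (hb : χ (L.left (L.dart c i)) = b) (hc : c ∉ L.bridged χ b S) :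
    L.circ S (L.dart c (i + 1)) = L.circ S (L.dart c (i + 2)) ↔
      L.circ S (L.dart c 0) = L.circ S (L.dart c 2) := by
  subst hb
  obtain ⟨h1, h2, h3⟩ := hχ.odd c
  rw [mem_bridged] at hc
  split_ifs at hc with h
  · have e1 := L.circ_one_two h
    have e2 := L.circ_three_zero h
    exact forall_zmod_four (P := fun i => ¬ χ (L.left (L.dart c 0)) = χ (L.left (L.dart c i)) →
      (L.circ S (L.dart c (i + 1)) = L.circ S (L.dart c (i + 2)) ↔
      L.circ S (L.dart c 0) = L.circ S (L.dart c 2))) (fun e => absurd rfl e)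
      (fun _ => show L.circ S (L.dart c 2) = L.circ S (L.dart c 3) ↔ _ by rw [e2, eq_comm])
      (fun e => absurd h2.symm e)
      (fun _ => show L.circ S (L.dart c 0) = L.circ S (L.dart c 1) ↔ _ by rw [e1]) i hc
  · have e1 := L.circ_zero_one h
    have e2 := L.circ_two_three h
    exact forall_zmod_four (P := fun i => ¬ χ (L.left (L.dart c 1)) = χ (L.left (L.dart c i)) →
      (L.circ S (L.dart c (i + 1)) = L.circ S (L.dart c (i + 2)) ↔
      L.circ S (L.dart c 0) = L.circ S (L.dart c 2)))
      (fun _ => show L.circ S (L.dart c 1) = L.circ S (L.dart c 2) ↔ _ by rw [e1])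
      (fun e => absurd rfl e)
      (fun _ => show L.circ S (L.dart c 3) = L.circ S (L.dart c 0) ↔ _ by rw [e2, eq_comm])
      (fun e => absurd (h1.trans h3.symm) e) i hc

omit hχ in
-- The way from one corner to the opposite one crosses edges i + 1 and i + 2; the jumps cancel
-- exactly when they are equal.
theorem isPotential_opposite {u : L.Circle S → ZMod 2} {g : F → ZMod 2}
    (hg : L.IsPotential p S u g) (c : X) (i : ZMod 4) :
    g (L.left (L.dart c i)) = g (L.left (L.dart c (i + 2))) ↔
      u (L.circ S (L.dart c (i + 1))) = u (L.circ S (L.dart c (i + 2))) := by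
  have h1 := hg.2 (L.dart c (i + 1))
  have h2 := hg.2 (L.dart c (i + 2))
  rw [L.left_rev_dart, add_sub_cancel_right] at h1
  rw [L.left_rev_dart, show i + 2 - 1 = i + 1 by ring] at h2
  rw [← h1, ← h2]
  generalize g _ = x, g _ = y, g _ = z
  revert x y z
  decide

theorem isLink_iff (hb : χ (L.left (L.dart c i)) = b) {x y : F} :
    (L.taitGraph χ hχ b).IsLink c x y ↔
      (x = L.left (L.dart c i) ∧ y = L.left (L.dart c (i + 2))) ∨
        (x = L.left (L.dart c (i + 2)) ∧ y = L.left (L.dart c i)) := by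
  have e : i + 2 + 2 = i := by
    have : (2 + 2 : ZMod 4) = 0 := by decide
    rw [add_assoc, this, add_zero]
  have hb2 := (hχ.color_add_two c i).trans hb
  constructor
  · rintro ⟨hx, -, j, rfl, rfl⟩
    have key : ∀ i j : ZMod 4, j = i ∨ j = i + 2 ∨ j = i - 1 ∨ i = j - 1 := by decide
    rcases key i j with rfl | rfl | rfl | rfl
    · exact Or.inl ⟨rfl, rfl⟩
    · exact Or.inr ⟨rfl, by rw [e]⟩
    · exact absurd (hx.trans hb.symm) (hχ.corner_ne c i)
    · exact absurd (hb.trans hx.symm) (hχ.corner_ne c j)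
  · rintro (⟨rfl, rfl⟩ | ⟨rfl, rfl⟩)
    · exact ⟨hb, hb2, i, rfl, rfl⟩
    · exact ⟨hb2, hb, i + 2, rfl, by rw [e]⟩

/-- Two faces are connected by edges in `T`. -/
def Joined (b : Bool) (T : Set X) : F → F → Prop :=
  Relation.ReflTransGen fun x y => ∃ e ∈ T, (L.taitGraph χ hχ b).IsLink e x y

theorem joined_symm {T : Set X} {x y : F} (h : Joined hχ b T x y) : Joined hχ b T y x :=
  have : Std.Symm fun x y => ∃ e ∈ T, (L.taitGraph χ hχ b).IsLink e x y :=
    ⟨fun _ _ ⟨e, he, h⟩ => ⟨e, he, h.symm⟩⟩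
  Relation.ReflTransGen.stdSymm.symm _ _ h


theorem exists_isLink_dart (b : Bool) (c : X) : ∃ i, χ (L.left (L.dart c i)) = b ∧
    (L.taitGraph χ hχ b).IsLink c (L.left (L.dart c i)) (L.left (L.dart c (i + 2))) := by
  obtain ⟨i, hi⟩ := hχ.exists_color c b
  exact ⟨i, hi, (isLink_iff hχ hi).2 (Or.inl ⟨rfl, rfl⟩)⟩

/-- Corners merged by the resolution are not separated by any circle, so potentials are constant
along merged crossings. -/
theorem potential_eq_of_joined {u : L.Circle S → ZMod 2} {g : F → ZMod 2}
    (hg : L.IsPotential p S u g) {T : Set X} (hT : T ⊆ L.bridged χ b S) {x y : F}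
    (h : Joined hχ b T x y) : g x = g y := by
  induction h with
  | refl => rfl
  | tail _ h ih =>
    obtain ⟨e, he, hx, -, i, rfl, rfl⟩ := h
    rw [ih, isPotential_opposite hg, circ_of_mem_bridged hχ hx (hT he)]

omit hχ in
-- The two resolutions of `c` are interchanged; by `circ_insert_eq_iff_ne` this decides in opposite
-- ways whether one circle runs through both strands.
theorem exists_flip (L : LinkDiagram X D F) (p : D) (S : Finset X) (c : X) : ∃ S' : Finset X,
    (∀ x, x ≠ c → (x ∈ S' ↔ x ∈ S)) ∧ (c ∈ S' ↔ c ∉ S) ∧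
      (L.circ S' (L.dart c 0) = L.circ S' (L.dart c 2) ↔
        L.circ S (L.dart c 0) ≠ L.circ S (L.dart c 2)) := by
  by_cases hc : c ∈ S
  · have h1 := L.circ_insert_eq_iff_ne p (Finset.notMem_erase c S)
    rw [Finset.insert_erase hc, L.circ_one_two hc, L.circ_three_zero hc] at h1
    refine ⟨S.erase c, fun x hx => by simp [hx], by simp [hc], ?_⟩
    rw [Ne, eq_comm (a := L.circ S _), h1, not_not]
  · have h1 := L.circ_insert_eq_iff_ne p hc
    have hm : c ∈ insert c S := Finset.mem_insert_self c S
    refine ⟨insert c S, fun x hx => by simp [hx], by simp [hc], ?_⟩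
    rw [← h1, L.circ_one_two hm, L.circ_three_zero hm, eq_comm]

omit hχ in
theorem bridged_flip {S' : Finset X} (h1 : ∀ x, x ≠ c → (x ∈ S' ↔ x ∈ S)) {x : X} (hx : x ≠ c) :
    x ∈ L.bridged χ b S' ↔ x ∈ L.bridged χ b S := by
  rw [mem_bridged, mem_bridged]
  simp only [h1 x hx]

theorem bridged_flip_self {S' : Finset X} (h2 : c ∈ S' ↔ c ∉ S) :
    c ∈ L.bridged χ b S' ↔ c ∉ L.bridged χ b S := by
  rw [mem_bridged, mem_bridged, (hχ.odd c).1]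
  by_cases hc : c ∈ S
  · rw [if_pos hc, if_neg (fun h => h2.1 h hc)]
    exact Bool.not_eq_eq_eq_not.trans Bool.eq_not
  · rw [if_neg hc, if_pos (h2.2 hc), Bool.not_eq_eq_eq_not]
    generalize χ _ = a
    revert a b
    decide

/-- A single circle contains every edge, so within a side one moves only through merged corners,
that is, along edges of the Tait graphs, keeping the color. The two sides have opposite colors, so
faces of equal color lie on the same side. -/
theorem joined_of_single (p : D) (h1 : ∀ d d', L.circ S d = L.circ S d') {x y : F} (hx : χ x = b)
    (hy : χ y = b) : Joined hχ b (L.bridged χ b S) x y := by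
  have key : ∀ {f f'}, Relation.EqvGen (L.SideStep S (L.circ S p)) f f' →
      χ f = χ f' ∧ (χ f = b → Joined hχ b (L.bridged χ b S) f f') := by
    intro f f' h
    induction h with
    | rel f f' h =>
      cases h with
      | edge d hd => exact absurd (h1 _ _) hd
      | zero c hc =>
        refine ⟨(hχ.color_add_two c 1).symm, fun hb => .single ⟨c, ?_, ?_⟩⟩
        · rw [mem_bridged, if_neg hc, hb]
        · exact (isLink_iff hχ hb).2 (Or.inl ⟨rfl, rfl⟩)
      | one c hc =>
        refine ⟨(hχ.color_add_two c 0).symm, fun hb => .single ⟨c, ?_, ?_⟩⟩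
        · rw [mem_bridged, if_pos hc, hb]
        · exact (isLink_iff hχ hb).2 (Or.inl ⟨rfl, rfl⟩)
    | refl => exact ⟨rfl, fun _ => .refl⟩
    | symm a b _ ih => exact ⟨ih.1.symm, fun h => joined_symm hχ (ih.2 (ih.1.trans h))⟩
    | trans a b c _ _ ih1 ih2 =>
      exact ⟨ih1.1.trans ih2.1, fun h => (ih1.2 h).trans (ih2.2 (ih1.1.symm.trans h))⟩
  have hp := hχ p
  rcases L.sideStep_or S p x with h | h <;> rcases L.sideStep_or S p y with h' | h'
  · exact (key (.trans _ _ _ (.symm _ _ h) h')).2 hx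
  · exact absurd ((key h').1.trans (hy.trans (hx.symm.trans (key h).1.symm))) hp
  · exact absurd ((key h).1.trans (hx.trans (hy.symm.trans (key h').1.symm))) hp
  · exact (key (.trans _ _ _ (.symm _ _ h) h')).2 hx

/-- Changing the resolution at `e` divides the circle in two. A potential of one of them separates
the corners at `e` but is constant along all other merged crossings, so no path can avoid `e`. -/
theorem not_joined_of_single (p : D) (h1 : ∀ d d', L.circ S d = L.circ S d') {e : X}
    (he : e ∈ L.bridged χ b S) {x y : F} (hl : (L.taitGraph χ hχ b).IsLink e x y) :
    ¬ Joined hχ b (L.bridged χ b S \ {e}) x y := by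
  intro hj
  obtain ⟨S', hS', hm, hflip⟩ := exists_flip L p S e
  obtain ⟨hx, -, i, rfl, rfl⟩ := hl
  have he' : e ∉ L.bridged χ b S' := fun h => (bridged_flip_self hχ hm).1 h he
  have hne : L.circ S' (L.dart e (i + 1)) ≠ L.circ S' (L.dart e (i + 2)) := by
    rw [Ne, circ_of_not_mem_bridged hχ hx he', hflip]
    exact not_not.2 (h1 _ _)
  obtain ⟨g, hg⟩ := L.exists_isPotential p S' (L.indicator (L.circ S' (L.dart e (i + 1))))
  have h := potential_eq_of_joined hχ hg
    (fun x hx => (bridged_flip hS' (Set.notMem_singleton_iff.1 hx.2)).2 hx.1) hj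
  rw [isPotential_opposite hg, indicator, indicator, if_pos rfl, if_neg hne.symm] at h
  exact one_ne_zero h

theorem isSpanningTree_of_single (p : D) (h1 : ∀ d d', L.circ S d = L.circ S d') (b : Bool) :
    (L.taitGraph χ hχ b).IsSpanningTree (L.bridged χ b S) where
  subset c _ := by
    obtain ⟨i, -, h⟩ := exists_isLink_dart hχ b c
    exact ⟨_, _, h⟩
  nonempty := by
    by_cases h : χ (L.left p) = b
    · exact ⟨_, h⟩
    · exact ⟨L.left (L.rev p), by
        have := hχ p
        change χ _ = b
        revert h this
        generalize χ _ = x, χ _ = y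
        revert x y b
        decide⟩
  connected _ hx _ hy := joined_of_single hχ p h1 hx hy
  acyclic _ he _ _ hl := not_joined_of_single hχ p h1 he hl

/-- A potential of one circle is constant on each color because both trees connect all their
vertices. Its jump is then the same across every edge, so that circle contains every edge. -/
theorem single_of_isSpanningTree (p : D)
    (h : (L.taitGraph χ hχ b).IsSpanningTree (L.bridged χ b S))
    (h' : (L.taitGraph χ hχ !b).IsSpanningTree (L.bridged χ (!b) S)) (d d' : D) :
    L.circ S d = L.circ S d' := by
  obtain ⟨g, hg⟩ := L.exists_isPotential p S (L.indicator (L.circ S d'))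
  have hconst : ∀ x y, χ x = χ y → g x = g y := by
    intro x y hxy
    by_cases hx : χ x = b
    · exact potential_eq_of_joined hχ hg subset_rfl (h.connected x hx y (hxy.symm.trans hx))
    · have hx := Bool.eq_not.2 hx
      exact potential_eq_of_joined hχ hg subset_rfl (h'.connected x hx y (hxy.symm.trans hx))
  have h2 := hg.2 d'
  have h3 := hg.2 d
  rw [indicator, if_pos rfl] at h2
  have hc : g (L.left d) + g (L.left (L.rev d)) = g (L.left d') + g (L.left (L.rev d')) := by
    have e1 := hχ d
    have e2 := hχ d'
    by_cases hdd : χ (L.left d) = χ (L.left d')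
    · rw [hconst _ _ hdd, hconst (L.left (L.rev d)) (L.left (L.rev d'))]
      revert e1 e2 hdd
      generalize χ _ = x, χ _ = y, χ _ = z, χ _ = w
      revert x y z w
      decide
    · rw [add_comm, hconst (L.left (L.rev d)) (L.left d'), hconst (L.left d) (L.left (L.rev d'))]
      all_goals
        revert e1 e2 hdd
        generalize χ _ = x, χ _ = y, χ _ = z, χ _ = w
        revert x y z w
        decide
  by_contra hne
  rw [hc, h2, indicator, if_neg hne] at h3
  exact one_ne_zero h3

omit hχ in
/-- The side of color `b` of an edge. -/
def coloredSide (L : LinkDiagram X D F) (χ : F → Bool) (b : Bool) (d : D) : F :=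
  if χ (L.left d) = b then L.left d else L.left (L.rev d)

theorem coloredSide_rev (b : Bool) (d : D) :
    L.coloredSide χ b (L.rev d) = L.coloredSide χ b d := by
  have h := hχ d
  rw [coloredSide, coloredSide, L.rev_rev]
  split_ifs with h1 h2 h2
  · exact absurd (h1.trans h2.symm) h
  · rfl
  · rfl
  · exact absurd ((Bool.eq_not.2 h1).trans (Bool.eq_not.2 h2).symm) h

theorem coloredSide_succ (hb : χ (L.left (L.dart c i)) = b) :
    L.coloredSide χ b (L.dart c (i + 1)) = L.left (L.dart c i) := by
  rw [coloredSide, if_neg, L.left_rev_dart, add_sub_cancel_right]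
  rw [hχ.color_add_one, hb]
  simp

omit hχ in
theorem coloredSide_self (hb : χ (L.left (L.dart c i)) = b) :
    L.coloredSide χ b (L.dart c i) = L.left (L.dart c i) := if_pos hb

/-- Two neighboring ends share the corner between them. If it has the other color, their sides of
color `b` are the opposite corners adjacent to it, and the crossing is the edge joining these. -/
theorem coloredSide_step {T : Set X} (hT : χ (L.left (L.dart c (i + 1))) = b → c ∈ T) :
    Joined hχ b T (L.coloredSide χ b (L.dart c i)) (L.coloredSide χ b (L.dart c (i + 1))) := by
  by_cases hb : χ (L.left (L.dart c i)) = b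
  · rw [coloredSide_self hb, coloredSide_succ hχ hb]
    exact .refl
  · have h1 : χ (L.left (L.dart c (i + 1))) = b := by
      rw [hχ.color_add_one, Bool.eq_not.2 hb, Bool.not_not]
    have e : i + 1 + 2 + 1 = i := by
      have : (1 + 2 + 1 : ZMod 4) = 0 := by decide
      rw [add_assoc, add_assoc, ← add_assoc 1, this, add_zero]
    have h3 := (hχ.color_add_two c (i + 1)).trans h1
    have h4 := coloredSide_succ hχ h3
    rw [e] at h4
    rw [coloredSide_self h1, h4]
    exact .single ⟨c, hT h1, (isLink_iff hχ h1).2 (Or.inr ⟨rfl, rfl⟩)⟩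

/-- The sides of color `b` along a circle of `L_S` are connected by the crossings at which `L_S`
merges the corners of color `b`. -/
theorem joined_coloredSide {d d' : D} (h : L.circ S d = L.circ S d') :
    Joined hχ b (L.bridged χ b S) (L.coloredSide χ b d) (L.coloredSide χ b d') := by
  refine L.circ_induction (S := S) (r := fun d d' =>
    Joined hχ b (L.bridged χ b S) (L.coloredSide χ b d) (L.coloredSide χ b d'))
    ⟨fun _ => .refl, joined_symm hχ, Relation.ReflTransGen.trans⟩ (fun d d' hdd => ?_) h
  cases hdd with
  | edge => rw [coloredSide_rev hχ]; exact .refl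
  | zero_left c hc =>
    exact coloredSide_step hχ (i := 0) fun h => by rwa [mem_bridged, if_neg hc]
  | zero_right c hc =>
    exact coloredSide_step hχ (i := 2) fun h => by
      rw [mem_bridged, if_neg hc]; exact (hχ.color_add_two c 1).symm.trans h
  | one_left c hc =>
    exact coloredSide_step hχ (i := 1) fun h => by
      rw [mem_bridged, if_pos hc]; exact (hχ.color_add_two c 0).symm.trans h
  | one_right c hc =>
    exact coloredSide_step hχ (i := 3) fun h => by rwa [mem_bridged, if_pos hc]

/-- If two circles met at an edge `c` of the tree, the other resolution would merge them, and
following the merged circle would join the ends of `c` without `c`, a cycle. If they met at `c`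
outside the tree, the potential of one would separate two faces that the tree connects. -/
theorem circ_zero_two_of_isSpanningTree (p : D)
    (h : (L.taitGraph χ hχ b).IsSpanningTree (L.bridged χ b S)) (c : X) :
    L.circ S (L.dart c 0) = L.circ S (L.dart c 2) := by
  obtain ⟨i, hi, hl⟩ := exists_isLink_dart hχ b c
  by_cases hc : c ∈ L.bridged χ b S
  · by_contra hne
    obtain ⟨S', hS', hm, hflip⟩ := exists_flip L p S c
    have hc' : c ∉ L.bridged χ b S' := fun h => (bridged_flip_self hχ hm).1 h hc
    have hsub : L.bridged χ b S' ⊆ L.bridged χ b S \ {c} := by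
      intro x hx
      have hxc : x ≠ c := by rintro rfl; exact hc' hx
      exact ⟨(bridged_flip hS' hxc).1 hx, hxc⟩
    have hj := joined_coloredSide hχ (b := b)
      ((circ_of_not_mem_bridged hχ hi hc').2 (hflip.2 hne))
    rw [coloredSide_succ hχ hi, coloredSide_self ((hχ.color_add_two c i).trans hi)] at hj
    exact h.acyclic c hc _ _ hl (Relation.ReflTransGen.mono
      (fun _ _ ⟨e, he, hle⟩ => ⟨e, hsub he, hle⟩) _ _ hj)
  · rw [← circ_of_not_mem_bridged hχ hi hc]
    obtain ⟨g, hg⟩ := L.exists_isPotential p S (L.indicator (L.circ S (L.dart c (i + 1))))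
    have hj := potential_eq_of_joined hχ hg subset_rfl
      (h.connected _ hi _ ((hχ.color_add_two c i).trans hi))
    rw [isPotential_opposite hg, indicator, indicator, if_pos rfl] at hj
    by_contra hne
    rw [if_neg (Ne.symm hne)] at hj
    exact one_ne_zero hj

omit hχ in
-- All ends at each crossing lie on one circle, so circles coincide along the connected projection.
theorem circ_eq_of_isConnected (hL : L.IsConnected)
    (h : ∀ c, L.circ S (L.dart c 0) = L.circ S (L.dart c 2)) (d d' : D) :
    L.circ S d = L.circ S d' := by
  have hall : ∀ c i, L.circ S (L.dart c i) = L.circ S (L.dart c 0) := by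
    intro c i
    by_cases hc : c ∈ S
    · exact forall_zmod_four (P := fun i => L.circ S (L.dart c i) = L.circ S (L.dart c 0)) rfl
        ((L.circ_one_two hc).trans (h c).symm) (h c).symm (L.circ_three_zero hc) i
    · exact forall_zmod_four (P := fun i => L.circ S (L.dart c i) = L.circ S (L.dart c 0)) rfl
        (L.circ_zero_one hc).symm (h c).symm ((L.circ_two_three hc).symm.trans (h c).symm) i
  have hsub : Subsingleton L.Component := (Nat.card_eq_one_iff_unique.1 hL).1
  have he := Quot.eqvGen_exact (hsub.elim (Quot.mk L.Step d) (Quot.mk L.Step d'))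
  induction he with
  | rel a b hab =>
    cases hab with
    | edge => exact (L.circ_rev S _).symm
    | crossing c i j => rw [hall c i, hall c j]
  | refl => rfl
  | symm _ _ _ ih => exact ih.symm
  | trans _ _ _ _ _ ih1 ih2 => exact ih1.trans ih2

omit hχ in
theorem mem_singleCircle_iff_forall (p : D) :
    S ∈ L.singleCircle ↔ ∀ d d', L.circ S d = L.circ S d' := by
  rw [mem_singleCircle_iff p]
  constructor
  · intro h d d'
    have : ∀ d, L.circ S d = L.circ S p := fun d => not_not.1 fun h' => h ⟨_, h'⟩
    rw [this d, this d']
  · rintro h ⟨C, hC⟩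
    obtain ⟨d, rfl⟩ := L.circ_surjective S C
    exact hC (h _ _)

/-- Each crossing merges the corners of exactly one color, so the complement of the merged set is
the merged set of the other color and both colors are treated alike. -/
theorem bijOn_bridged (p : D) (b : Bool) : Set.BijOn (L.bridged χ b) L.singleCircle
    {T | (L.taitGraph χ hχ b).IsSpanningTree T ∧ (L.taitGraph χ hχ !b).IsSpanningTree Tᶜ} := by
  refine ⟨fun S hS => ?_, (bridged_injective hχ b).injOn, ?_⟩
  · have h := (mem_singleCircle_iff_forall p).1 hS
    refine ⟨isSpanningTree_of_single hχ p h b, ?_⟩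
    rw [← bridged_not hχ]
    exact isSpanningTree_of_single hχ p h !b
  · rintro T ⟨h, h'⟩
    obtain ⟨S, rfl⟩ := exists_bridged_eq hχ b T
    rw [← bridged_not hχ] at h'
    exact ⟨S, (mem_singleCircle_iff_forall p).2 (single_of_isSpanningTree hχ p h h'), rfl⟩

/-- For a connected projection one tree already forces all circles at each crossing to coincide, so
nothing need be asked of the complement. -/
theorem bijOn_bridged_of_isConnected (p : D) (b : Bool) (hL : L.IsConnected) :
    Set.BijOn (L.bridged χ b) L.singleCircle {T | (L.taitGraph χ hχ b).IsSpanningTree T} := by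
  refine ⟨fun S hS => isSpanningTree_of_single hχ p ((mem_singleCircle_iff_forall p).1 hS) b,
    (bridged_injective hχ b).injOn, fun T h => ?_⟩
  obtain ⟨S, rfl⟩ := exists_bridged_eq hχ b T
  exact ⟨S, (mem_singleCircle_iff_forall p).2
    (circ_eq_of_isConnected hL (circ_zero_two_of_isSpanningTree hχ p h)), rfl⟩

end Tait

end LinkDiagram

/-! ### Assembly of the theorem. -/

theorem mainTheorem5 {X D F : Type*} [Fintype X] [DecidableEq X] [Fintype D] [Fintype F]
    (L : LinkDiagram X D F) (p : D) :
    -- `KT(L)` over the fraction field, with its filtration by `|S|`, is a filtered complex,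
    -- and `CT(L)` is a complex
    ∃ (hKT : IsFilteredComplex (L.ktGr p (FaceField F)) (L.ktFil p (FaceField F))
        (L.ktD p (FaceField F)))
      (_ : IsGradedComplex L.ctGr (L.ctD p)),
      -- `CT(L)` is isomorphic, as a graded complex, to a deformation retract of `KT(L)`
      (∃ N : Submodule (FaceField F) (L.KT p (FaceField F)),
        IsDeformationRetract (L.ktGr p (FaceField F)) (L.ktD p (FaceField F)) N ∧
        ∃ e : L.CT ≃ₗ[FaceField F] N,
          (∀ x, (e (L.ctD p x) : L.KT p (FaceField F)) = L.ktD p (FaceField F) (e x)) ∧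
          ∀ n x, x ∈ L.ctGr n ↔ (e x : L.KT p (FaceField F)) ∈ L.ktGr p (FaceField F) n) ∧
      -- the page `E²` with the differential `d₂` is isomorphic to `CT(L)`
      (∃ e : ∀ i n : ℤ,
        SpecPage (L.ktGr p (FaceField F)) (L.ktFil p (FaceField F)) (L.ktD p (FaceField F)) 2 i n
          ≃ₗ[FaceField F] ↥(L.ctLevel i ⊓ L.ctGr n),
        ∀ i n x, (e (i + 2) (n + 2) (hKT.pageD 2 i n x) : L.CT) = L.ctD p (e i n x)) ∧
      -- the spectral sequence collapses at the page `E³`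
      (∀ r : ℤ, 3 ≤ r → ∀ i n, hKT.pageD r i n = 0) ∧
      -- single circle resolutions and spanning trees of the Tait graphs
      (∃ χ : F → Bool, L.IsCheckerboard χ) ∧
      ∀ (χ : F → Bool) (hχ : L.IsCheckerboard χ) (b : Bool),
        Set.BijOn (L.bridged χ b) L.singleCircle
          {T | (L.taitGraph χ hχ b).IsSpanningTree T ∧ (L.taitGraph χ hχ !b).IsSpanningTree Tᶜ} ∧
        (L.IsConnected → Set.BijOn (L.bridged χ b) L.singleCircle
          {T | (L.taitGraph χ hχ b).IsSpanningTree T}) := by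
  refine ⟨L.isFilteredComplex p (FaceField F), L.isGradedComplex_ct p,
    ⟨_, L.isDeformationRetract p, L.exists_equiv_retract p⟩,
    (L.filteredRetraction p).exists_pageEquiv _, (L.filteredRetraction p).pageD_eq_zero _,
    L.exists_isCheckerboard p, fun χ hχ b => ⟨LinkDiagram.bijOn_bridged hχ p b,
      LinkDiagram.bijOn_bridged_of_isConnected hχ p b⟩⟩
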